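/- Let $M$ be a smooth (Hausdorff, second countable) manifold of dimension $n\ge 1$ and let $r\ge 1$. For $k\ge 0$ let $T_kM$ be the $k$-th order tangent bundle, i.e. the manifold of $k$-jets $j^k_0(\gamma)$ of smooth curves $\gamma\colon\mathbb{R}\to M$. Every $f\in C^\infty(M)$ has lifts $f^{(j)}\in C^\infty(T_kM)$, $0\le j\le k$, given by $$f^{(j)}(j^k_0(\gamma))=\frac{1}{j!}\frac{d^j}{dt^j}\Big|_{t=0}f(\gamma(t)).$$ A *weighting of order $r$* on $M$ is a filtration $C^\infty(M)=C^\infty(M)_{(0)}\supseteq C^\infty(M)_{(1)}\supseteq\cdots$ for which $M$ is covered by charts $U$ with coordinates $x_1,\dots,x_n$ and weights $0\le w_1\le\dots\le w_n\le r$ such that $f\in C^\infty(M)_{(i)}$ if and only if, for each chart $U$ of the covering, $f|_U$ lies in the ideal of $C^\infty(U)$ generated by the monomials $\prod_a x_a^{s_a}$ with $\sum_a s_aw_a\ge i$; on the overlap of two charts of the covering the monomials of the two charts of weight $\ge i$ are required to generate the same ideal. The weights are allowed to depend on the chart. A weighting determines the subset $Q\subset T_{r-1}M$ of common zeros of all lifts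 $f^{(i-1)}$ with $1\le i\le r$ and $f\in C^\infty(M)_{(i)}$; we say that $Q$ *is the subset defined by the weighting*. Let $Q\subset T_{r-1}M$ be a closed (embedded) submanifold, possibly empty and possibly with components of different dimensions, and let $\mathcal{I}_Q\subset C^\infty(T_{r-1}M)$ be its vanishing ideal. **(I)** There is a weighting of order $r$ on $M$ such that $Q$ is the subset defined by it, if and only if the following two conditions hold: 1. the ideal $\mathcal{I}_Q$ is generated by functions of the form $f^{(j)}$, with $f\in C^\infty(M)$ and $0\le j\le r-1$; 2. if $f\in C^\infty(M)$ and $f^{(i)}\in\mathcal{I}_Q$, where $0\le i\le r-1$, then $f^{(j)}\in\mathcal{I}_Q$ for all $1\le j\le i$, and the function $f^{(0)}|_Q$ is locally constant. **(II)** If $Q$ is the subset defined by a weighting of order $r$, then the weighting is recovered from $Q$ by $$C^\infty(M)_{(i)}=\{f\in C^\infty(M)\mid f^{(0)}|_Q=0\ \text{and}\ f^{(i-1)}|_Q=0\},\qquad 1\le i\le r.$$ **(III)** If $M$ and $Q$ are connected ($Q$ possibly empty), then (I) also holds for weightings that have the same weights $w_1\le\dots\le w_n$ in all charts of the covering. 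-/

import Mathlib

open Set Filter Topology Manifold ContDiff

set_option linter.unusedSectionVars false

namespace JetWeighting

section Calculus

variable {X F G : Type*} [NormedAddCommGroup X] [NormedSpace ℝ X]
  [NormedAddCommGroup F] [NormedSpace ℝ F] [NormedAddCommGroup G] [NormedSpace ℝ G]

/-- The `k`-jet of `g ∘ c` at `0` only depends on the `k`-jet of `c` at `0`. -/
theorem iteratedDeriv_comp_congr {g : F → G} {c d : ℝ → F} {k : ℕ}
    (hg : ContDiffAt ℝ ∞ g (c 0)) (hc : ContDiffAt ℝ ∞ c 0) (hd : ContDiffAt ℝ ∞ d 0)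
    (h : ∀ j ≤ k, iteratedDeriv j c 0 = iteratedDeriv j d 0) :
    ∀ j ≤ k, iteratedDeriv j (g ∘ c) 0 = iteratedDeriv j (g ∘ d) 0 := by
  intro j hj
  have h0 : c 0 = d 0 := by simpa using h 0 (Nat.zero_le _)
  have hj' : (j : ℕ∞ω) ≤ ∞ := by exact_mod_cast le_top
  rw [iteratedDeriv_eq_iteratedFDeriv, iteratedDeriv_eq_iteratedFDeriv,
    iteratedFDeriv_comp hg hc hj', iteratedFDeriv_comp (h0 ▸ hg) hd hj', ← h0]
  congr 1
  unfold FormalMultilinearSeries.taylorComp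
  refine Finset.sum_congr rfl fun p _ => ?_
  unfold FormalMultilinearSeries.compAlongOrderedFinpartition
  congr 1
  funext m
  have hm : p.partSize m ≤ k := (p.partSize_le m).trans hj
  change iteratedFDeriv ℝ (p.partSize m) c 0 = iteratedFDeriv ℝ (p.partSize m) d 0
  simp only [iteratedFDeriv_eq_equiv_comp, Function.comp_apply, h _ hm]

/-- Derivatives in one variable of a smooth function depend smoothly on the remaining ones. -/
theorem contDiffOn_iteratedDeriv_param (j : ℕ) : ∀ {H : X × ℝ → F} {O : Set (X × ℝ)},
    IsOpen O → ContDiffOn ℝ ∞ H O →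
    ContDiffOn ℝ ∞ (fun x => iteratedDeriv j (fun t => H (x, t)) 0) {x | (x, (0 : ℝ)) ∈ O} := by
  induction j with
  | zero =>
    intro H O _ hH
    simp only [iteratedDeriv_zero]
    exact hH.comp (by fun_prop : ContDiff ℝ ∞ fun x : X => (x, (0 : ℝ))).contDiffOn fun x hx => hx
  | succ j ih =>
    intro H O hO hH
    have hD : ContDiffOn ℝ ∞ (fun q => fderiv ℝ H q (0, 1)) O :=
      (hH.fderiv_of_isOpen hO (m := ∞) (by simp)).clm_apply contDiffOn_const
    refine (ih hO hD).congr fun x hx => ?_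
    rw [iteratedDeriv_succ']
    refine Filter.EventuallyEq.iteratedDeriv_eq _ ?_
    have hc : Continuous fun t : ℝ => (x, t) := by fun_prop
    filter_upwards [hc.continuousAt.preimage_mem_nhds (hO.mem_nhds hx)] with t ht
    have h1 : HasFDerivAt H (fderiv ℝ H (x, t)) (x, t) :=
      ((hH.contDiffAt (hO.mem_nhds ht)).differentiableAt (by simp)).hasFDerivAt
    have h2 : HasDerivAt (fun s : ℝ => (x, s)) ((0 : X), (1 : ℝ)) t :=
      (hasDerivAt_const t x).prodMk (hasDerivAt_id t)
    exact (h1.comp_hasDerivAt t h2).deriv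

/-- The polynomial curve with Taylor coefficients `x 0, …, x k`. -/
noncomputable def polyCurve {k : ℕ} (x : Fin (k + 1) → F) (t : ℝ) : F :=
  ∑ i : Fin (k + 1), t ^ (i : ℕ) • x i

theorem contDiff_polyCurve {k : ℕ} :
    ContDiff ℝ ∞ fun q : (Fin (k + 1) → F) × ℝ => polyCurve q.1 q.2 := by
  unfold polyCurve
  fun_prop

theorem polyCurve_zero {k : ℕ} (x : Fin (k + 1) → F) : polyCurve x 0 = x 0 := by
  unfold polyCurve
  rw [Finset.sum_eq_single 0]
  · simp
  · intro b _ hb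
    have : (b : ℕ) ≠ 0 := fun h => hb (Fin.ext h)
    rw [zero_pow this, zero_smul]
  · simp

theorem iteratedDeriv_polyCurve {k : ℕ} (x : Fin (k + 1) → F) (j : Fin (k + 1)) :
    iteratedDeriv j (polyCurve x) 0 = (Nat.factorial j : ℝ) • x j := by
  unfold polyCurve
  rw [iteratedDeriv_fun_sum (fun i _ => by fun_prop)]
  rw [Finset.sum_eq_single j]
  · rw [iteratedDeriv_smul_const (by fun_prop), iteratedDeriv_fun_pow_zero]
    simp
  · intro b _ hb
    rw [iteratedDeriv_smul_const (by fun_prop), iteratedDeriv_fun_pow_zero]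
    have : (b : ℕ) ≠ j := fun h => hb (Fin.ext h)
    simp [this.symm]
  · simp

theorem contDiff_polyCurve_right {k : ℕ} (x : Fin (k + 1) → F) : ContDiff ℝ ∞ (polyCurve x) := by
  unfold polyCurve
  fun_prop

/-- A smooth function of one variable that is the identity near `0` and has small values. -/
theorem exists_reparam {ε : ℝ} (hε : 0 < ε) :
    ∃ τ : ℝ → ℝ, ContDiff ℝ ∞ τ ∧ τ =ᶠ[𝓝 0] id ∧ ∀ t, |τ t| < ε := by
  let b : ContDiffBump (0 : ℝ) := ⟨ε / 2, ε, by positivity, by linarith⟩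
  refine ⟨fun t => b t * t, b.contDiff.mul contDiff_id, ?_, fun t => ?_⟩
  · filter_upwards [b.eventuallyEq_one] with t ht
    simp [ht]
  · by_cases ht : b.rOut ≤ dist t 0
    · simp [b.zero_of_le_dist ht, hε]
    · have ht' : |t| < ε := by simpa [b] using ht
      calc |b t * t| = b t * |t| := by rw [abs_mul, abs_of_nonneg b.nonneg]
        _ ≤ 1 * |t| := by gcongr; exact b.le_one
        _ < ε := by simpa using ht'

end Calculus

section Jets

/-- Smooth curves `ℝ → M` in an `n`-dimensional manifold `M`. -/
abbrev Curve (n : ℕ) (M : Type*) [TopologicalSpace M] [ChartedSpace (EuclideanSpace ℝ (Fin n)) M] :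
    Type _ :=
  C^∞⟮𝓘(ℝ, ℝ), ℝ; 𝓡 n, M⟯

/-- Smooth real functions on an `n`-dimensional manifold `M`. -/
abbrev Func (n : ℕ) (M : Type*) [TopologicalSpace M] [ChartedSpace (EuclideanSpace ℝ (Fin n)) M] :
    Type _ :=
  C^∞⟮𝓡 n, M; 𝓘(ℝ, ℝ), ℝ⟯

variable (n : ℕ) (M : Type*) [TopologicalSpace M] [ChartedSpace (EuclideanSpace ℝ (Fin n)) M]

/-- Two smooth curves have the same `k`-jet at `0`: same value, and, in a chart at that value,
the same derivatives at `0` up to order `k`. -/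
noncomputable def jetSetoid (k : ℕ) : Setoid (Curve n M) where
  r γ δ := γ 0 = δ 0 ∧ ∀ j ≤ k,
    iteratedDeriv j (chartAt (EuclideanSpace ℝ (Fin n)) (γ 0) ∘ γ) 0 =
      iteratedDeriv j (chartAt (EuclideanSpace ℝ (Fin n)) (γ 0) ∘ δ) 0
  iseqv :=
    { refl := fun _ => ⟨rfl, fun _ _ => rfl⟩
      symm := fun h => ⟨h.1.symm, fun j hj => by rw [← h.1]; exact (h.2 j hj).symm⟩
      trans := fun h h' => ⟨h.1.trans h'.1, fun j hj =>
        (h.2 j hj).trans (by rw [h.1]; exact h'.2 j hj)⟩ }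

/-- The `k`-th order tangent bundle `T_k M`, the set of `k`-jets at `0` of smooth curves in `M`. -/
def JetBundle (k : ℕ) : Type _ := Quotient (jetSetoid n M k)

variable {n M} {k : ℕ}

/-- The `k`-jet at `0` of a smooth curve. -/
noncomputable def jet (k : ℕ) (γ : Curve n M) : JetBundle n M k := Quotient.mk (jetSetoid n M k) γ

/-- The bundle projection `T_k M → M`. -/
noncomputable def JetBundle.base (u : JetBundle n M k) : M :=
  Quotient.lift (s := jetSetoid n M k) (fun γ : Curve n M => γ 0) (fun _ _ h => h.1) u

@[simp] theorem base_jet (γ : Curve n M) : (jet k γ).base = γ 0 := rfl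

theorem exists_jet (u : JetBundle n M k) : ∃ γ : Curve n M, jet k γ = u := Quotient.exists_rep u

theorem jet_eq_iff {γ δ : Curve n M} : jet k γ = jet k δ ↔ γ 0 = δ 0 ∧ ∀ j ≤ k,
    iteratedDeriv j (chartAt (EuclideanSpace ℝ (Fin n)) (γ 0) ∘ γ) 0 =
      iteratedDeriv j (chartAt (EuclideanSpace ℝ (Fin n)) (γ 0) ∘ δ) 0 :=
  Quotient.eq (r := jetSetoid n M k)

variable [IsManifold (𝓡 n) ∞ M]

theorem contDiffAt_chart_comp {e : OpenPartialHomeomorph M (EuclideanSpace ℝ (Fin n))}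
    (he : e ∈ IsManifold.maximalAtlas (𝓡 n) ∞ M) (γ : Curve n M) (h : γ 0 ∈ e.source) :
    ContDiffAt ℝ ∞ (e ∘ γ) 0 :=
  ((contMDiffAt_of_mem_maximalAtlas he h).comp (0 : ℝ) γ.contMDiff.contMDiffAt).contDiffAt

theorem comp_eventuallyEq {e : OpenPartialHomeomorph M (EuclideanSpace ℝ (Fin n))}
    {A : Type*} (f : M → A) (γ : Curve n M) (h : γ 0 ∈ e.source) :
    f ∘ γ =ᶠ[𝓝 (0 : ℝ)] (f ∘ e.symm) ∘ (e ∘ γ) := by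
  have hγ : Continuous γ := γ.contMDiff.continuous
  filter_upwards [hγ.continuousAt.preimage_mem_nhds (e.open_source.mem_nhds h)] with t ht
  simp [e.left_inv ht]

/-- If two curves have the same `k`-jet in one chart, then so do their images under any map that
is smooth near the base point. -/
theorem iteratedDeriv_congr_of_chart {e : OpenPartialHomeomorph M (EuclideanSpace ℝ (Fin n))}
    (he : e ∈ IsManifold.maximalAtlas (𝓡 n) ∞ M) {G : Type*} [NormedAddCommGroup G]
    [NormedSpace ℝ G] {f : M → G} {γ δ : Curve n M} (hγ : γ 0 ∈ e.source) (hδ : δ 0 ∈ e.source)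
    (hf : ContMDiffAt (𝓡 n) 𝓘(ℝ, G) ∞ f (γ 0))
    (h : ∀ j ≤ k, iteratedDeriv j (e ∘ γ) 0 = iteratedDeriv j (e ∘ δ) 0) :
    ∀ j ≤ k, iteratedDeriv j (f ∘ γ) 0 = iteratedDeriv j (f ∘ δ) 0 := by
  intro j hj
  rw [(comp_eventuallyEq f γ hγ).iteratedDeriv_eq, (comp_eventuallyEq f δ hδ).iteratedDeriv_eq]
  refine iteratedDeriv_comp_congr (k := k) ?_ (contDiffAt_chart_comp he γ hγ)
    (contDiffAt_chart_comp he δ hδ) h j hj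
  have h1 : ContMDiffAt (𝓡 n) (𝓡 n) ∞ e.symm (e (γ 0)) :=
    contMDiffAt_symm_of_mem_maximalAtlas he (e.map_source hγ)
  have h2 : ContMDiffAt (𝓡 n) 𝓘(ℝ, G) ∞ f (e.symm (e (γ 0))) := by rwa [e.left_inv hγ]
  exact (h2.comp _ h1).contDiffAt

theorem iteratedDeriv_congr_of_jet_eq {G : Type*} [NormedAddCommGroup G]
    [NormedSpace ℝ G] {f : M → G} {γ δ : Curve n M}
    (hf : ContMDiffAt (𝓡 n) 𝓘(ℝ, G) ∞ f (γ 0)) (h : jet k γ = jet k δ) :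
    ∀ j ≤ k, iteratedDeriv j (f ∘ γ) 0 = iteratedDeriv j (f ∘ δ) 0 := by
  rw [jet_eq_iff] at h
  refine iteratedDeriv_congr_of_chart (IsManifold.chart_mem_maximalAtlas (γ 0))
    (mem_chart_source _ _) ?_ hf h.2
  rw [← h.1]
  exact mem_chart_source _ _

/-- The jets of two curves agree as soon as they agree in one chart. -/
theorem jet_eq_of_chart {e : OpenPartialHomeomorph M (EuclideanSpace ℝ (Fin n))}
    (he : e ∈ IsManifold.maximalAtlas (𝓡 n) ∞ M) {γ δ : Curve n M}
    (hγ : γ 0 ∈ e.source) (hδ : δ 0 ∈ e.source)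
    (h : ∀ j ≤ k, iteratedDeriv j (e ∘ γ) 0 = iteratedDeriv j (e ∘ δ) 0) :
    jet k γ = jet k δ := by
  rw [jet_eq_iff]
  have h0 : e (γ 0) = e (δ 0) := by simpa using h 0 (Nat.zero_le _)
  exact ⟨e.injOn hγ hδ h0, iteratedDeriv_congr_of_chart he hγ hδ
    (contMDiffAt_of_mem_maximalAtlas (IsManifold.chart_mem_maximalAtlas (γ 0))
      (mem_chart_source _ _)) h⟩

/-- The `j`-th lift of a function on `M`, as a function on `T_k M`:
`f^{(j)} (jet of γ) = (1 / j!) (d/dt)^j f (γ t)` at `t = 0`. -/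
noncomputable def liftFun (f : Func n M) (j : Fin (k + 1)) (u : JetBundle n M k) : ℝ :=
  Quotient.lift (s := jetSetoid n M k)
    (fun γ : Curve n M => ((Nat.factorial j : ℝ))⁻¹ * iteratedDeriv j (f ∘ γ) 0)
    (fun γ δ h => by
      have h' : jet k γ = jet k δ := Quotient.sound h
      simp only [iteratedDeriv_congr_of_jet_eq f.contMDiff.contMDiffAt h' j
        (Nat.lt_succ_iff.mp j.2)]) u

theorem liftFun_jet (f : Func n M) (j : Fin (k + 1)) (γ : Curve n M) :
    liftFun f j (jet k γ) = ((Nat.factorial j : ℝ))⁻¹ * iteratedDeriv j (f ∘ γ) 0 := rfl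

/-- The coordinates on `T_k M` induced by a chart `e` of `M`: the Taylor coefficients of order
`≤ k` of the curve in the chart. -/
noncomputable def jetCoord (e : OpenPartialHomeomorph M (EuclideanSpace ℝ (Fin n)))
    (u : JetBundle n M k) (j : Fin (k + 1)) : EuclideanSpace ℝ (Fin n) :=
  ((Nat.factorial j : ℝ))⁻¹ • iteratedDeriv j (e ∘ (exists_jet u).choose) 0

theorem jetCoord_jet {e : OpenPartialHomeomorph M (EuclideanSpace ℝ (Fin n))}
    (he : e ∈ IsManifold.maximalAtlas (𝓡 n) ∞ M) (γ : Curve n M) (h : γ 0 ∈ e.source)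
    (j : Fin (k + 1)) :
    jetCoord e (jet k γ) j = ((Nat.factorial j : ℝ))⁻¹ • iteratedDeriv j (e ∘ γ) 0 := by
  unfold jetCoord
  have h' := (exists_jet (jet k γ)).choose_spec
  rw [iteratedDeriv_congr_of_jet_eq (contMDiffAt_of_mem_maximalAtlas he h) h'.symm j
    (Nat.lt_succ_iff.mp j.2)]

theorem jetCoord_zero {e : OpenPartialHomeomorph M (EuclideanSpace ℝ (Fin n))}
    (he : e ∈ IsManifold.maximalAtlas (𝓡 n) ∞ M) (u : JetBundle n M k) (h : u.base ∈ e.source) :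
    jetCoord e u 0 = e u.base := by
  obtain ⟨γ, rfl⟩ := exists_jet u
  rw [jetCoord_jet he γ h]
  simp

/-- A smooth curve with prescribed Taylor coefficients in a chart. -/
theorem exists_curve {e : OpenPartialHomeomorph M (EuclideanSpace ℝ (Fin n))}
    (he : e ∈ IsManifold.maximalAtlas (𝓡 n) ∞ M) (x : Fin (k + 1) → EuclideanSpace ℝ (Fin n))
    (hx : x 0 ∈ e.target) :
    ∃ γ : Curve n M, γ 0 = e.symm (x 0) ∧ e ∘ γ =ᶠ[𝓝 (0 : ℝ)] polyCurve x := by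
  have hc : Continuous (polyCurve x) := (contDiff_polyCurve_right x).continuous
  have hO : polyCurve x ⁻¹' e.target ∈ 𝓝 (0 : ℝ) :=
    hc.continuousAt.preimage_mem_nhds (e.open_target.mem_nhds (by rwa [polyCurve_zero]))
  obtain ⟨ε, hε, hsub⟩ := Metric.mem_nhds_iff.mp hO
  obtain ⟨τ, hτ, hτ0, hτε⟩ := exists_reparam hε
  have hmem : ∀ t, polyCurve x (τ t) ∈ e.target := fun t => hsub (by simpa using hτε t)
  have hsm : ContMDiff 𝓘(ℝ, ℝ) (𝓡 n) ∞ fun t => e.symm (polyCurve x (τ t)) :=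
    (contMDiffOn_symm_of_mem_maximalAtlas he).comp_contMDiff
      ((contDiff_polyCurve_right x).comp hτ).contMDiff hmem
  refine ⟨⟨_, hsm⟩, ?_, ?_⟩
  · have : τ 0 = 0 := hτ0.self_of_nhds
    change e.symm (polyCurve x (τ 0)) = _
    rw [this, polyCurve_zero]
  · filter_upwards [hτ0] with t ht
    change e (e.symm (polyCurve x (τ t))) = _
    rw [e.right_inv (hmem t), ht, id]

theorem bijOn_jetCoord {e : OpenPartialHomeomorph M (EuclideanSpace ℝ (Fin n))}
    (he : e ∈ IsManifold.maximalAtlas (𝓡 n) ∞ M) :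
    BijOn (jetCoord (k := k) e) {u | u.base ∈ e.source} {x | x 0 ∈ e.target} := by
  refine ⟨fun u hu => ?_, fun u hu v hv h => ?_, fun x hx => ?_⟩
  · change jetCoord e u 0 ∈ e.target
    rw [jetCoord_zero he u hu]
    exact e.map_source hu
  · obtain ⟨γ, rfl⟩ := exists_jet u
    obtain ⟨δ, rfl⟩ := exists_jet v
    refine jet_eq_of_chart he hu hv fun j hj => ?_
    have h' := congrFun h ⟨j, Nat.lt_succ_of_le hj⟩
    rw [jetCoord_jet he γ hu, jetCoord_jet he δ hv] at h'
    exact smul_right_injective _ (inv_ne_zero (Nat.cast_ne_zero.mpr (Nat.factorial_ne_zero j))) h'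
  · obtain ⟨γ, h0, hγ⟩ := exists_curve he x hx
    have hs : γ 0 ∈ e.source := h0 ▸ e.map_target hx
    refine ⟨jet k γ, hs, funext fun j => ?_⟩
    rw [jetCoord_jet he γ hs, hγ.iteratedDeriv_eq, iteratedDeriv_polyCurve, smul_smul,
      inv_mul_cancel₀ (Nat.cast_ne_zero.mpr (Nat.factorial_ne_zero _)), one_smul]

theorem nonempty_jetBundle (e : OpenPartialHomeomorph M (EuclideanSpace ℝ (Fin n))) :
    Nonempty (JetBundle n M k) :=
  ⟨jet k ⟨fun _ => e.symm 0, contMDiff_const⟩⟩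

/-- The chart of `T_k M` induced by a chart of `M`. -/
noncomputable def jetChart (k : ℕ) (e : OpenPartialHomeomorph M (EuclideanSpace ℝ (Fin n)))
    (he : e ∈ IsManifold.maximalAtlas (𝓡 n) ∞ M) :
    PartialEquiv (JetBundle n M k) (Fin (k + 1) → EuclideanSpace ℝ (Fin n)) :=
  haveI : Nonempty (JetBundle n M k) := nonempty_jetBundle e
  (bijOn_jetCoord he).toPartialEquiv (jetCoord e) {u | u.base ∈ e.source} {x | x 0 ∈ e.target}

/-- Reading smooth data on `M` along the jets of a chart depends smoothly on the jet. -/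
theorem contDiffOn_read {e : OpenPartialHomeomorph M (EuclideanSpace ℝ (Fin n))}
    (he : e ∈ IsManifold.maximalAtlas (𝓡 n) ∞ M) {G : Type*} [NormedAddCommGroup G]
    [NormedSpace ℝ G] {f : M → G} {U : Set M} (hU : IsOpen U)
    (hf : ContMDiffOn (𝓡 n) 𝓘(ℝ, G) ∞ f U) (j : ℕ) :
    ContDiffOn ℝ ∞
      (fun x : Fin (k + 1) → EuclideanSpace ℝ (Fin n) =>
        iteratedDeriv j (fun t => f (e.symm (polyCurve x t))) 0)
      {x | x 0 ∈ e.target ∧ e.symm (x 0) ∈ U} := by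
  have hV : IsOpen (e.target ∩ e.symm ⁻¹' U) := e.isOpen_inter_preimage_symm hU
  have hV' : MapsTo e.symm (e.target ∩ e.symm ⁻¹' U) U := fun _ hy => hy.2
  have hfe : ContDiffOn ℝ ∞ (f ∘ e.symm) (e.target ∩ e.symm ⁻¹' U) :=
    (hf.comp ((contMDiffOn_symm_of_mem_maximalAtlas he).mono inter_subset_left)
      hV').contDiffOn
  have hp := contDiff_polyCurve (F := EuclideanSpace ℝ (Fin n)) (k := k)
  have := contDiffOn_iteratedDeriv_param j
    (H := fun q : (Fin (k + 1) → EuclideanSpace ℝ (Fin n)) × ℝ => f (e.symm (polyCurve q.1 q.2)))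
    (hV.preimage hp.continuous) (hfe.comp hp.contDiffOn (mapsTo_preimage _ _))
  refine this.mono fun x hx => ?_
  change polyCurve x 0 ∈ e.target ∩ e.symm ⁻¹' U
  rw [polyCurve_zero]
  exact hx

theorem jetChart_symm_spec {e : OpenPartialHomeomorph M (EuclideanSpace ℝ (Fin n))}
    (he : e ∈ IsManifold.maximalAtlas (𝓡 n) ∞ M) (x : Fin (k + 1) → EuclideanSpace ℝ (Fin n))
    (hx : x 0 ∈ e.target) :
    ∃ γ : Curve n M, γ 0 = e.symm (x 0) ∧ e ∘ γ =ᶠ[𝓝 (0 : ℝ)] polyCurve x ∧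
      (jetChart k e he).symm x = jet k γ := by
  obtain ⟨γ, h0, hγ⟩ := exists_curve he x hx
  have hs : γ 0 ∈ e.source := h0 ▸ e.map_target hx
  refine ⟨γ, h0, hγ, ?_⟩
  have hx' : jetChart k e he (jet k γ) = x := funext fun j => by
    change jetCoord e (jet k γ) j = x j
    rw [jetCoord_jet he γ hs, hγ.iteratedDeriv_eq, iteratedDeriv_polyCurve, smul_smul,
      inv_mul_cancel₀ (Nat.cast_ne_zero.mpr (Nat.factorial_ne_zero _)), one_smul]
  rw [← hx']
  exact (jetChart k e he).left_inv hs

theorem iteratedDeriv_read {e : OpenPartialHomeomorph M (EuclideanSpace ℝ (Fin n))} {A : Type*}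
    [NormedAddCommGroup A] [NormedSpace ℝ A] (f : M → A)
    {x : Fin (k + 1) → EuclideanSpace ℝ (Fin n)} {γ : Curve n M} (h : γ 0 ∈ e.source)
    (hγ : e ∘ γ =ᶠ[𝓝 (0 : ℝ)] polyCurve x) (j : ℕ) :
    iteratedDeriv j (f ∘ γ) 0 = iteratedDeriv j (fun t => f (e.symm (polyCurve x t))) 0 := by
  refine Filter.EventuallyEq.iteratedDeriv_eq _ ?_
  filter_upwards [comp_eventuallyEq f γ h, hγ] with t h1 h2
  rw [h1]
  simp only [Function.comp_apply] at h2 ⊢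
  rw [h2]

theorem jetChart_trans_source {e e' : OpenPartialHomeomorph M (EuclideanSpace ℝ (Fin n))}
    (he : e ∈ IsManifold.maximalAtlas (𝓡 n) ∞ M) (he' : e' ∈ IsManifold.maximalAtlas (𝓡 n) ∞ M) :
    ((jetChart k e he).symm.trans (jetChart k e' he')).source =
      {x | x 0 ∈ e.target ∧ e.symm (x 0) ∈ e'.source} := by
  ext x
  rw [PartialEquiv.trans_source]
  change (x 0 ∈ e.target ∧ ((jetChart k e he).symm x).base ∈ e'.source) ↔ _
  refine and_congr_right fun hx => ?_
  obtain ⟨γ, h0, -, h⟩ := jetChart_symm_spec he x hx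
  rw [h, base_jet, h0]

theorem contDiffOn_jetChart_trans {e e' : OpenPartialHomeomorph M (EuclideanSpace ℝ (Fin n))}
    (he : e ∈ IsManifold.maximalAtlas (𝓡 n) ∞ M) (he' : e' ∈ IsManifold.maximalAtlas (𝓡 n) ∞ M) :
    ContDiffOn ℝ ∞ ((jetChart k e he).symm.trans (jetChart k e' he'))
      ((jetChart k e he).symm.trans (jetChart k e' he')).source := by
  rw [jetChart_trans_source, contDiffOn_pi]
  intro j
  refine ((contDiffOn_read he e'.open_source (contMDiffOn_of_mem_maximalAtlas he') j).const_smul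
    ((Nat.factorial j : ℝ))⁻¹).congr ?_
  rintro x ⟨hx, hx'⟩
  obtain ⟨γ, h0, hγ, h⟩ := jetChart_symm_spec he x hx
  change jetCoord e' ((jetChart k e he).symm x) j = _
  rw [h, jetCoord_jet he' γ (h0 ▸ hx'), iteratedDeriv_read e' (h0 ▸ e.map_target hx) hγ]

variable (n M k) in
/-- The charts of `T_k M` induced by the charts of `M`; they make `T_k M` a manifold. -/
noncomputable def jetCore :
    ChartedSpaceCore (Fin (k + 1) → EuclideanSpace ℝ (Fin n)) (JetBundle n M k) where
  atlas := {c | ∃ e, ∃ he : e ∈ atlas (EuclideanSpace ℝ (Fin n)) M,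
    c = jetChart k e (IsManifold.subset_maximalAtlas he)}
  chartAt u := jetChart k (chartAt _ u.base) (IsManifold.chart_mem_maximalAtlas u.base)
  mem_chart_source u := mem_chart_source _ u.base
  chart_mem_atlas u := ⟨_, chart_mem_atlas _ u.base, rfl⟩
  open_source := by
    rintro _ _ ⟨e, he, rfl⟩ ⟨e', he', rfl⟩
    rw [jetChart_trans_source]
    exact (e.isOpen_inter_preimage_symm e'.open_source).preimage
      (continuous_apply (A := fun _ => EuclideanSpace ℝ (Fin n)) (0 : Fin (k + 1)))
  continuousOn_toFun := by
    rintro _ _ ⟨e, he, rfl⟩ ⟨e', he', rfl⟩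
    exact (contDiffOn_jetChart_trans _ _).continuousOn

noncomputable instance : TopologicalSpace (JetBundle n M k) := (jetCore n M k).toTopologicalSpace

noncomputable instance :
    ChartedSpace (Fin (k + 1) → EuclideanSpace ℝ (Fin n)) (JetBundle n M k) :=
  (jetCore n M k).toChartedSpace

instance : IsManifold 𝓘(ℝ, Fin (k + 1) → EuclideanSpace ℝ (Fin n)) ∞ (JetBundle n M k) := by
  refine isManifold_of_contDiffOn _ _ _ fun c c' hc hc' => ?_
  obtain ⟨_, ⟨_, rfl⟩, hc⟩ := hc
  simp only [mem_iUnion, mem_singleton_iff] at hc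
  obtain ⟨⟨e, he, h1⟩, rfl⟩ := hc
  obtain ⟨_, ⟨_, rfl⟩, hc'⟩ := hc'
  simp only [mem_iUnion, mem_singleton_iff] at hc'
  obtain ⟨⟨e', he', h1'⟩, rfl⟩ := hc'
  subst h1 h1'
  have := contDiffOn_jetChart_trans (k := k) (IsManifold.subset_maximalAtlas (I := 𝓡 n) (n := ∞) he)
    (IsManifold.subset_maximalAtlas (I := 𝓡 n) (n := ∞) he')
  simp only [modelWithCornersSelf_coe, modelWithCornersSelf_coe_symm, Function.comp_id,
    Function.id_comp, preimage_id, range_id, inter_univ]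
  exact this

end Jets

section Weightings

variable {n : ℕ} {M : Type*} [TopologicalSpace M] [ChartedSpace (EuclideanSpace ℝ (Fin n)) M]
  [IsManifold (𝓡 n) ∞ M] {k : ℕ}

variable (n M k) in
/-- Smooth real functions on `T_k M`. -/
abbrev JetFunc : Type _ :=
  C^∞⟮𝓘(ℝ, Fin (k + 1) → EuclideanSpace ℝ (Fin n)), JetBundle n M k; 𝓘(ℝ, ℝ), ℝ⟯

theorem contMDiff_liftFun (f : Func n M) (j : Fin (k + 1)) :
    ContMDiff 𝓘(ℝ, Fin (k + 1) → EuclideanSpace ℝ (Fin n)) 𝓘(ℝ, ℝ) ∞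
      (liftFun (k := k) f j) := by
  intro u
  have hu : u ∈ (chartAt (Fin (k + 1) → EuclideanSpace ℝ (Fin n)) u).source := mem_chart_source _ u
  refine ContMDiffOn.contMDiffAt (s := (chartAt _ u).source) ?_
    ((chartAt (Fin (k + 1) → EuclideanSpace ℝ (Fin n)) u).open_source.mem_nhds hu)
  rw [contMDiffOn_iff_of_mem_maximalAtlas' (e' := chartAt ℝ (0 : ℝ))
    (IsManifold.chart_mem_maximalAtlas u) (IsManifold.chart_mem_maximalAtlas (0 : ℝ))
    subset_rfl (by intro x _; rw [chartAt_self_eq]; exact mem_univ _)]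
  have he := IsManifold.chart_mem_maximalAtlas (I := 𝓡 n) (n := ∞) u.base
  have key := (contDiffOn_read (k := k) he isOpen_univ f.contMDiff.contMDiffOn j).const_smul
    ((Nat.factorial j : ℝ))⁻¹
  refine (key.mono ?_).congr ?_
  · rintro _ ⟨v, hv, rfl⟩
    exact ⟨(jetChart k _ he).map_source hv, mem_univ _⟩
  · rintro _ ⟨v, hv, rfl⟩
    have hx := (jetChart k _ he).map_source hv
    obtain ⟨γ, h0, hγ, h⟩ := jetChart_symm_spec he (jetChart k _ he v) hx
    change liftFun f j ((jetChart k _ he).symm (jetChart k _ he v)) = ((Nat.factorial j : ℝ))⁻¹ •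
      iteratedDeriv j (fun t => f ((chartAt _ u.base).symm (polyCurve (jetChart k _ he v) t))) 0
    rw [h, liftFun_jet, iteratedDeriv_read f (h0 ▸ OpenPartialHomeomorph.map_target _ hx) hγ,
      smul_eq_mul]

/-- The lift `f^{(j)} ∈ C^∞(T_k M)`, for `j ≤ k`, of `f ∈ C^∞(M)`. -/
noncomputable def lift (f : Func n M) (j : Fin (k + 1)) : JetFunc n M k :=
  ⟨liftFun f j, contMDiff_liftFun f j⟩

/-- The vanishing ideal of a subset of `T_k M`. -/
noncomputable def vanishingIdeal (Q : Set (JetBundle n M k)) : Ideal (JetFunc n M k) where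
  carrier := {g | ∀ u ∈ Q, g u = 0}
  zero_mem' := fun _ _ => rfl
  add_mem' := fun {g h} hg hh u hu => by
    change g u + h u = 0
    rw [hg u hu, hh u hu, add_zero]
  smul_mem' := fun c g hg u hu => by
    change c u * g u = 0
    rw [hg u hu, mul_zero]

/-- Embedded submanifolds of `T_k M`: near each of its points, `Q` is a linear subspace in a
suitable chart of the smooth structure. -/
def IsSubmanifold (Q : Set (JetBundle n M k)) : Prop :=
  ∀ u ∈ Q, ∃ c ∈ IsManifold.maximalAtlas 𝓘(ℝ, Fin (k + 1) → EuclideanSpace ℝ (Fin n)) ∞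
    (JetBundle n M k), u ∈ c.source ∧
      ∃ V : Submodule ℝ (Fin (k + 1) → EuclideanSpace ℝ (Fin n)), ∀ v ∈ c.source, v ∈ Q ↔ c v ∈ V

/-- The ideal of `C^∞(V)`, for `V` inside the domain of the chart `e`, generated by the monomials
`∏ x_a ^ s_a` of weight `∑ s_a w_a ≥ i` in the coordinates `x_a` of `e`. -/
noncomputable def monomialIdeal (e : OpenPartialHomeomorph M (EuclideanSpace ℝ (Fin n)))
    (w : Fin n → ℕ) (i : ℕ) (V : TopologicalSpace.Opens M) : Ideal C^∞⟮𝓡 n, V; 𝓘(ℝ, ℝ), ℝ⟯ :=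
  Ideal.span {g | ∃ s : Fin n → ℕ, i ≤ ∑ a, s a * w a ∧ ∀ x : V, g x = ∏ a, (e x) a ^ s a}

/-- The domain of a chart, as an open set. -/
def chartDomain (e : OpenPartialHomeomorph M (EuclideanSpace ℝ (Fin n))) :
    TopologicalSpace.Opens M :=
  ⟨e.source, e.open_source⟩

/-- Restriction of smooth functions to an open subset. -/
noncomputable def restrictTo (V : TopologicalSpace.Opens M) (f : Func n M) :
    C^∞⟮𝓡 n, V; 𝓘(ℝ, ℝ), ℝ⟯ :=
  ⟨fun x => f x, f.contMDiff.comp contMDiff_subtype_val⟩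

/-- `A` is a covering of `M` by weighted charts, the chart `e` having the weights
`0 ≤ w e 1 ≤ … ≤ w e n ≤ r`, for the filtration `F 0 ⊇ F 1 ⊇ …` of `C^∞(M)`: a function is in
`F i` if and only if its restriction to each chart domain is in the ideal generated by the
monomials of weight `≥ i`. The filtration is one of the sheaf of smooth functions, so on the
overlap of two of the charts both must give the same ideals. -/
structure IsWeightedCovering (r : ℕ) (F : ℕ → Ideal (Func n M))
    (A : Set (OpenPartialHomeomorph M (EuclideanSpace ℝ (Fin n))))
    (w : OpenPartialHomeomorph M (EuclideanSpace ℝ (Fin n)) → Fin n → ℕ) : Prop where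
  mem_maximalAtlas : ∀ e ∈ A, e ∈ IsManifold.maximalAtlas (𝓡 n) ∞ M
  covers : ∀ p : M, ∃ e ∈ A, p ∈ e.source
  monotone : ∀ e ∈ A, Monotone (w e)
  le_order : ∀ e ∈ A, ∀ a, w e a ≤ r
  agree : ∀ e ∈ A, ∀ e' ∈ A, ∀ i,
    monomialIdeal e (w e) i (chartDomain e ⊓ chartDomain e') =
      monomialIdeal e' (w e') i (chartDomain e ⊓ chartDomain e')
  mem_iff : ∀ i f, f ∈ F i ↔
    ∀ e ∈ A, restrictTo (chartDomain e) f ∈ monomialIdeal e (w e) i (chartDomain e)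

/-- `F` is a weighting of order `r` on `M`, where the weights may be different at different
connected components of the submanifold along which `M` is weighted. -/
def IsWeighting (r : ℕ) (F : ℕ → Ideal (Func n M)) : Prop :=
  ∃ A w, IsWeightedCovering r F A w

/-- `F` is a weighting of order `r` on `M` with the same weights `w` everywhere. -/
def IsWeightingWithWeights (r : ℕ) (w : Fin n → ℕ) (F : ℕ → Ideal (Func n M)) : Prop :=
  ∃ A, IsWeightedCovering r F A (fun _ => w)

/-- The subset of `T_k M` cut out by the lifts `f^{(i-1)}` of the functions `f` of filtration
degree `i ≤ k + 1` (here `i = j + 1`). -/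
def cutOut (k : ℕ) (F : ℕ → Ideal (Func n M)) : Set (JetBundle n M k) :=
  {u | ∀ j : Fin (k + 1), ∀ f ∈ F (j + 1), lift f j u = 0}

/-- The vanishing ideal of `Q` is generated by lifts of functions on `M`. -/
def GeneratedByLifts (Q : Set (JetBundle n M k)) : Prop :=
  vanishingIdeal Q =
    Ideal.span {g | g ∈ vanishingIdeal Q ∧ ∃ (f : Func n M) (j : Fin (k + 1)), g = lift f j}

/-- If `f^{(i)}` vanishes on `Q`, then so do all `f^{(j)}` with `j ≤ i`, up to adding to `f` a
locally constant function, which the lifts `f^{(j)}` with `j ≥ 1` do not see: for `j = 0`, the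
function `f^{(0)}` is only required to be locally constant on `Q`. -/
def LowerLiftsVanish (Q : Set (JetBundle n M k)) : Prop :=
  ∀ (f : Func n M) (i : Fin (k + 1)), lift f i ∈ vanishingIdeal Q →
    (∀ j : Fin (k + 1), 1 ≤ (j : ℕ) → j ≤ i → lift f j ∈ vanishingIdeal Q) ∧
      IsLocallyConstant fun u : Q => lift f (0 : Fin (k + 1)) (u : JetBundle n M k)

end Weightings

end JetWeighting

open JetWeighting

/-! Put `k = r - 1`. Everything is tested along curves. Given a chart with weights `w`, a curve is
weighted if its `a`-th coordinate vanishes to order `w a` at `0`; since `w a ≤ k + 1`, this depends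
only on the `k`-jet. The core is `mem_monomialIdeal_iff`: the ideal generated by the monomials of
weight `≥ i` consists of the functions that vanish to order `i` along all weighted curves. One
direction is multiplicativity of orders. The other removes the coordinates of positive weight one at
a time by Hadamard's lemma and divides by them with `WeightedOrder.of_mul`. Hence `Q` is defined by
a weighting exactly when `M` is covered by adapted charts (`IsAdapted`), over which `Q` consists of
the jets of weighted curves. The weighting is then `curveOrderIdeal Q`, the filtration by order of
vanishing along the curves with jet in `Q`.

Adapted charts imply both conditions. Weighted curves stay weighted under changes of parameter
fixing `0`, and if a Taylor coefficient vanishes after every such change, so do all lower ones of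
positive order (`coeff_tser_eq_zero_of_reparam`). Local constancy follows by integrating along lines
in the coordinate plane that is the base of `Q`. For generation, the vanishing ideal is locally
generated by lifts of localized coordinates. An ideal admits only finite sums, so
`exists_generators` supplies finitely many global functions generating `curveOrderIdeal Q i` at all
points: general position bounds the number of generators over a compact set independently of that
set, and generators over disjoint shells of an exhaustion are glued. The Leibniz rule carries this
over to lifts.

Conversely, generation and closedness make `Q` the zero set of lifts. These are homogeneous under `t
↦ c t`, so `Q` is stable under scaling and contains the constant jet below each of its points. At
such a constant jet choose coordinates adapted to the flag of differentials of the ideals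
`curveOrderIdeal Q i`. In them `Q` lies in the linear space of weighted jets. By the second
condition a lift of order `j` vanishing on `Q` comes, up to a constant and near the point, from a
member of `curveOrderIdeal Q (j + 1)`, so its differential kills that linear space. The tangent
space of `Q` is therefore the whole space, `Q` fills it near the constant jet, and scaling extends
this to the fibres (`exists_isAdapted_of_mem`). Where the constant jet is not in `Q`, a nonvanishing
coordinate of positive weight gives an adapted chart.

The formula of (II) follows since the second condition fills in the intermediate lifts. For (III),
the number of weights exceeding `j` is an invariant of `Q` at each point of its base
(`IsAdapted.card_le`), so the weights are locally constant along `Q`. -/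

namespace JetWeighting

/-! ### Taylor series of functions of one variable, and changes of parameter -/

section TaylorSeries

/-- The Taylor series at `0` of a function of one variable. -/
noncomputable def tser (φ : ℝ → ℝ) : PowerSeries ℝ :=
  PowerSeries.mk fun j => ((Nat.factorial j : ℝ))⁻¹ * iteratedDeriv j φ 0

theorem coeff_tser (φ : ℝ → ℝ) (j : ℕ) :
    PowerSeries.coeff j (tser φ) = ((Nat.factorial j : ℝ))⁻¹ * iteratedDeriv j φ 0 :=
  PowerSeries.coeff_mk _ _

theorem coeff_zero_tser (φ : ℝ → ℝ) : PowerSeries.coeff 0 (tser φ) = φ 0 := by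
  simp [coeff_tser]

theorem tser_congr {φ ψ : ℝ → ℝ} (h : φ =ᶠ[𝓝 0] ψ) : tser φ = tser ψ := by
  ext j
  rw [coeff_tser, coeff_tser, h.iteratedDeriv_eq]

theorem natCast_le_infty (j : ℕ) : (j : ℕ∞ω) ≤ ∞ := by exact_mod_cast le_top

/-- The factor `1 / j!` turns the Leibniz rule into the Cauchy product. Orders of vanishing thus
become divisibility by powers of `X` in a domain. -/
theorem tser_mul {φ ψ : ℝ → ℝ} (hφ : ContDiffAt ℝ ∞ φ 0) (hψ : ContDiffAt ℝ ∞ ψ 0) :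
    tser (φ * ψ) = tser φ * tser ψ := by
  ext j
  rw [coeff_tser, iteratedDeriv_mul (hφ.of_le (natCast_le_infty j)) (hψ.of_le (natCast_le_infty j)),
    PowerSeries.coeff_mul, Finset.Nat.sum_antidiagonal_eq_sum_range_succ_mk, Finset.mul_sum]
  refine Finset.sum_congr rfl fun i hi => ?_
  rw [coeff_tser, coeff_tser, Nat.cast_choose ℝ (Nat.lt_succ_iff.mp (Finset.mem_range.mp hi))]
  have := Nat.factorial_ne_zero j
  field_simp

theorem tser_add {φ ψ : ℝ → ℝ} (hφ : ContDiffAt ℝ ∞ φ 0) (hψ : ContDiffAt ℝ ∞ ψ 0) :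
    tser (φ + ψ) = tser φ + tser ψ := by
  ext j
  rw [coeff_tser, iteratedDeriv_add (hφ.of_le (natCast_le_infty j)) (hψ.of_le (natCast_le_infty j)),
    map_add, coeff_tser, coeff_tser, mul_add]

theorem tser_const (c : ℝ) : tser (fun _ => c) = PowerSeries.C c := by
  ext j
  rw [coeff_tser, iteratedDeriv_const, PowerSeries.coeff_C]
  split_ifs with h <;> simp [h]

theorem tser_id_pow (m : ℕ) : tser (fun t => t ^ m) = PowerSeries.X ^ m := by
  ext j
  rw [coeff_tser, iteratedDeriv_fun_pow_zero, PowerSeries.coeff_X_pow]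
  split_ifs with h
  · subst h
    have := Nat.factorial_ne_zero j
    field_simp
  · simp

theorem tser_pow {φ : ℝ → ℝ} (hφ : ContDiffAt ℝ ∞ φ 0) (m : ℕ) :
    tser (fun t => φ t ^ m) = tser φ ^ m := by
  induction m with
  | zero => simpa using tser_const 1
  | succ m ih =>
    have : (fun t => φ t ^ (m + 1)) = (fun t => φ t ^ m) * φ := by
      ext t
      simp [pow_succ]
    rw [this, tser_mul (hφ.pow m) hφ, ih, pow_succ]

theorem tser_sum {ι : Type*} {s : Finset ι} {φ : ι → ℝ → ℝ}
    (hφ : ∀ i ∈ s, ContDiffAt ℝ ∞ (φ i) 0) :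
    tser (fun t => ∑ i ∈ s, φ i t) = ∑ i ∈ s, tser (φ i) := by
  ext j
  rw [coeff_tser, iteratedDeriv_fun_sum fun i hi => (hφ i hi).of_le (natCast_le_infty j), map_sum,
    Finset.mul_sum]
  simp only [coeff_tser]

theorem tser_prod {ι : Type*} {s : Finset ι} {φ : ι → ℝ → ℝ}
    (hφ : ∀ i, ContDiffAt ℝ ∞ (φ i) 0) :
    tser (fun t => ∏ i ∈ s, φ i t) = ∏ i ∈ s, tser (φ i) := by
  classical
  induction s using Finset.induction_on with
  | empty => simpa using tser_const 1
  | insert a s ha ih =>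
    have : (fun t => ∏ i ∈ insert a s, φ i t) = φ a * fun t => ∏ i ∈ s, φ i t := by
      ext t
      simp [Finset.prod_insert ha]
    rw [this, tser_mul (hφ a) (contDiffAt_prod fun i _ => hφ i), ih, Finset.prod_insert ha]

theorem coeff_tser_deriv (φ : ℝ → ℝ) (j : ℕ) :
    PowerSeries.coeff j (tser (deriv φ)) = (j + 1) * PowerSeries.coeff (j + 1) (tser φ) := by
  rw [coeff_tser, coeff_tser, iteratedDeriv_succ', Nat.factorial_succ]
  have := Nat.factorial_ne_zero j
  push_cast
  field_simp

/-- Permits induction on the order of vanishing by differentiating once, so that only the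
first-order chain rule is needed for compositions. -/
theorem X_pow_succ_dvd_tser_iff (φ : ℝ → ℝ) (m : ℕ) :
    PowerSeries.X ^ (m + 1) ∣ tser φ ↔ φ 0 = 0 ∧ PowerSeries.X ^ m ∣ tser (deriv φ) := by
  simp only [PowerSeries.X_pow_dvd_iff, coeff_tser_deriv]
  constructor
  · intro h
    refine ⟨by simpa [coeff_zero_tser] using h 0 (Nat.succ_pos _), fun j hj => ?_⟩
    rw [h (j + 1) (by omega), mul_zero]
  · rintro ⟨h0, h⟩ j hj
    cases j with
    | zero => rwa [coeff_zero_tser]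
    | succ j =>
      have h1 : (j : ℝ) + 1 ≠ 0 := by positivity
      exact (mul_eq_zero.mp (h j (by omega))).resolve_left h1

theorem contDiffAt_deriv {φ : ℝ → ℝ} {t : ℝ} (h : ContDiffAt ℝ ∞ φ t) :
    ContDiffAt ℝ ∞ (deriv φ) t := by
  have h1 : ContDiffAt ℝ ∞ (fun s => fderiv ℝ φ s 1) t :=
    (h.fderiv_right (m := ∞) (by simp)).clm_apply contDiffAt_const
  exact h1

/-- Substituting a function that vanishes at `0` does not lower the order of vanishing. -/
theorem X_pow_dvd_tser_comp (m : ℕ) : ∀ {φ ψ : ℝ → ℝ}, ContDiffAt ℝ ∞ φ 0 → ContDiffAt ℝ ∞ ψ 0 →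
    ψ 0 = 0 → PowerSeries.X ^ m ∣ tser φ → PowerSeries.X ^ m ∣ tser (φ ∘ ψ) := by
  induction m with
  | zero => intros; simp
  | succ m ih =>
    intro φ ψ hφ hψ h0 h
    rw [X_pow_succ_dvd_tser_iff] at h ⊢
    refine ⟨by simp [h0, h.1], ?_⟩
    have hφ' : ContDiffAt ℝ ∞ φ (ψ 0) := by rwa [h0]
    have e : deriv (φ ∘ ψ) =ᶠ[𝓝 0] (deriv φ ∘ ψ) * deriv ψ := by
      have h1 : ∀ᶠ t in 𝓝 (0 : ℝ), ContDiffAt ℝ 1 ψ t :=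
        (hψ.of_le (by simp)).eventually (by simp)
      have h2 : ∀ᶠ t in 𝓝 (0 : ℝ), ContDiffAt ℝ 1 φ (ψ t) :=
        hψ.continuousAt.eventually ((hφ'.of_le (by simp)).eventually (by simp))
      filter_upwards [h1, h2] with t h1 h2
      simp only [Pi.mul_apply, Function.comp_apply]
      exact deriv_comp t (h2.differentiableAt (by simp)) (h1.differentiableAt (by simp))
    rw [tser_congr e, tser_mul ((contDiffAt_deriv hφ').comp _ hψ) (contDiffAt_deriv hψ)]
    exact (ih (contDiffAt_deriv hφ) hψ h0 h.2).mul_right _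

theorem coeff_tser_comp_mul {φ : ℝ → ℝ} (hφ : ContDiff ℝ ∞ φ) (c : ℝ) (j : ℕ) :
    PowerSeries.coeff j (tser fun t => φ (c * t)) = c ^ j * PowerSeries.coeff j (tser φ) := by
  rw [coeff_tser, coeff_tser, iteratedDeriv_comp_const_mul (hφ.of_le (natCast_le_infty j))]
  simp
  ring

/-- The binomial expansion up to its first nontrivial term, the only one that matters for the change
of parameter `t + t ^ (d + 1)`. -/
theorem one_add_X_pow_pow (d m : ℕ) (hd : 0 < d) : ∃ g : PowerSeries ℝ,
    (1 + PowerSeries.X ^ d) ^ m = 1 + PowerSeries.C (m : ℝ) * PowerSeries.X ^ d +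
      PowerSeries.X ^ (d + 1) * g := by
  obtain ⟨d, rfl⟩ : ∃ d', d = d' + 1 := ⟨d - 1, by omega⟩
  induction m with
  | zero => exact ⟨0, by simp⟩
  | succ m ih =>
    obtain ⟨g, hg⟩ := ih
    refine ⟨g * (1 + PowerSeries.X ^ (d + 1)) + PowerSeries.C (m : ℝ) * PowerSeries.X ^ d, ?_⟩
    rw [pow_succ, hg]
    push_cast [map_add, map_one]
    ring

/-- If the Taylor coefficient of order `i` of `h` vanishes after all changes of parameter, then so
do all the coefficients of orders `1, …, i`. -/
theorem coeff_tser_eq_zero_of_reparam {h : ℝ → ℝ} (hh : ContDiff ℝ ∞ h) {i : ℕ}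
    (H : ∀ ψ : ℝ → ℝ, ContDiff ℝ ∞ ψ → ψ 0 = 0 → PowerSeries.coeff i (tser (h ∘ ψ)) = 0) :
    ∀ j, 1 ≤ j → j ≤ i → PowerSeries.coeff j (tser h) = 0 := by
  intro j
  induction j using Nat.strong_induction_on with
  | _ j ih =>
  intro hj hji
  have hi0 : PowerSeries.coeff i (tser h) = 0 := by simpa using H id contDiff_id rfl
  rcases hji.eq_or_lt with rfl | hlt
  · exact hi0
  set c : ℕ → ℝ := fun m => PowerSeries.coeff m (tser h) with hc
  -- The substitution `t ↦ t + t ^ (d + 1)` sends `t ^ j` to `t ^ j + j t ^ (j + d) + …`, so the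
  -- coefficient of order `j` reappears at order `i = j + d`, multiplied by `j ≠ 0`.
  let d := i - j
  let ψ : ℝ → ℝ := fun t => t + t ^ (d + 1)
  have hψ : ContDiff ℝ ∞ ψ := by fun_prop
  have hψ0 : ψ 0 = 0 := by simp [ψ]
  -- The Taylor polynomial of degree `i`; the remainder vanishes to order `i + 1`, also after the
  -- substitution.
  let P : ℝ → ℝ := fun t => ∑ m ∈ Finset.range (i + 1), c m * t ^ m
  have hP : ContDiff ℝ ∞ P := by fun_prop
  have htP : ∀ {χ : ℝ → ℝ}, ContDiff ℝ ∞ χ → tser (P ∘ χ) =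
      ∑ m ∈ Finset.range (i + 1), PowerSeries.C (c m) * tser χ ^ m := by
    intro χ hχ
    change tser (fun t => ∑ m ∈ Finset.range (i + 1), c m * χ t ^ m) = _
    rw [tser_sum fun m _ => by fun_prop]
    refine Finset.sum_congr rfl fun m _ => ?_
    have := tser_mul (φ := fun _ => c m) (ψ := fun t => χ t ^ m) contDiffAt_const
      (by fun_prop)
    rw [tser_const, tser_pow hχ.contDiffAt] at this
    exact this
  have hR : PowerSeries.X ^ (i + 1) ∣ tser (h - P) := by
    rw [PowerSeries.X_pow_dvd_iff]
    intro m hm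
    have e1 : h = (h - P) + P := by ext; simp
    have e2 : tser h = tser (h - P) + tser P := by
      conv_lhs => rw [e1]
      exact tser_add (hh.sub hP).contDiffAt hP.contDiffAt
    have e3 := htP (χ := id) contDiff_id
    have e4 : tser (id : ℝ → ℝ) = PowerSeries.X := by
      have := tser_id_pow 1
      rw [pow_one] at this
      rw [← this]
      congr 1
      ext t
      simp
    have e5 : PowerSeries.coeff m (tser P) = c m := by
      rw [Function.comp_id, e4] at e3
      rw [e3, map_sum, Finset.sum_eq_single m]
      · simp [PowerSeries.coeff_C_mul, PowerSeries.coeff_X_pow]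
      · intro b _ hb
        simp [PowerSeries.coeff_C_mul, PowerSeries.coeff_X_pow, hb.symm]
      · intro hm'
        exact absurd (Finset.mem_range.mpr hm) hm'
    have e6 := congrArg (PowerSeries.coeff m) e2
    rw [map_add, e5] at e6
    change c m = _ at e6
    linarith
  have hhP : ContDiff ℝ ∞ (h - P) := hh.sub hP
  have hR' := X_pow_dvd_tser_comp (i + 1) hhP.contDiffAt hψ.contDiffAt hψ0 hR
  rw [PowerSeries.X_pow_dvd_iff] at hR'
  have hsum : tser (h ∘ ψ) = tser ((h - P) ∘ ψ) + tser (P ∘ ψ) := by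
    rw [← tser_add (hhP.comp hψ).contDiffAt (hP.comp hψ).contDiffAt]
    congr 1
    ext t
    simp
  have key := H ψ hψ hψ0
  have hψs : tser ψ = PowerSeries.X * (1 + PowerSeries.X ^ d) := by
    have := tser_add (φ := fun t : ℝ => t ^ 1) (ψ := fun t => t ^ (d + 1)) (by fun_prop)
      (by fun_prop)
    rw [tser_id_pow, tser_id_pow] at this
    have e : ψ = (fun t : ℝ => t ^ 1) + fun t => t ^ (d + 1) := by
      ext t
      simp [ψ]
    rw [e, this]
    ring
  -- Only `m = j` contributes to order `i`: the terms `1 ≤ m < j` vanish by induction, `m = i` by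
  -- `hi0`, the constant term has no order `i` part, and for `j < m < i` the first correction has
  -- order `m + d > i`.
  rw [hsum, map_add, hR' i (by omega), zero_add, htP hψ, map_sum, Finset.sum_eq_single j] at key
  · obtain ⟨g, hg⟩ := one_add_X_pow_pow d j (by omega)
    rw [hψs, mul_pow, hg, PowerSeries.coeff_C_mul] at key
    have e : (PowerSeries.X : PowerSeries ℝ) ^ j * (1 + PowerSeries.C (j : ℝ) * PowerSeries.X ^ d +
        PowerSeries.X ^ (d + 1) * g) = PowerSeries.X ^ j + PowerSeries.C (j : ℝ) *
        PowerSeries.X ^ i + PowerSeries.X ^ (i + 1) * g := by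
      have hi : i = j + d := by omega
      rw [hi]
      ring
    rw [e, map_add, map_add, PowerSeries.coeff_C_mul, PowerSeries.coeff_X_pow_self,
      PowerSeries.coeff_X_pow, PowerSeries.coeff_X_pow_mul', if_neg (by omega),
      if_neg (by omega)] at key
    simp only [zero_add, mul_one, add_zero, mul_eq_zero, Nat.cast_eq_zero] at key
    exact key.resolve_right (by omega)
  · intro m hm hmj
    have hm' : m ≤ i := Nat.lt_succ_iff.mp (Finset.mem_range.mp hm)
    rw [PowerSeries.coeff_C_mul]
    rcases Nat.eq_zero_or_pos m with rfl | hm0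
    · rw [pow_zero, PowerSeries.coeff_one, if_neg (by omega), mul_zero]
    rcases lt_or_gt_of_ne hmj with hlt' | hgt
    · have : c m = 0 := ih m hlt' hm0 hm'
      rw [this, zero_mul]
    · rcases hm'.eq_or_lt with rfl | hmi
      · have : c m = 0 := hi0
        rw [this, zero_mul]
      · obtain ⟨g, hg⟩ := one_add_X_pow_pow d m (by omega)
        have e : (PowerSeries.X : PowerSeries ℝ) ^ m * (1 + PowerSeries.C (m : ℝ) *
            PowerSeries.X ^ d + PowerSeries.X ^ (d + 1) * g) = PowerSeries.X ^ m +
            PowerSeries.X ^ (m + d) * (PowerSeries.C (m : ℝ) + PowerSeries.X * g) := by ring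
        rw [hψs, mul_pow, hg, e, map_add, PowerSeries.coeff_X_pow, PowerSeries.coeff_X_pow_mul',
          if_neg (by omega), if_neg (by omega)]
        simp
  · intro hj'
    exact absurd (Finset.mem_range.mpr (by omega)) hj'

end TaylorSeries

/-! ### Hadamard's lemma -/

section Hadamard

variable {V : Type*} [NormedAddCommGroup V] [NormedSpace ℝ V]

-- The integral is the value at `0` of a convolution with the indicator of the unit interval, to
-- which smoothness of convolutions with parameters applies. The bump function makes the kernel
-- compactly supported; it equals `1` wherever the indicator sees it.
open MeasureTheory in
theorem contDiff_integral_unitInterval {K : V × ℝ → ℝ} (hK : ContDiff ℝ ∞ K) :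
    ContDiff ℝ ∞ fun x => ∫ s in (0 : ℝ)..1, K (x, s) := by
  let b : ContDiffBump (0 : ℝ) := ⟨1, 2, by norm_num, by norm_num⟩
  have h := contDiffOn_convolution_right_with_param (𝕜 := ℝ) (n := (⊤ : ℕ∞))
    (μ := (volume : Measure ℝ)) (ContinuousLinearMap.mul ℝ ℝ)
    (f := indicator (Ioc (0 : ℝ) 1) fun _ => (1 : ℝ)) (g := fun (x : V) u => b u * K (x, -u))
    (s := univ) (k := Metric.closedBall 0 2) isOpen_univ (isCompact_closedBall _ _) ?_ ?_ ?_
  · have h2 := h.comp (s := univ) (f := fun x : V => (x, (0 : ℝ)))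
      (by fun_prop : ContDiff ℝ (⊤ : ℕ∞) fun x : V => (x, (0 : ℝ))).contDiffOn
      (fun x _ => by simp)
    rw [contDiffOn_univ] at h2
    convert h2 using 1
    ext x
    simp only [Function.comp_apply, convolution_def, ContinuousLinearMap.mul_apply']
    rw [intervalIntegral.integral_of_le zero_le_one, ← integral_indicator measurableSet_Ioc]
    congr 1
    ext s
    by_cases hs : s ∈ Ioc (0 : ℝ) 1
    · have hb : b (-s) = 1 := b.one_of_mem_closedBall (by
        simp only [mem_closedBall_zero_iff, norm_neg, Real.norm_eq_abs, abs_of_pos hs.1]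
        exact hs.2)
      simp [hs, hb]
    · simp [hs]
  · intro x u _ hu
    have : b u = 0 := b.zero_of_le_dist (by
      rw [Metric.mem_closedBall, not_le] at hu
      exact hu.le)
    simp [this]
  · exact ((integrable_indicator_iff measurableSet_Ioc).2 (by simp)).locallyIntegrable
  · rw [univ_prod_univ, contDiffOn_univ]
    have h1 : ContDiff ℝ ∞ fun q : V × ℝ => b q.2 := b.contDiff.comp contDiff_snd
    exact h1.mul (hK.comp (by fun_prop : ContDiff ℝ ∞ fun q : V × ℝ => (q.1, -q.2)))

/-- Hadamard's lemma. -/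
theorem exists_sum_eq_sub {ι : Type*} [Fintype ι] {g : V → ℝ} (hg : ContDiff ℝ ∞ g)
    (ℓ : ι → V →L[ℝ] ℝ) (v : ι → V) :
    ∃ h : ι → V → ℝ, (∀ b, ContDiff ℝ ∞ (h b)) ∧
      ∀ x, g x - g (x - ∑ b, ℓ b x • v b) = ∑ b, ℓ b x * h b x := by
  let P : V → V := fun x => ∑ b, ℓ b x • v b
  have hP : ContDiff ℝ ∞ P := by fun_prop
  have hd : ContDiff ℝ ∞ (fderiv ℝ g) := hg.fderiv_right (by simp)
  have hK : ∀ b, ContDiff ℝ ∞ fun q : V × ℝ => fderiv ℝ g (q.1 - (1 - q.2) • P q.1) (v b) := by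
    intro b
    exact (hd.comp (by fun_prop)).clm_apply contDiff_const
  -- The fundamental theorem of calculus on the segment from `x - P x` at `s = 0` to `x` at `s = 1`.
  refine ⟨fun b x => ∫ s in (0 : ℝ)..1, fderiv ℝ g (x - (1 - s) • P x) (v b),
    fun b => contDiff_integral_unitInterval (hK b), fun x => ?_⟩
  have hder : ∀ s : ℝ, HasDerivAt (fun s => g (x - (1 - s) • P x))
      (∑ b, ℓ b x * fderiv ℝ g (x - (1 - s) • P x) (v b)) s := by
    intro s
    have h1 : HasDerivAt (fun s : ℝ => x - (1 - s) • P x) (P x) s := by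
      have := (((hasDerivAt_id s).const_sub 1).smul_const (P x)).const_sub x
      simpa using this
    have h2 := ((hg.differentiable (by simp)) (x - (1 - s) • P x)).hasFDerivAt.comp_hasDerivAt s h1
    have e : fderiv ℝ g (x - (1 - s) • P x) (P x) =
        ∑ b, ℓ b x * fderiv ℝ g (x - (1 - s) • P x) (v b) := by
      conv_lhs => rw [show P x = ∑ b, ℓ b x • v b from rfl]
      rw [map_sum]
      simp only [map_smul, smul_eq_mul, P]
    rw [e] at h2
    exact h2
  have hint := intervalIntegral.integral_eq_sub_of_hasDerivAt (a := 0) (b := 1)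
    (fun s _ => hder s) ?_
  · simp only [sub_self, zero_smul, sub_zero, one_smul] at hint
    change g x - g (x - P x) = _
    rw [← hint, intervalIntegral.integral_finsetSum]
    · refine Finset.sum_congr rfl fun b _ => ?_
      rw [intervalIntegral.integral_const_mul]
    · intro b _
      refine Continuous.intervalIntegrable ?_ _ _
      exact continuous_const.mul ((hK b).continuous.comp (by fun_prop : Continuous fun s : ℝ => (x, s)))
  · refine Continuous.intervalIntegrable ?_ _ _
    refine continuous_finsetSum _ fun b _ => ?_
    exact continuous_const.mul ((hK b).continuous.comp (by fun_prop : Continuous fun s : ℝ => (x, s)))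

end Hadamard

/-! ### Pointwise rules for bundled smooth functions -/

section Bundling

variable {E H M E' H' M' : Type*} [NormedAddCommGroup E] [NormedSpace ℝ E]
  [TopologicalSpace H] {I : ModelWithCorners ℝ E H} [TopologicalSpace M] [ChartedSpace H M]
  [NormedAddCommGroup E'] [NormedSpace ℝ E'] [TopologicalSpace H'] {I' : ModelWithCorners ℝ E' H'}
  [TopologicalSpace M'] [ChartedSpace H' M']

/-- Bundle a smooth map. -/
def mkSmooth (f : M → M') (hf : ContMDiff I I' ∞ f) : C^∞⟮I, M; I', M'⟯ := ⟨f, hf⟩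

@[simp] theorem mkSmooth_apply (f : M → M') (hf : ContMDiff I I' ∞ f) (x : M) :
    mkSmooth f hf x = f x := rfl

@[simp] theorem coe_mkSmooth (f : M → M') (hf : ContMDiff I I' ∞ f) : ⇑(mkSmooth f hf) = f := rfl

theorem smooth_mul_apply (f g : C^∞⟮I, M; 𝓘(ℝ, ℝ), ℝ⟯) (x : M) : (f * g) x = f x * g x := rfl

theorem smooth_add_apply (f g : C^∞⟮I, M; 𝓘(ℝ, ℝ), ℝ⟯) (x : M) : (f + g) x = f x + g x := rfl

theorem smooth_sub_apply (f g : C^∞⟮I, M; 𝓘(ℝ, ℝ), ℝ⟯) (x : M) : (f - g) x = f x - g x := rfl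

theorem smooth_zero_apply (x : M) : (0 : C^∞⟮I, M; 𝓘(ℝ, ℝ), ℝ⟯) x = 0 := rfl

theorem smooth_sum_apply {ι : Type*} (s : Finset ι) (f : ι → C^∞⟮I, M; 𝓘(ℝ, ℝ), ℝ⟯) (x : M) :
    (∑ i ∈ s, f i) x = ∑ i ∈ s, f i x :=
  map_sum (ContMDiffMap.evalRingHom (I := I) (I' := 𝓘(ℝ, ℝ)) (n := ∞) x) f s

theorem smooth_prod_apply {ι : Type*} (s : Finset ι) (f : ι → C^∞⟮I, M; 𝓘(ℝ, ℝ), ℝ⟯) (x : M) :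
    (∏ i ∈ s, f i) x = ∏ i ∈ s, f i x :=
  map_prod (ContMDiffMap.evalRingHom (I := I) (I' := 𝓘(ℝ, ℝ)) (n := ∞) x) f s

theorem smooth_pow_apply (f : C^∞⟮I, M; 𝓘(ℝ, ℝ), ℝ⟯) (m : ℕ) (x : M) : (f ^ m) x = f x ^ m := rfl

end Bundling

/-! ### Bump functions, extension of germs, and partitions of unity -/

section General

variable {V : Type*} [NormedAddCommGroup V] [NormedSpace ℝ V] [FiniteDimensional ℝ V]
  {N : Type*} [TopologicalSpace N] [ChartedSpace V N] [IsManifold 𝓘(ℝ, V) ∞ N] [T2Space N]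
  [SigmaCompactSpace N]

theorem exists_bump {U K : Set N} (hU : IsOpen U) (hK : IsClosed K) (h : K ⊆ U) :
    ∃ χ : C^∞⟮𝓘(ℝ, V), N; 𝓘(ℝ, ℝ), ℝ⟯, (∀ᶠ x in 𝓝ˢ K, χ x = 1) ∧ tsupport χ ⊆ U := by
  have : LocallyCompactSpace N := Manifold.locallyCompact_of_finiteDimensional 𝓘(ℝ, V)
  obtain ⟨χ, h0, h1, -⟩ := exists_contMDiffMap_zero_one_nhds_of_isClosed 𝓘(ℝ, V) (n := (⊤ : ℕ∞))
    hU.isClosed_compl hK (disjoint_left.mpr fun x hx hx' => hx (h hx'))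
  refine ⟨χ, h1, fun x hx => ?_⟩
  by_contra hxU
  have : ∀ᶠ y in 𝓝 x, χ y = 0 := h0.filter_mono (nhds_le_nhdsSet hxU)
  exact (notMem_tsupport_iff_eventuallyEq.mpr this) hx

theorem contMDiff_mul_of_tsupport {U : Set N} (hU : IsOpen U) {χ : N → ℝ}
    (hχ : ContMDiff 𝓘(ℝ, V) 𝓘(ℝ, ℝ) ∞ χ) (h : tsupport χ ⊆ U) {f : N → ℝ}
    (hf : ContMDiffOn 𝓘(ℝ, V) 𝓘(ℝ, ℝ) ∞ f U) :
    ContMDiff 𝓘(ℝ, V) 𝓘(ℝ, ℝ) ∞ fun x => χ x * f x := by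
  refine contMDiff_of_tsupport fun x hx => ?_
  have hx' : x ∈ U := h (closure_mono (fun y hy => left_ne_zero_of_mul hy) hx)
  exact hχ.contMDiffAt.mul (hf.contMDiffAt (hU.mem_nhds hx'))

/-- Every germ of a smooth function is the germ of a global one, with support in a given set. -/
theorem exists_extension {U : Set N} (hU : IsOpen U) {p : N} (hp : p ∈ U) {f : N → ℝ}
    (hf : ContMDiffOn 𝓘(ℝ, V) 𝓘(ℝ, ℝ) ∞ f U) :
    ∃ F : C^∞⟮𝓘(ℝ, V), N; 𝓘(ℝ, ℝ), ℝ⟯, ⇑F =ᶠ[𝓝 p] f := by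
  obtain ⟨χ, h1, h2⟩ := exists_bump (V := V) hU isClosed_singleton (singleton_subset_iff.mpr hp)
  rw [nhdsSet_singleton] at h1
  refine ⟨mkSmooth (fun x => χ x * f x) (contMDiff_mul_of_tsupport hU χ.contMDiff h2 hf), ?_⟩
  filter_upwards [h1] with x hx
  change χ x * f x = f x
  rw [hx, one_mul]

/-- A smooth function that is locally a combination of finitely many smooth functions is so
globally. -/
theorem mem_span_of_locally {ι : Type*} [Fintype ι] (v : ι → C^∞⟮𝓘(ℝ, V), N; 𝓘(ℝ, ℝ), ℝ⟯)
    (f : C^∞⟮𝓘(ℝ, V), N; 𝓘(ℝ, ℝ), ℝ⟯)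
    (h : ∀ x : N, ∃ U ∈ 𝓝 x, ∃ c : ι → N → ℝ,
      (∀ i, ContMDiffOn 𝓘(ℝ, V) 𝓘(ℝ, ℝ) ∞ (c i) U) ∧ ∀ y ∈ U, f y = ∑ i, c i y * v i y) :
    f ∈ Ideal.span (range v) := by
  -- The admissible coefficient vectors at a point form an affine, hence convex, set, so local
  -- choices can be averaged by a partition of unity.
  let T : N → Set (ι → ℝ) := fun y => {c | f y = ∑ i, c i * v i y}
  have hT : ∀ y, Convex ℝ (T y) := by
    intro y a ha b hb s t _ _ hst
    simp only [T, mem_ofPred_eq, Pi.add_apply, Pi.smul_apply, smul_eq_mul] at ha hb ⊢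
    have : ∑ i, (s * a i + t * b i) * v i y = s * ∑ i, a i * v i y + t * ∑ i, b i * v i y := by
      rw [Finset.mul_sum, Finset.mul_sum, ← Finset.sum_add_distrib]
      exact Finset.sum_congr rfl fun i _ => by ring
    rw [this, ← ha, ← hb, ← add_mul, hst, one_mul]
  have hloc : ∀ x : N, ∃ U ∈ 𝓝 x, ∃ g : N → ι → ℝ,
      ContMDiffOn 𝓘(ℝ, V) 𝓘(ℝ, ι → ℝ) ((⊤ : ℕ∞) : ℕ∞ω) g U ∧ ∀ y ∈ U, g y ∈ T y := by
    intro x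
    obtain ⟨U, hU, c, hc, hf⟩ := h x
    exact ⟨U, hU, fun y i => c i y, contMDiffOn_pi_space.mpr hc, hf⟩
  obtain ⟨g, hg⟩ := exists_contMDiffMap_forall_mem_convex_of_local 𝓘(ℝ, V) hT hloc
  rw [Ideal.mem_span_range_iff_exists_fun]
  have hgi : ∀ i, ContMDiff 𝓘(ℝ, V) 𝓘(ℝ, ℝ) ∞ fun x => g x i := contMDiff_pi_space.mp g.contMDiff
  refine ⟨fun i => mkSmooth (fun x => g x i) (hgi i), ?_⟩
  ext x
  rw [smooth_sum_apply]
  exact (hg x).symm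

end General

/-! ### Topology and charts of the jet bundle -/

section JetTopology

variable {n : ℕ} {M : Type*} [TopologicalSpace M] [ChartedSpace (EuclideanSpace ℝ (Fin n)) M]
  [IsManifold (𝓡 n) ∞ M] {k : ℕ}

theorem jetChart_symm_base {e : OpenPartialHomeomorph M (EuclideanSpace ℝ (Fin n))}
    (he : e ∈ IsManifold.maximalAtlas (𝓡 n) ∞ M) (x : Fin (k + 1) → EuclideanSpace ℝ (Fin n))
    (hx : x 0 ∈ e.target) : ((jetChart k e he).symm x).base = e.symm (x 0) := by
  obtain ⟨γ, h0, -, h⟩ := jetChart_symm_spec he x hx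
  rw [h, base_jet, h0]

theorem isOpen_jetTarget (e : OpenPartialHomeomorph M (EuclideanSpace ℝ (Fin n))) :
    IsOpen {x : Fin (k + 1) → EuclideanSpace ℝ (Fin n) | x 0 ∈ e.target} :=
  e.open_target.preimage (continuous_apply (A := fun _ => EuclideanSpace ℝ (Fin n)) (0 : Fin (k + 1)))

theorem continuous_base : Continuous (JetBundle.base : JetBundle n M k → M) := by
  rw [continuous_iff_continuousAt]
  intro u
  set c := chartAt (Fin (k + 1) → EuclideanSpace ℝ (Fin n)) u with hc
  set e := chartAt (EuclideanSpace ℝ (Fin n)) u.base with he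
  have hu : u ∈ c.source := mem_chart_source _ u
  have h0 : jetCoord e u 0 = e u.base := jetCoord_zero (IsManifold.chart_mem_maximalAtlas _) u hu
  have h1 : ContinuousAt (fun v => e.symm (c v 0)) u := by
    refine ContinuousAt.comp (f := fun v => c v 0) ?_
      ((continuous_apply (A := fun _ => EuclideanSpace ℝ (Fin n)) 0).continuousAt.comp
        (c.continuousAt hu))
    refine e.continuousAt_symm ?_
    change jetCoord e u 0 ∈ _
    rw [h0]
    exact e.map_source hu
  refine h1.congr ?_
  filter_upwards [c.open_source.mem_nhds hu] with v hv
  change e.symm (jetCoord e v 0) = _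
  rw [jetCoord_zero (IsManifold.chart_mem_maximalAtlas _) v hv, e.left_inv hv]

theorem contDiffOn_jetCoord_trans {e e' : OpenPartialHomeomorph M (EuclideanSpace ℝ (Fin n))}
    (he : e ∈ IsManifold.maximalAtlas (𝓡 n) ∞ M) (he' : e' ∈ IsManifold.maximalAtlas (𝓡 n) ∞ M) :
    ContDiffOn ℝ ∞ (fun x => jetChart k e' he' ((jetChart k e he).symm x))
      {x | x 0 ∈ e.target ∧ e.symm (x 0) ∈ e'.source} := by
  have := contDiffOn_jetChart_trans (k := k) he he'
  rw [jetChart_trans_source] at this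
  exact this

theorem isOpen_jetChart_trans_source
    (e e' : OpenPartialHomeomorph M (EuclideanSpace ℝ (Fin n))) :
    IsOpen {x : Fin (k + 1) → EuclideanSpace ℝ (Fin n) |
      x 0 ∈ e.target ∧ e.symm (x 0) ∈ e'.source} :=
  (e.isOpen_inter_preimage_symm e'.open_source).preimage
    (continuous_apply (A := fun _ => EuclideanSpace ℝ (Fin n)) (0 : Fin (k + 1)))

/-- The atlas of `T_k M` uses only charts in the atlas of `M`. Adapted charts are arbitrary members
of the maximal atlas, whose jet charts must be shown smooth as well. -/
theorem contMDiffOn_jetChart {e : OpenPartialHomeomorph M (EuclideanSpace ℝ (Fin n))}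
    (he : e ∈ IsManifold.maximalAtlas (𝓡 n) ∞ M) :
    ContMDiffOn 𝓘(ℝ, Fin (k + 1) → EuclideanSpace ℝ (Fin n))
      𝓘(ℝ, Fin (k + 1) → EuclideanSpace ℝ (Fin n)) ∞ (jetChart k e he) {u | u.base ∈ e.source} := by
  intro u hu
  refine ContMDiffAt.contMDiffWithinAt ?_
  set c := chartAt (Fin (k + 1) → EuclideanSpace ℝ (Fin n)) u with hc
  have hu' : u ∈ c.source := mem_chart_source _ u
  set he0 := IsManifold.chart_mem_maximalAtlas (I := 𝓡 n) (n := ∞) u.base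
  have h1 := contDiffOn_jetCoord_trans (k := k) he0 he
  have hx : c u ∈ {x : Fin (k + 1) → EuclideanSpace ℝ (Fin n) |
      x 0 ∈ (chartAt (EuclideanSpace ℝ (Fin n)) u.base).target ∧
      (chartAt (EuclideanSpace ℝ (Fin n)) u.base).symm (x 0) ∈ e.source} := by
    have h0 : c u 0 = _ := jetCoord_zero he0 u hu'
    rw [mem_ofPred_eq, h0, OpenPartialHomeomorph.left_inv _ (mem_chart_source _ _)]
    exact ⟨OpenPartialHomeomorph.map_source _ (mem_chart_source _ _), hu⟩
  have h2 := (h1.contDiffAt ((isOpen_jetChart_trans_source _ _).mem_nhds hx)).contMDiffAt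
  have h3 : ContMDiffAt 𝓘(ℝ, Fin (k + 1) → EuclideanSpace ℝ (Fin n))
      𝓘(ℝ, Fin (k + 1) → EuclideanSpace ℝ (Fin n)) ∞ c u :=
    contMDiffAt_of_mem_maximalAtlas (IsManifold.chart_mem_maximalAtlas u) hu'
  refine (h2.comp u h3).congr_of_eventuallyEq ?_
  filter_upwards [c.open_source.mem_nhds hu'] with v hv
  have h4 : (jetChart k _ he0).symm (c v) = v := c.left_inv hv
  simp only [Function.comp_apply]
  rw [h4]

theorem contMDiffOn_jetChart_symm {e : OpenPartialHomeomorph M (EuclideanSpace ℝ (Fin n))}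
    (he : e ∈ IsManifold.maximalAtlas (𝓡 n) ∞ M) :
    ContMDiffOn 𝓘(ℝ, Fin (k + 1) → EuclideanSpace ℝ (Fin n))
      𝓘(ℝ, Fin (k + 1) → EuclideanSpace ℝ (Fin n)) ∞ (jetChart k e he).symm
      {x | x 0 ∈ e.target} := by
  intro x hx
  refine ContMDiffAt.contMDiffWithinAt ?_
  set u := (jetChart k e he).symm x with hu
  set c := chartAt (Fin (k + 1) → EuclideanSpace ℝ (Fin n)) u with hc
  have hu' : u ∈ c.source := mem_chart_source _ u
  set he0 := IsManifold.chart_mem_maximalAtlas (I := 𝓡 n) (n := ∞) u.base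
  have h1 := contDiffOn_jetCoord_trans (k := k) he he0
  have hb : u.base = e.symm (x 0) := jetChart_symm_base he x hx
  have hx' : x ∈ {x : Fin (k + 1) → EuclideanSpace ℝ (Fin n) | x 0 ∈ e.target ∧
      e.symm (x 0) ∈ (chartAt (EuclideanSpace ℝ (Fin n)) u.base).source} :=
    ⟨hx, hb ▸ mem_chart_source _ _⟩
  have hO := (isOpen_jetChart_trans_source _ _).mem_nhds hx'
  have h2 := (h1.contDiffAt hO).contMDiffAt
  have h3 : ContMDiffAt 𝓘(ℝ, Fin (k + 1) → EuclideanSpace ℝ (Fin n))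
      𝓘(ℝ, Fin (k + 1) → EuclideanSpace ℝ (Fin n)) ∞ c.symm (c u) :=
    contMDiffAt_symm_of_mem_maximalAtlas (IsManifold.chart_mem_maximalAtlas u) (c.map_source hu')
  refine (ContMDiffAt.comp x (g := c.symm) h3 h2).congr_of_eventuallyEq ?_
  filter_upwards [hO] with y hy
  refine (c.left_inv (x := (jetChart k e he).symm y) ?_).symm
  change ((jetChart k e he).symm y).base ∈ (chartAt (EuclideanSpace ℝ (Fin n)) u.base).source
  rw [jetChart_symm_base he y hy.1]
  exact hy.2

/-- The chart of `T_k M` induced by a chart of `M`, as an open partial homeomorphism. -/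
noncomputable def jetHomeo (k : ℕ) (e : OpenPartialHomeomorph M (EuclideanSpace ℝ (Fin n)))
    (he : e ∈ IsManifold.maximalAtlas (𝓡 n) ∞ M) :
    OpenPartialHomeomorph (JetBundle n M k) (Fin (k + 1) → EuclideanSpace ℝ (Fin n)) where
  toPartialEquiv := jetChart k e he
  open_source := e.open_source.preimage continuous_base
  open_target := isOpen_jetTarget e
  continuousOn_toFun := (contMDiffOn_jetChart he).continuousOn
  continuousOn_invFun := (contMDiffOn_jetChart_symm he).continuousOn

theorem jetHomeo_mem_maximalAtlas {e : OpenPartialHomeomorph M (EuclideanSpace ℝ (Fin n))}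
    (he : e ∈ IsManifold.maximalAtlas (𝓡 n) ∞ M) :
    jetHomeo k e he ∈ IsManifold.maximalAtlas 𝓘(ℝ, Fin (k + 1) → EuclideanSpace ℝ (Fin n)) ∞
      (JetBundle n M k) :=
  (jetHomeo k e he).mem_maximalAtlas_of_contMDiffOn (contMDiffOn_jetChart he)
    (contMDiffOn_jetChart_symm he)

theorem mem_jetHomeo_source {e : OpenPartialHomeomorph M (EuclideanSpace ℝ (Fin n))}
    (he : e ∈ IsManifold.maximalAtlas (𝓡 n) ∞ M) (u : JetBundle n M k) :
    u ∈ (jetHomeo k e he).source ↔ u.base ∈ e.source := Iff.rfl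

instance [T2Space M] : T2Space (JetBundle n M k) := by
  refine ⟨fun u v huv => ?_⟩
  by_cases h : u.base = v.base
  · have he := IsManifold.chart_mem_maximalAtlas (I := 𝓡 n) (n := ∞) u.base
    set c := jetHomeo k _ he with hc
    have hu : u ∈ c.source := mem_chart_source _ u.base
    have hv : v ∈ c.source := by
      rw [hc, mem_jetHomeo_source, ← h]
      exact mem_chart_source _ u.base
    obtain ⟨s, t, hs, ht, hus, hvt, hst⟩ := t2_separation (c.injOn.ne hu hv huv)
    exact ⟨_, _, c.isOpen_inter_preimage hs, c.isOpen_inter_preimage ht, ⟨hu, hus⟩, ⟨hv, hvt⟩,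
      (hst.preimage c).mono inter_subset_right inter_subset_right⟩
  · obtain ⟨s, t, hs, ht, hus, hvt, hst⟩ := t2_separation h
    exact ⟨_, _, hs.preimage continuous_base, ht.preimage continuous_base, hus, hvt,
      hst.preimage _⟩

/-- The jet of a constant curve. -/
noncomputable def constJet (k : ℕ) (p : M) : JetBundle n M k := jet k (mkSmooth (fun _ => p) contMDiff_const)

@[simp] theorem base_constJet (p : M) : (constJet k p : JetBundle n M k).base = p := rfl

theorem jetCoord_constJet {e : OpenPartialHomeomorph M (EuclideanSpace ℝ (Fin n))}
    (he : e ∈ IsManifold.maximalAtlas (𝓡 n) ∞ M) {p : M} (hp : p ∈ e.source) :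
    jetCoord e (constJet k p) = Pi.single 0 (e p) := by
  ext1 j
  unfold constJet
  rw [jetCoord_jet he _ hp]
  change _ • iteratedDeriv j (fun _ => e p) 0 = _
  rw [iteratedDeriv_const]
  by_cases hj : j = 0
  · subst hj
    simp
  · have : (j : ℕ) ≠ 0 := fun h => hj (Fin.ext h)
    simp [hj, this]

theorem continuous_constJet : Continuous (constJet k : M → JetBundle n M k) := by
  rw [continuous_iff_continuousAt]
  intro p
  have he := IsManifold.chart_mem_maximalAtlas (I := 𝓡 n) (n := ∞) p
  set e := chartAt (EuclideanSpace ℝ (Fin n)) p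
  have hp : p ∈ e.source := mem_chart_source _ p
  have hp' : (constJet k p : JetBundle n M k) ∈ (jetHomeo k e he).source := hp
  have h1 : ContinuousAt (fun q => (Pi.single 0 (e q) : Fin (k + 1) → EuclideanSpace ℝ (Fin n))) p :=
    (continuous_single (A := fun _ => EuclideanSpace ℝ (Fin n)) 0).continuousAt.comp
      (e.continuousAt hp)
  have h2 : ContinuousAt (jetHomeo k e he).symm (Pi.single 0 (e p)) := by
    refine (jetHomeo k e he).continuousAt_symm ?_
    rw [← jetCoord_constJet he hp]
    exact (jetHomeo k e he).map_source hp'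
  refine (ContinuousAt.comp (f := fun q => (Pi.single 0 (e q) : Fin (k + 1) → _)) h2 h1).congr ?_
  filter_upwards [e.open_source.mem_nhds hp] with q hq
  simp only [Function.comp_apply]
  rw [← jetCoord_constJet he hq]
  exact (jetHomeo k e he).left_inv (x := constJet k q) hq

/-- The chart at a jet depends only on its base point, so charts at the constant jets over a
countable family already cover. -/
instance [SecondCountableTopology M] : SecondCountableTopology (JetBundle n M k) := by
  obtain ⟨s, hs, hcov⟩ := TopologicalSpace.countable_cover_nhds fun p : M =>
    chart_source_mem_nhds (EuclideanSpace ℝ (Fin n)) p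
  refine ChartedSpace.secondCountable_of_countable_cover
    (Fin (k + 1) → EuclideanSpace ℝ (Fin n)) (s := constJet k '' s) ?_ (hs.image _)
  rw [eq_univ_iff_forall]
  intro u
  have : u.base ∈ ⋃ x ∈ s, (chartAt (EuclideanSpace ℝ (Fin n)) x).source := hcov ▸ mem_univ _
  simp only [mem_iUnion] at this ⊢
  obtain ⟨p, hp, h⟩ := this
  exact ⟨constJet k p, mem_image_of_mem _ hp, h⟩

instance [SecondCountableTopology M] : SigmaCompactSpace (JetBundle n M k) :=
  haveI := Manifold.locallyCompact_of_finiteDimensional (M := JetBundle n M k)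
    𝓘(ℝ, Fin (k + 1) → EuclideanSpace ℝ (Fin n))
  inferInstance

end JetTopology

/-! ### Ideals generated by weighted monomials -/

section Monomials

variable {n : ℕ} {R : Type*} [CommRing R]

/-- The ideal generated by the monomials of weight `≥ i` in given elements. -/
def monIdeal (x : Fin n → R) (w : Fin n → ℕ) (i : ℕ) : Ideal R :=
  Ideal.span {g | ∃ s : Fin n → ℕ, i ≤ ∑ a, s a * w a ∧ g = ∏ a, x a ^ s a}

/-- Finitely many generators of `monIdeal`. -/
def monGen (x : Fin n → R) (w : Fin n → ℕ) (i : ℕ) (s : Fin n → Fin (i + 1)) : R :=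
  if i ≤ ∑ a, (s a : ℕ) * w a then ∏ a, x a ^ (s a : ℕ) else 0

theorem monIdeal_zero (x : Fin n → R) (w : Fin n → ℕ) : monIdeal x w 0 = ⊤ := by
  rw [Ideal.eq_top_iff_one]
  exact Ideal.subset_span ⟨0, by simp, by simp⟩

theorem monGen_mem (x : Fin n → R) (w : Fin n → ℕ) (i : ℕ) (s : Fin n → Fin (i + 1)) :
    monGen x w i s ∈ monIdeal x w i := by
  unfold monGen
  split_ifs with h
  · exact Ideal.subset_span ⟨fun a => s a, h, rfl⟩
  · exact zero_mem _

/-- Truncating the exponents at `i`, and deleting the variables of weight `0`, leaves a divisor that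
still has weight `≥ i`: one truncated exponent of positive weight suffices. Finiteness of the
generating family is what allows partitions of unity later. -/
theorem monIdeal_eq_span_range (x : Fin n → R) (w : Fin n → ℕ) (i : ℕ) :
    monIdeal x w i = Ideal.span (range (monGen x w i)) := by
  apply le_antisymm
  · refine Ideal.span_le.mpr ?_
    rintro _ ⟨s, hs, rfl⟩
    let s' : Fin n → Fin (i + 1) := fun a =>
      if w a = 0 then 0 else ⟨min (s a) i, Nat.lt_succ_of_le (min_le_right _ _)⟩
    have hle : ∀ a, (s' a : ℕ) ≤ s a := by
      intro a
      simp only [s']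
      split_ifs
      · exact Nat.zero_le _
      · exact min_le_left _ _
    have hi : i ≤ ∑ a, (s' a : ℕ) * w a := by
      by_cases h : ∃ a, w a ≠ 0 ∧ i < s a
      · obtain ⟨a, ha, hia⟩ := h
        refine le_trans ?_ (Finset.single_le_sum (f := fun a => (s' a : ℕ) * w a)
          (fun _ _ => Nat.zero_le _) (Finset.mem_univ a))
        have : (s' a : ℕ) = i := by simp [s', ha, hia.le]
        rw [this]
        exact Nat.le_mul_of_pos_right _ (Nat.pos_of_ne_zero ha)
      · push Not at h
        refine hs.trans (le_of_eq (Finset.sum_congr rfl fun a _ => ?_))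
        by_cases ha : w a = 0
        · simp [ha]
        · simp [s', ha, h a ha]
    have hdvd : monGen x w i s' ∣ ∏ a, x a ^ s a := by
      rw [monGen, if_pos hi]
      exact Finset.prod_dvd_prod_of_dvd _ _ fun a _ => pow_dvd_pow _ (hle a)
    exact Ideal.mem_of_dvd _ hdvd (Ideal.subset_span (mem_range_self _))
  · refine Ideal.span_le.mpr ?_
    rintro _ ⟨s, rfl⟩
    exact monGen_mem x w i s

theorem mul_mem_monIdeal {x : Fin n → R} {w : Fin n → ℕ} {i : ℕ} (a : Fin n) {g : R}
    (hg : g ∈ monIdeal x w (i - w a)) : x a * g ∈ monIdeal x w i := by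
  unfold monIdeal at hg
  induction hg using Submodule.span_induction with
  | mem g hg =>
    obtain ⟨s, hs, rfl⟩ := hg
    refine Ideal.subset_span ⟨s + Pi.single a 1, ?_, ?_⟩
    · have : ∑ b, (s + Pi.single a 1 : Fin n → ℕ) b * w b = ∑ b, s b * w b + w a := by
        simp [add_mul, Finset.sum_add_distrib, Pi.single_apply]
      omega
    · simp only [Pi.add_apply, pow_add, Finset.prod_mul_distrib]
      rw [mul_comm]
      congr 1
      rw [Finset.prod_eq_single a]
      · simp
      · intro b _ hb
        simp [hb]
      · simp
  | zero => simp
  | add g h _ _ hg hh =>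
    rw [mul_add]
    exact add_mem hg hh
  | smul r g _ hg =>
    rw [smul_eq_mul, mul_left_comm]
    exact Ideal.mul_mem_left _ _ hg

end Monomials

/-! ### Weighted order along curves in Euclidean space -/

section Euclidean

variable {n : ℕ}

/-- The coordinate functions of Euclidean space. -/
noncomputable def coordE (a : Fin n) :
    C^∞⟮𝓘(ℝ, EuclideanSpace ℝ (Fin n)), EuclideanSpace ℝ (Fin n); 𝓘(ℝ, ℝ), ℝ⟯ :=
  mkSmooth (fun x => x a) (by
    have : ContDiff ℝ ∞ fun x : EuclideanSpace ℝ (Fin n) => x a := by fun_prop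
    exact this.contMDiff)

@[simp] theorem coordE_apply (a : Fin n) (x : EuclideanSpace ℝ (Fin n)) : coordE a x = x a := rfl

/-- `f` vanishes to order `i` along the curves whose `a`-th coordinate vanishes to order `w a`. -/
def WeightedOrder (w : Fin n → ℕ) (D : Set (EuclideanSpace ℝ (Fin n))) (i : ℕ)
    (f : EuclideanSpace ℝ (Fin n) → ℝ) : Prop :=
  ∀ c : ℝ → EuclideanSpace ℝ (Fin n), ContDiff ℝ ∞ c → c 0 ∈ D →
    (∀ a, PowerSeries.X ^ w a ∣ tser fun t => c t a) → PowerSeries.X ^ i ∣ tser (f ∘ c)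

/-- Replace the coordinates in `T` by `0`. -/
noncomputable def zeroOn (T : Finset (Fin n)) (x : EuclideanSpace ℝ (Fin n)) :
    EuclideanSpace ℝ (Fin n) :=
  WithLp.toLp 2 fun a => if a ∈ T then 0 else x a

@[simp] theorem zeroOn_apply (T : Finset (Fin n)) (x : EuclideanSpace ℝ (Fin n)) (a : Fin n) :
    zeroOn T x a = if a ∈ T then 0 else x a := rfl

theorem contDiff_zeroOn (T : Finset (Fin n)) : ContDiff ℝ ∞ (zeroOn T) := by
  refine contDiff_euclidean.mpr fun a => ?_
  simp only [zeroOn_apply]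
  split_ifs <;> fun_prop

theorem zeroOn_zeroOn_singleton (T : Finset (Fin n)) (a : Fin n) (x : EuclideanSpace ℝ (Fin n)) :
    zeroOn T (zeroOn {a} x) = zeroOn (insert a T) x := by
  ext b
  by_cases hb : b = a <;> by_cases hT : b ∈ T <;> simp [hb, hT]

theorem zeroOn_singleton (a : Fin n) (x : EuclideanSpace ℝ (Fin n)) :
    zeroOn {a} x = x - x a • EuclideanSpace.single a (1 : ℝ) := by
  ext b
  by_cases hb : b = a
  · subst hb; simp
  · simp [hb]

/-- The centre lies in the coordinate plane, so projecting onto the plane does not increase the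
distance to it. -/
theorem zeroOn_mem_ball {T : Finset (Fin n)} {x₀ x : EuclideanSpace ℝ (Fin n)} {ρ : ℝ}
    (h0 : ∀ a ∈ T, x₀ a = 0) (hx : x ∈ Metric.ball x₀ ρ) : zeroOn T x ∈ Metric.ball x₀ ρ := by
  rw [Metric.mem_ball] at hx ⊢
  refine lt_of_le_of_lt ?_ hx
  rw [EuclideanSpace.dist_eq, EuclideanSpace.dist_eq]
  refine Real.sqrt_le_sqrt (Finset.sum_le_sum fun a _ => ?_)
  simp only [zeroOn_apply]
  split_ifs with ha
  · rw [h0 a ha, dist_self, zero_pow two_ne_zero]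
    exact sq_nonneg _
  · exact le_rfl

theorem WeightedOrder.comp_zeroOn {w : Fin n → ℕ} {D : Set (EuclideanSpace ℝ (Fin n))} {i : ℕ}
    {f : EuclideanSpace ℝ (Fin n) → ℝ} (h : WeightedOrder w D i f) {T : Finset (Fin n)}
    (hD : ∀ x ∈ D, zeroOn T x ∈ D) : WeightedOrder w D i (f ∘ zeroOn T) := by
  intro c hc h0 hw
  refine h (zeroOn T ∘ c) ((contDiff_zeroOn T).comp hc) (hD _ h0) fun a => ?_
  simp only [Function.comp_apply, zeroOn_apply]
  split_ifs with ha
  · rw [tser_const, map_zero]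
    exact dvd_zero _
  · exact hw a

/-- Along a given curve `x a` may vanish to order higher than `w a`, and then the order of the
product says too little about `h`. Adding `ε t ^ w a` to the coordinate makes its order exactly `w
a` for all but one `ε`. For those `ε` one can divide, and the remaining case follows by continuity
in `ε`. -/
theorem WeightedOrder.of_mul {w : Fin n → ℕ} {D : Set (EuclideanSpace ℝ (Fin n))} {i : ℕ}
    {h : EuclideanSpace ℝ (Fin n) → ℝ} (hh : ContDiff ℝ ∞ h) {a : Fin n} (ha : 0 < w a)
    (H : WeightedOrder w D i fun x => x a * h x) : WeightedOrder w D (i - w a) h := by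
  intro c hc h0 hw
  rcases lt_or_ge i (w a) with hi | hi
  · rw [Nat.sub_eq_zero_of_le hi.le, pow_zero]
    exact one_dvd _
  obtain ⟨y, hy⟩ := hw a
  have hca : ∀ b, ContDiff ℝ ∞ fun t => c t b := contDiff_euclidean.mp hc
  let cε : ℝ → ℝ → EuclideanSpace ℝ (Fin n) := fun ε t =>
    c t + (ε * t ^ w a) • EuclideanSpace.single a (1 : ℝ)
  have hcε : ∀ ε, ContDiff ℝ ∞ (cε ε) := fun ε => by fun_prop
  have hser : ∀ ε, tser (fun t => cε ε t a) = PowerSeries.X ^ w a * (y + PowerSeries.C ε) := by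
    intro ε
    have e : (fun t => cε ε t a) = (fun t => c t a) + ((fun _ => ε) * fun t => t ^ w a) := by
      ext t
      simp [cε]
    have s1 : ContDiff ℝ ∞ ((fun _ : ℝ => ε) * fun t => t ^ w a) :=
      contDiff_const.mul (contDiff_id.pow _)
    rw [e, tser_add (hca a).contDiffAt s1.contDiffAt,
      tser_mul contDiffAt_const (by fun_prop), tser_const, tser_id_pow, hy]
    ring
  -- For the other `ε` the cofactor `y + ε` is prime to `X`, so the powers of `X` must divide the
  -- series of `h`.
  have key : ∀ ε, ε ≠ -PowerSeries.coeff 0 y →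
      PowerSeries.X ^ (i - w a) ∣ tser (h ∘ cε ε) := by
    intro ε hε
    have h1 := H (cε ε) (hcε ε) (by simpa [cε, zero_pow ha.ne'] using h0) fun b => by
      by_cases hb : b = a
      · subst hb
        rw [hser]
        exact dvd_mul_right _ _
      · have : (fun t => cε ε t b) = fun t => c t b := by
          ext t
          simp [cε, hb]
        rw [this]
        exact hw b
    have e : ((fun x : EuclideanSpace ℝ (Fin n) => x a * h x) ∘ cε ε) =
        (fun t => cε ε t a) * (h ∘ cε ε) := rfl
    rw [e, tser_mul ((contDiff_euclidean.mp (hcε ε) a).contDiffAt) (hh.comp (hcε ε)).contDiffAt,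
      hser, ← Nat.add_sub_cancel' hi, pow_add, mul_assoc] at h1
    have h2 := (mul_dvd_mul_iff_left (pow_ne_zero _ PowerSeries.X_ne_zero)).mp h1
    refine Prime.pow_dvd_of_dvd_mul_left PowerSeries.X_prime _ ?_ h2
    rw [PowerSeries.X_dvd_iff]
    intro h3
    apply hε
    rw [map_add, PowerSeries.constantCoeff_C] at h3
    rw [PowerSeries.coeff_zero_eq_constantCoeff]
    linarith
  have e0 : h ∘ c = h ∘ cε 0 := by
    ext t
    simp [cε]
  rw [e0, PowerSeries.X_pow_dvd_iff]
  intro j hj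
  have hcont : Continuous fun ε => iteratedDeriv j (h ∘ cε ε) 0 := by
    have := contDiffOn_iteratedDeriv_param j
      (H := fun q : ℝ × ℝ => h (cε q.1 q.2)) (O := univ) isOpen_univ
      (by
        rw [contDiffOn_univ]
        refine hh.comp ?_
        simp only [cε]
        fun_prop)
    simp only [mem_univ, ofPred_true, contDiffOn_univ] at this
    exact this.continuous
  have : (fun ε => iteratedDeriv j (h ∘ cε ε) 0) = fun _ => 0 := by
    refine hcont.ext_on (dense_compl_singleton (-PowerSeries.coeff 0 y)) continuous_const ?_
    intro ε hε
    have h1 := PowerSeries.X_pow_dvd_iff.mp (key ε hε) j hj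
    rw [coeff_tser] at h1
    exact (mul_eq_zero.mp h1).resolve_left
      (inv_ne_zero (Nat.cast_ne_zero.mpr (Nat.factorial_ne_zero j)))
  rw [coeff_tser, congrFun this 0, mul_zero]

/-- A smooth function of weighted order `≥ i` along curves is a combination of monomials of weight
`≥ i`. -/
theorem WeightedOrder.exists_mem_monIdeal {w : Fin n → ℕ} {x₀ : EuclideanSpace ℝ (Fin n)} {ρ : ℝ}
    (hx₀ : ∀ a, 0 < w a → x₀ a = 0) (i : ℕ) :
    ∀ f : C^∞⟮𝓘(ℝ, EuclideanSpace ℝ (Fin n)), EuclideanSpace ℝ (Fin n); 𝓘(ℝ, ℝ), ℝ⟯,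
      WeightedOrder w (Metric.ball x₀ ρ) i f →
      ∃ g ∈ monIdeal coordE w i, ∀ x ∈ Metric.ball x₀ ρ, f x = g x := by
  induction i using Nat.strong_induction_on with
  | _ i ih =>
  intro f hf
  rcases Nat.eq_zero_or_pos i with rfl | hi
  · exact ⟨f, by rw [monIdeal_zero]; trivial, fun _ _ => rfl⟩
  have hfs : ContDiff ℝ ∞ f := f.contMDiff.contDiff
  -- Telescoping: setting one more coordinate `a` to zero changes `f` by `x a * h` with `h` from
  -- Hadamard's lemma. The order of `h` is at least `i - w a < i`, so the induction hypothesis puts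
  -- `h` into the right monomial ideal.
  have claim : ∀ T : Finset (Fin n), (∀ a ∈ T, 0 < w a) →
      ∃ g ∈ monIdeal coordE w i, ∀ x ∈ Metric.ball x₀ ρ, f x = g x + f (zeroOn T x) := by
    intro T
    induction T using Finset.induction_on with
    | empty =>
      intro _
      refine ⟨0, zero_mem _, fun x _ => ?_⟩
      have : zeroOn ∅ x = x := by
        ext
        simp
      rw [this, smooth_zero_apply, zero_add]
    | insert a T _ ihT =>
      intro hT
      obtain ⟨g, hg, hfg⟩ := ihT fun b hb => hT b (Finset.mem_insert_of_mem hb)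
      have ha : 0 < w a := hT a (Finset.mem_insert_self _ _)
      have hDT : ∀ x ∈ Metric.ball x₀ ρ, zeroOn T x ∈ Metric.ball x₀ ρ := fun x hx =>
        zeroOn_mem_ball (fun b hb => hx₀ b (hT b (Finset.mem_insert_of_mem hb))) hx
      have hDT' : ∀ x ∈ Metric.ball x₀ ρ, zeroOn (insert a T) x ∈ Metric.ball x₀ ρ := fun x hx =>
        zeroOn_mem_ball (fun b hb => hx₀ b (hT b hb)) hx
      have hfT : ContDiff ℝ ∞ (f ∘ zeroOn T) := hfs.comp (contDiff_zeroOn T)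
      obtain ⟨h, hh, hfh⟩ := exists_sum_eq_sub (ι := Unit) hfT
        (fun _ => EuclideanSpace.proj a) (fun _ => EuclideanSpace.single a (1 : ℝ))
      replace hh := hh ()
      have hfh' : ∀ x, f (zeroOn T x) - f (zeroOn (insert a T) x) = x a * h () x := by
        intro x
        have := hfh x
        rw [Fintype.sum_unique, Fintype.sum_unique] at this
        change f (zeroOn T x) - f (zeroOn T (x - x a • EuclideanSpace.single a (1 : ℝ))) =
          x a * h () x at this
        rwa [← zeroOn_singleton, zeroOn_zeroOn_singleton] at this
      have hord : WeightedOrder w (Metric.ball x₀ ρ) i fun x => x a * h () x := by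
        intro c hc h0 hw
        have h1 := hf.comp_zeroOn hDT c hc h0 hw
        have h2 := hf.comp_zeroOn hDT' c hc h0 hw
        have e : (f ∘ zeroOn T) ∘ c = (fun x => x a * h () x) ∘ c + (f ∘ zeroOn (insert a T)) ∘ c := by
          ext t
          have := hfh' (c t)
          simp only [Function.comp_apply, Pi.add_apply]
          linarith
        have s1 : ContDiff ℝ ∞ ((fun x : EuclideanSpace ℝ (Fin n) => x a * h () x) ∘ c) := by
          have : ContDiff ℝ ∞ fun x : EuclideanSpace ℝ (Fin n) => x a := by fun_prop
          exact (this.mul hh).comp hc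
        rw [e, tser_add s1.contDiffAt
          ((hfs.comp (contDiff_zeroOn _)).comp hc).contDiffAt] at h1
        exact (dvd_add_left h2).mp h1
      obtain ⟨g', hg', hgg'⟩ := ih (i - w a) (by omega) (mkSmooth (h ()) hh.contMDiff)
        (WeightedOrder.of_mul hh ha hord)
      refine ⟨g + coordE a * g', add_mem hg (mul_mem_monIdeal a hg'), fun x hx => ?_⟩
      have e1 := hfg x hx
      have e2 := hfh' x
      have e3 := hgg' x hx
      rw [mkSmooth_apply] at e3
      rw [smooth_add_apply, smooth_mul_apply, coordE_apply, ← e3]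
      linarith
  obtain ⟨g, hg, hfg⟩ := claim (Finset.univ.filter fun a => 0 < w a) (by simp)
  refine ⟨g, hg, fun x hx => ?_⟩
  rw [hfg x hx, add_eq_left]
  -- What remains is `f` on the common zeros of the coordinates of positive weight. Constant curves
  -- there are weighted, so `f` vanishes because `i > 0`.
  have h1 := hf (fun _ => zeroOn (Finset.univ.filter fun a => 0 < w a) x) contDiff_const
    (zeroOn_mem_ball (by simpa using hx₀) hx) fun a => by
      rw [tser_const]
      rcases Nat.eq_zero_or_pos (w a) with h | h
      · rw [h, pow_zero]
        exact one_dvd _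
      · simp [h]
  have h2 := PowerSeries.X_pow_dvd_iff.mp h1 0 hi
  rw [coeff_zero_tser] at h2
  exact h2

end Euclidean

/-! ### Monomial ideals on a manifold, detected by weighted curves -/

section MonomialIdeals

variable {n : ℕ} {M : Type*} [TopologicalSpace M] [ChartedSpace (EuclideanSpace ℝ (Fin n)) M]
  [IsManifold (𝓡 n) ∞ M]

theorem contMDiffOn_coord {e : OpenPartialHomeomorph M (EuclideanSpace ℝ (Fin n))}
    (he : e ∈ IsManifold.maximalAtlas (𝓡 n) ∞ M) (a : Fin n) :
    ContMDiffOn (𝓡 n) 𝓘(ℝ, ℝ) ∞ (fun p => e p a) e.source := by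
  have h : ContDiff ℝ ∞ fun x : EuclideanSpace ℝ (Fin n) => x a := by fun_prop
  exact h.contMDiff.comp_contMDiffOn (contMDiffOn_of_mem_maximalAtlas he)

theorem contDiffAt_comp_curve {f : M → ℝ} {U : Set M} (hU : IsOpen U)
    (hf : ContMDiffOn (𝓡 n) 𝓘(ℝ, ℝ) ∞ f U) (γ : Curve n M) (h : γ 0 ∈ U) :
    ContDiffAt ℝ ∞ (f ∘ γ) 0 :=
  ((hf.contMDiffAt (hU.mem_nhds h)).comp (0 : ℝ) γ.contMDiff.contMDiffAt).contDiffAt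

theorem contDiff_func_comp (f : Func n M) (γ : Curve n M) : ContDiff ℝ ∞ (f ∘ γ) :=
  (f.contMDiff.comp γ.contMDiff).contDiff

theorem eventually_curve_mem {U : Set M} (hU : IsOpen U) (γ : Curve n M) (h : γ 0 ∈ U) :
    ∀ᶠ t in 𝓝 (0 : ℝ), γ t ∈ U :=
  γ.contMDiff.continuous.continuousAt.preimage_mem_nhds (hU.mem_nhds h)

theorem comp_curve_congr {A : Type*} {f g : M → A} (γ : Curve n M) (h : f =ᶠ[𝓝 (γ 0)] g) :
    f ∘ γ =ᶠ[𝓝 (0 : ℝ)] g ∘ γ :=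
  γ.contMDiff.continuous.continuousAt.eventually h

/-- A smooth curve in `M` with a given germ in a chart. -/
theorem exists_curve_of_germ {e : OpenPartialHomeomorph M (EuclideanSpace ℝ (Fin n))}
    (he : e ∈ IsManifold.maximalAtlas (𝓡 n) ∞ M) {c : ℝ → EuclideanSpace ℝ (Fin n)}
    (hc : ContDiff ℝ ∞ c) (h0 : c 0 ∈ e.target) :
    ∃ γ : Curve n M, γ 0 = e.symm (c 0) ∧ e ∘ γ =ᶠ[𝓝 (0 : ℝ)] c := by
  obtain ⟨ε, hε, hsub⟩ := Metric.mem_nhds_iff.mp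
    (hc.continuous.continuousAt.preimage_mem_nhds (e.open_target.mem_nhds h0))
  obtain ⟨τ, hτ, hτ0, hτε⟩ := exists_reparam hε
  have hmem : ∀ t, c (τ t) ∈ e.target := fun t => hsub (by simpa using hτε t)
  refine ⟨mkSmooth (fun t => e.symm (c (τ t)))
    ((contMDiffOn_symm_of_mem_maximalAtlas he).comp_contMDiff (hc.comp hτ).contMDiff hmem), ?_, ?_⟩
  · have : τ 0 = 0 := hτ0.self_of_nhds
    rw [mkSmooth_apply, this]
  · filter_upwards [hτ0] with t ht
    simp only [Function.comp_apply, coe_mkSmooth]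
    rw [e.right_inv (hmem t), ht, id]

open Classical in
/-- Extension by zero of a function on an open set. -/
noncomputable def extendZero (V : TopologicalSpace.Opens M) (f : V → ℝ) (x : M) : ℝ :=
  if h : x ∈ V then f ⟨x, h⟩ else 0

theorem extendZero_apply {V : TopologicalSpace.Opens M} (f : V → ℝ) (x : V) :
    extendZero V f x = f x := by
  simp [extendZero]

theorem contMDiffOn_extendZero {V : TopologicalSpace.Opens M} (f : C^∞⟮𝓡 n, V; 𝓘(ℝ, ℝ), ℝ⟯) :
    ContMDiffOn (𝓡 n) 𝓘(ℝ, ℝ) ∞ (extendZero V f) V := by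
  intro x hx
  refine ContMDiffAt.contMDiffWithinAt ?_
  have h : ContMDiffAt (𝓡 n) 𝓘(ℝ, ℝ) ∞ (fun y : V => extendZero V f y) ⟨x, hx⟩ := by
    simp only [extendZero_apply]
    exact f.contMDiff.contMDiffAt
  exact contMDiffAt_subtype_iff.mp h

/-- The coordinates of a chart on an open subset of its domain. -/
noncomputable def coordOn {e : OpenPartialHomeomorph M (EuclideanSpace ℝ (Fin n))}
    (he : e ∈ IsManifold.maximalAtlas (𝓡 n) ∞ M) {V : TopologicalSpace.Opens M}
    (hV : V ≤ chartDomain e) (a : Fin n) : C^∞⟮𝓡 n, V; 𝓘(ℝ, ℝ), ℝ⟯ :=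
  mkSmooth (fun x => e x a)
    ((contMDiffOn_coord he a).comp_contMDiff contMDiff_subtype_val fun x => hV x.2)

theorem monomialIdeal_eq {e : OpenPartialHomeomorph M (EuclideanSpace ℝ (Fin n))}
    (he : e ∈ IsManifold.maximalAtlas (𝓡 n) ∞ M) {V : TopologicalSpace.Opens M}
    (hV : V ≤ chartDomain e) (w : Fin n → ℕ) (i : ℕ) :
    monomialIdeal e w i V = monIdeal (coordOn he hV) w i := by
  unfold monomialIdeal monIdeal
  congr 1
  ext g
  refine exists_congr fun s => and_congr_right fun _ => ?_
  constructor
  · intro h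
    ext x
    rw [h x, smooth_prod_apply]
    rfl
  · rintro rfl x
    rw [smooth_prod_apply]
    rfl

/-- The curves that vanish to order `w a` in the `a`-th coordinate of a chart. -/
def IsWeightedCurve (e : OpenPartialHomeomorph M (EuclideanSpace ℝ (Fin n))) (w : Fin n → ℕ)
    (γ : Curve n M) : Prop :=
  ∀ a, PowerSeries.X ^ w a ∣ tser fun t => e (γ t) a

/-- Along a weighted curve the factor `x_a ^ s_a` is divisible by `X ^ (s_a w_a)`; multiplying by
smooth functions preserves divisibility. -/
theorem X_pow_dvd_tser_of_mem_monomialIdeal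
    {e : OpenPartialHomeomorph M (EuclideanSpace ℝ (Fin n))}
    (he : e ∈ IsManifold.maximalAtlas (𝓡 n) ∞ M) {w : Fin n → ℕ} {i : ℕ}
    {V : TopologicalSpace.Opens M} (hV : V ≤ chartDomain e) {f : C^∞⟮𝓡 n, V; 𝓘(ℝ, ℝ), ℝ⟯}
    (hf : f ∈ monomialIdeal e w i V) {γ : Curve n M} (h0 : γ 0 ∈ V) (hγ : IsWeightedCurve e w γ) :
    PowerSeries.X ^ i ∣ tser (extendZero V f ∘ γ) := by
  have hs : ∀ f : C^∞⟮𝓡 n, V; 𝓘(ℝ, ℝ), ℝ⟯, ContDiffAt ℝ ∞ (extendZero V f ∘ γ) 0 := fun f =>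
    contDiffAt_comp_curve V.2 (contMDiffOn_extendZero f) γ h0
  unfold monomialIdeal at hf
  induction hf using Submodule.span_induction with
  | mem g hg =>
    obtain ⟨s, hsi, hg⟩ := hg
    have hx : ∀ a, ContDiffAt ℝ ∞ (fun t => e (γ t) a) 0 := fun a =>
      contDiffAt_comp_curve e.open_source (contMDiffOn_coord he a) γ (hV h0)
    have e1 : extendZero V g ∘ γ =ᶠ[𝓝 (0 : ℝ)] fun t => ∏ a, e (γ t) a ^ s a := by
      filter_upwards [eventually_curve_mem V.2 γ h0] with t ht
      exact (extendZero_apply g ⟨γ t, ht⟩).trans (hg ⟨γ t, ht⟩)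
    rw [tser_congr e1, tser_prod fun a => (hx a).pow _]
    refine (pow_dvd_pow _ hsi).trans ?_
    rw [← Finset.prod_pow_eq_pow_sum]
    refine Finset.prod_dvd_prod_of_dvd _ _ fun a _ => ?_
    rw [tser_pow (hx a), mul_comm, pow_mul]
    exact pow_dvd_pow_of_dvd (hγ a) _
  | zero =>
    have : extendZero V (0 : C^∞⟮𝓡 n, V; 𝓘(ℝ, ℝ), ℝ⟯) ∘ γ = fun _ => 0 := by
      ext t
      by_cases h : γ t ∈ V <;> simp [extendZero, h]
    rw [this, tser_const]
    simp
  | add g h _ _ hg hh =>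
    have : extendZero V ⇑(g + h) ∘ γ = extendZero V g ∘ γ + extendZero V h ∘ γ := by
      ext t
      by_cases h : γ t ∈ V
      · simp [extendZero, h]
      · simp [extendZero, h]
    rw [this, tser_add (hs g) (hs h)]
    exact dvd_add hg hh
  | smul r g _ hg =>
    have : extendZero V ⇑(r • g) ∘ γ = (extendZero V r ∘ γ) * (extendZero V g ∘ γ) := by
      ext t
      by_cases h : γ t ∈ V
      · simp only [Function.comp_apply, Pi.mul_apply, extendZero, dif_pos h]
        rfl
      · simp [extendZero, h]
    rw [this, tser_mul (hs r) (hs g)]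
    exact hg.mul_left _

variable [T2Space M] [SecondCountableTopology M]

/-- Membership in the ideal of weight `≥ i` is tested by the curves that vanish in the coordinates
to the orders given by the weights. -/
theorem mem_monomialIdeal_iff {e : OpenPartialHomeomorph M (EuclideanSpace ℝ (Fin n))}
    (he : e ∈ IsManifold.maximalAtlas (𝓡 n) ∞ M) {w : Fin n → ℕ} {i : ℕ}
    {V : TopologicalSpace.Opens M} (hV : V ≤ chartDomain e) {f : C^∞⟮𝓡 n, V; 𝓘(ℝ, ℝ), ℝ⟯} :
    f ∈ monomialIdeal e w i V ↔ ∀ γ : Curve n M, γ 0 ∈ V → IsWeightedCurve e w γ →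
      PowerSeries.X ^ i ∣ tser (extendZero V f ∘ γ) := by
  refine ⟨fun hf γ h0 hγ => X_pow_dvd_tser_of_mem_monomialIdeal he hV hf h0 hγ, fun H => ?_⟩
  have : LocallyCompactSpace V := Manifold.locallyCompact_of_finiteDimensional (𝓡 n)
  rw [monomialIdeal_eq he hV, monIdeal_eq_span_range]
  refine mem_span_of_locally _ _ fun x => ?_
  have hxe : (x : M) ∈ e.source := hV x.2
  -- Where a coordinate of positive weight does not vanish, its `i`-th power is an invertible
  -- monomial of weight `≥ i`, and this single generator suffices.
  by_cases hx : ∃ a, 0 < w a ∧ e x a ≠ 0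
  · obtain ⟨a, ha, hxa⟩ := hx
    have hcont : Continuous fun y : V => e y a := (coordOn he hV a).contMDiff.continuous
    refine ⟨{y : V | e y a ≠ 0}, (isOpen_ne_fun hcont continuous_const).mem_nhds hxa,
      fun s y => if s = Pi.single a (Fin.last i) then f y * (e y a ^ i)⁻¹ else 0, ?_, ?_⟩
    · intro s
      by_cases hs : s = Pi.single a (Fin.last i)
      · simp only [if_pos hs]
        refine f.contMDiff.contMDiffOn.mul ?_
        intro y hy
        have h1 : ContMDiffAt (𝓡 n) 𝓘(ℝ, ℝ) ∞ (fun y : V => e y a ^ i) y :=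
          ((coordOn he hV a) ^ i).contMDiff.contMDiffAt
        exact (h1.inv₀ (pow_ne_zero i hy)).contMDiffWithinAt
      · simp only [if_neg hs]
        exact contMDiffOn_const
    · intro y hy
      have h1 : ∀ b, ((Pi.single a (Fin.last i) : Fin n → Fin (i + 1)) b : ℕ) =
          if b = a then i else 0 := by
        intro b
        by_cases hb : b = a
        · subst hb; simp
        · simp [hb]
      have h2 : monGen (coordOn he hV) w i (Pi.single a (Fin.last i)) = coordOn he hV a ^ i := by
        unfold monGen
        rw [if_pos]
        · rw [Finset.prod_eq_single a]
          · rw [h1, if_pos rfl]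
          · intro b _ hb
            rw [h1, if_neg hb, pow_zero]
          · simp
        · rw [Finset.sum_eq_single a]
          · rw [h1, if_pos rfl]
            exact Nat.le_mul_of_pos_right _ ha
          · intro b _ hb
            rw [h1, if_neg hb, zero_mul]
          · simp
      rw [Finset.sum_eq_single (Pi.single a (Fin.last i))]
      · beta_reduce
        rw [if_pos rfl, h2, smooth_pow_apply]
        change f y = f y * (e y a ^ i)⁻¹ * e y a ^ i
        rw [mul_assoc, inv_mul_cancel₀ (pow_ne_zero i hy), mul_one]
      · intro s _ hs
        beta_reduce
        rw [if_neg hs, zero_mul]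
      · simp
  -- Now all coordinates of positive weight vanish at the point. Read in the chart and extended to a
  -- global function, `f` falls under the Euclidean result on a small ball.
  · push Not at hx
    set O : Set (EuclideanSpace ℝ (Fin n)) := e.target ∩ e.symm ⁻¹' V with hO
    have hOo : IsOpen O := e.isOpen_inter_preimage_symm V.2
    have hxO : e x ∈ O := ⟨e.map_source hxe, by
      rw [mem_preimage, e.left_inv hxe]
      exact x.2⟩
    have hfO : ContMDiffOn 𝓘(ℝ, EuclideanSpace ℝ (Fin n)) 𝓘(ℝ, ℝ) ∞ (extendZero V f ∘ e.symm) O :=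
      (contMDiffOn_extendZero f).comp ((contMDiffOn_symm_of_mem_maximalAtlas he).mono
        inter_subset_left) inter_subset_right
    obtain ⟨G, hG⟩ := exists_extension (V := EuclideanSpace ℝ (Fin n)) hOo hxO hfO
    obtain ⟨ρ, hρ, hball⟩ := Metric.mem_nhds_iff.mp (Filter.inter_mem (hOo.mem_nhds hxO) hG)
    have hord : WeightedOrder w (Metric.ball (e x) ρ) i G := by
      intro c hc h0 hw
      obtain ⟨γ, hγ0, hγ⟩ := exists_curve_of_germ he hc (hball h0).1.1
      have hγV : γ 0 ∈ V := by
        rw [hγ0]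
        exact (hball h0).1.2
      have h1 := H γ hγV fun a => by
        have : (fun t => e (γ t) a) =ᶠ[𝓝 (0 : ℝ)] fun t => c t a := by
          filter_upwards [hγ] with t ht
          rw [← ht]
          rfl
        rw [tser_congr this]
        exact hw a
      have h2 : extendZero V f ∘ γ =ᶠ[𝓝 (0 : ℝ)] G ∘ c := by
        filter_upwards [hγ, eventually_curve_mem V.2 γ hγV,
          hc.continuous.continuousAt.preimage_mem_nhds (Metric.isOpen_ball.mem_nhds h0)]
          with t h1 h2 h3
        have h4 : G (c t) = (extendZero V f ∘ e.symm) (c t) := (hball h3).2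
        rw [Function.comp_apply, Function.comp_apply, h4, ← h1]
        simp only [Function.comp_apply]
        rw [e.left_inv (hV h2)]
      rwa [tser_congr h2] at h1
    obtain ⟨g, hg, hGg⟩ := hord.exists_mem_monIdeal (fun a ha => hx a ha) i
    rw [monIdeal_eq_span_range, Ideal.mem_span_range_iff_exists_fun] at hg
    obtain ⟨c, rfl⟩ := hg
    have hcont : ContinuousOn (fun y : V => e y) univ := fun y _ =>
      ((e.continuousAt (hV y.2)).comp continuous_subtype_val.continuousAt).continuousWithinAt
    rw [continuousOn_univ] at hcont
    refine ⟨{y : V | e y ∈ Metric.ball (e x) ρ},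
      (Metric.isOpen_ball.preimage hcont).mem_nhds (Metric.mem_ball_self hρ),
      fun s y => c s (e y), fun s => ?_, fun y hy => ?_⟩
    · have h1 : ContMDiff (𝓡 n) 𝓘(ℝ, EuclideanSpace ℝ (Fin n)) ∞ fun y : V => e y :=
        (contMDiffOn_of_mem_maximalAtlas he).comp_contMDiff contMDiff_subtype_val fun y => hV y.2
      exact ((c s).contMDiff.comp h1).contMDiffOn
    · have h1 : f y = G (e y) := by
        have : G (e y) = (extendZero V f ∘ e.symm) (e y) := (hball hy).2
        rw [this, Function.comp_apply, e.left_inv (hV y.2), extendZero_apply]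
      rw [h1, hGg _ hy, smooth_sum_apply]
      refine Finset.sum_congr rfl fun s _ => ?_
      rw [smooth_mul_apply]
      congr 1
      unfold monGen
      split_ifs
      · rw [smooth_prod_apply, smooth_prod_apply]
        rfl
      · rfl

end MonomialIdeals

/-! ### Adapted charts and their equivalence with weightings -/

section AdaptedCharts

variable {n : ℕ} {M : Type*} [TopologicalSpace M] [ChartedSpace (EuclideanSpace ℝ (Fin n)) M]
  [IsManifold (𝓡 n) ∞ M] {k : ℕ}

/-- The functions that vanish to order `i` along the curves with `k`-jet in `Q`. -/
noncomputable def curveOrderIdeal (Q : Set (JetBundle n M k)) (i : ℕ) : Ideal (Func n M) where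
  carrier := {f | ∀ γ : Curve n M, jet k γ ∈ Q → PowerSeries.X ^ i ∣ tser (f ∘ γ)}
  zero_mem' := fun γ _ => by
    have : ⇑(0 : Func n M) ∘ γ = fun _ => 0 := rfl
    rw [this, tser_const, map_zero]
    exact dvd_zero _
  add_mem' := fun {f g} hf hg γ hγ => by
    have : ⇑(f + g) ∘ γ = f ∘ γ + g ∘ γ := rfl
    rw [this, tser_add (contDiff_func_comp f γ).contDiffAt (contDiff_func_comp g γ).contDiffAt]
    exact dvd_add (hf γ hγ) (hg γ hγ)
  smul_mem' := fun c f hf γ hγ => by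
    have : ⇑(c • f) ∘ γ = (c ∘ γ) * (f ∘ γ) := rfl
    rw [this, tser_mul (contDiff_func_comp c γ).contDiffAt (contDiff_func_comp f γ).contDiffAt]
    exact (hf γ hγ).mul_left _

theorem mem_curveOrderIdeal {Q : Set (JetBundle n M k)} {i : ℕ} {f : Func n M} :
    f ∈ curveOrderIdeal Q i ↔
      ∀ γ : Curve n M, jet k γ ∈ Q → PowerSeries.X ^ i ∣ tser (f ∘ γ) := Iff.rfl

theorem lift_jet (f : Func n M) (j : Fin (k + 1)) (γ : Curve n M) :
    lift f j (jet k γ) = PowerSeries.coeff (j : ℕ) (tser (f ∘ γ)) := by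
  rw [coeff_tser]
  rfl

theorem mem_vanishingIdeal {Q : Set (JetBundle n M k)} {g : JetFunc n M k} :
    g ∈ vanishingIdeal Q ↔ ∀ u ∈ Q, g u = 0 := Iff.rfl

theorem lift_mem_vanishingIdeal {Q : Set (JetBundle n M k)} {f : Func n M} {j : Fin (k + 1)} :
    lift f j ∈ vanishingIdeal Q ↔
      ∀ γ : Curve n M, jet k γ ∈ Q → PowerSeries.coeff (j : ℕ) (tser (f ∘ γ)) = 0 := by
  rw [mem_vanishingIdeal]
  constructor
  · intro h γ hγ
    rw [← lift_jet]
    exact h _ hγ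
  · intro h u hu
    obtain ⟨γ, rfl⟩ := exists_jet u
    rw [lift_jet]
    exact h γ hu

/-- The chart `e` with the weights `w` straightens `Q`. -/
structure IsAdapted (Q : Set (JetBundle n M k))
    (e : OpenPartialHomeomorph M (EuclideanSpace ℝ (Fin n))) (w : Fin n → ℕ) : Prop where
  mem_maximalAtlas : e ∈ IsManifold.maximalAtlas (𝓡 n) ∞ M
  monotone : Monotone w
  le_order : ∀ a, w a ≤ k + 1
  jet_mem_iff : ∀ γ : Curve n M, γ 0 ∈ e.source → (jet k γ ∈ Q ↔ IsWeightedCurve e w γ)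

variable [T2Space M] [SecondCountableTopology M]

theorem sigmaCompactSpace_of_chartedSpace (n : ℕ) (M : Type*) [TopologicalSpace M]
    [ChartedSpace (EuclideanSpace ℝ (Fin n)) M] [SecondCountableTopology M] :
    SigmaCompactSpace M :=
  have := Manifold.locallyCompact_of_finiteDimensional (M := M) (𝓡 n)
  inferInstance

/-- A function near `p` extends to a global one that vanishes along a curve to at least the same
order. -/
theorem exists_localized {U : Set M} (hU : IsOpen U) {p : M} (hp : p ∈ U) {g : M → ℝ}
    (hg : ContMDiffOn (𝓡 n) 𝓘(ℝ, ℝ) ∞ g U) :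
    ∃ f : Func n M, ⇑f =ᶠ[𝓝 p] g ∧ ∀ (γ : Curve n M) (i : ℕ),
      (γ 0 ∈ U → PowerSeries.X ^ i ∣ tser (g ∘ γ)) → PowerSeries.X ^ i ∣ tser (f ∘ γ) := by
  have := sigmaCompactSpace_of_chartedSpace n M
  obtain ⟨χ, h1, h2⟩ := exists_bump (V := EuclideanSpace ℝ (Fin n)) hU isClosed_singleton
    (singleton_subset_iff.mpr hp)
  rw [nhdsSet_singleton] at h1
  refine ⟨mkSmooth (fun x => χ x * g x) (contMDiff_mul_of_tsupport hU χ.contMDiff h2 hg), ?_, ?_⟩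
  · filter_upwards [h1] with x hx
    rw [mkSmooth_apply, hx, one_mul]
  · intro γ i H
    by_cases h0 : γ 0 ∈ U
    · have e : ⇑(mkSmooth (fun x => χ x * g x)
          (contMDiff_mul_of_tsupport hU χ.contMDiff h2 hg)) ∘ γ = (χ ∘ γ) * (g ∘ γ) := rfl
      rw [e, tser_mul (contDiff_func_comp χ γ).contDiffAt (contDiffAt_comp_curve hU hg γ h0)]
      exact (H h0).mul_left _
    · have hχ : ⇑χ =ᶠ[𝓝 (γ 0)] 0 := notMem_tsupport_iff_eventuallyEq.mp fun h => h0 (h2 h)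
      have e : ⇑(mkSmooth (fun x => χ x * g x)
          (contMDiff_mul_of_tsupport hU χ.contMDiff h2 hg)) ∘ γ =ᶠ[𝓝 (0 : ℝ)] fun _ => 0 := by
        filter_upwards [comp_curve_congr γ hχ] with t ht
        simp only [Function.comp_apply, Pi.zero_apply] at ht
        simp [ht]
      rw [tser_congr e, tser_const, map_zero]
      exact dvd_zero _

theorem restrictTo_mem_monomialIdeal_iff
    {e : OpenPartialHomeomorph M (EuclideanSpace ℝ (Fin n))}
    (he : e ∈ IsManifold.maximalAtlas (𝓡 n) ∞ M) {w : Fin n → ℕ} {i : ℕ} {f : Func n M} :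
    restrictTo (chartDomain e) f ∈ monomialIdeal e w i (chartDomain e) ↔
      ∀ γ : Curve n M, γ 0 ∈ e.source → IsWeightedCurve e w γ →
        PowerSeries.X ^ i ∣ tser (f ∘ γ) := by
  rw [mem_monomialIdeal_iff he le_rfl]
  refine forall_congr' fun γ => forall_congr' fun h0 => forall_congr' fun _ => ?_
  have : extendZero (chartDomain e) (restrictTo (chartDomain e) f) ∘ γ =ᶠ[𝓝 (0 : ℝ)] f ∘ γ := by
    filter_upwards [eventually_curve_mem e.open_source γ h0] with t ht
    exact extendZero_apply (V := chartDomain e) _ ⟨γ t, ht⟩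
  rw [tser_congr this]

/-- The coordinate `x_a` is itself a monomial of weight `w a`. It therefore lies in the ideal of
that weight of the other chart and vanishes to order `w a` along the weighted curves of that chart.
-/
theorem IsWeightedCurve.of_monomialIdeal_eq
    {e e' : OpenPartialHomeomorph M (EuclideanSpace ℝ (Fin n))}
    (he : e ∈ IsManifold.maximalAtlas (𝓡 n) ∞ M) (he' : e' ∈ IsManifold.maximalAtlas (𝓡 n) ∞ M)
    {w w' : Fin n → ℕ}
    (h : ∀ i, monomialIdeal e w i (chartDomain e ⊓ chartDomain e') =
      monomialIdeal e' w' i (chartDomain e ⊓ chartDomain e'))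
    {γ : Curve n M} (h0 : γ 0 ∈ e.source) (h0' : γ 0 ∈ e'.source)
    (hγ : IsWeightedCurve e' w' γ) : IsWeightedCurve e w γ := by
  intro a
  have hV : chartDomain e ⊓ chartDomain e' ≤ chartDomain e := inf_le_left
  have h1 : coordOn he hV a ∈ monomialIdeal e w (w a) (chartDomain e ⊓ chartDomain e') := by
    rw [monomialIdeal_eq he hV]
    exact Ideal.subset_span ⟨Pi.single a 1, by simp [Pi.single_apply], by
      rw [Finset.prod_eq_single a]
      · simp
      · intro b _ hb
        simp [hb]
      · simp⟩
  rw [h] at h1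
  have h2 := X_pow_dvd_tser_of_mem_monomialIdeal he' inf_le_right h1 (γ := γ) ⟨h0, h0'⟩ hγ
  have e1 : extendZero (chartDomain e ⊓ chartDomain e') (coordOn he hV a) ∘ γ =ᶠ[𝓝 (0 : ℝ)]
      fun t => e (γ t) a := by
    filter_upwards [eventually_curve_mem (e.open_source.inter e'.open_source) γ ⟨h0, h0'⟩] with t ht
    exact extendZero_apply (V := chartDomain e ⊓ chartDomain e') _ ⟨γ t, ht⟩
  rwa [tser_congr e1] at h2

/-- The localized coordinate `x_a` lies in `F i` for all `i ≤ w a`, so its lifts of order below `w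
a` vanish on the subset that is cut out. Conversely, members of `F (j + 1)` vanish to order `j + 1`
along weighted curves. -/
theorem IsWeightedCovering.isAdapted {F : ℕ → Ideal (Func n M)}
    {A : Set (OpenPartialHomeomorph M (EuclideanSpace ℝ (Fin n)))}
    {w : OpenPartialHomeomorph M (EuclideanSpace ℝ (Fin n)) → Fin n → ℕ}
    (H : IsWeightedCovering (k + 1) F A w) {e : OpenPartialHomeomorph M (EuclideanSpace ℝ (Fin n))}
    (he : e ∈ A) : IsAdapted (cutOut k F) e (w e) := by
  have he' := H.mem_maximalAtlas e he
  refine ⟨he', H.monotone e he, H.le_order e he, fun γ h0 => ⟨fun hγ a => ?_, fun hγ j f hf => ?_⟩⟩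
  · obtain ⟨f, hf, hf'⟩ := exists_localized e.open_source h0 (contMDiffOn_coord he' a)
    -- Membership in `F i` must be checked in every chart of the covering; this is where agreement
    -- of the ideals on overlaps is needed.
    have hmem : ∀ i ≤ w e a, f ∈ F i := by
      intro i hi
      refine (H.mem_iff i f).mpr fun e' he'A => ?_
      have he'' := H.mem_maximalAtlas e' he'A
      rw [restrictTo_mem_monomialIdeal_iff he'']
      intro δ hδ hwδ
      refine hf' δ i fun hδe => ?_
      exact (pow_dvd_pow _ hi).trans
        (IsWeightedCurve.of_monomialIdeal_eq he' he'' (H.agree e he e' he'A) hδe hδ hwδ a)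
    rw [PowerSeries.X_pow_dvd_iff]
    intro j hj
    have hjk : j < k + 1 := hj.trans_le (H.le_order e he a)
    have h1 := hγ ⟨j, hjk⟩ f (hmem _ hj)
    rw [lift_jet, tser_congr (comp_curve_congr γ hf)] at h1
    exact h1
  · have h1 := (restrictTo_mem_monomialIdeal_iff he').mp ((H.mem_iff _ f).mp hf e he) γ h0 hγ
    rw [lift_jet]
    exact PowerSeries.X_pow_dvd_iff.mp h1 j (Nat.lt_succ_self _)

theorem mem_curveOrderIdeal_iff_of_isAdapted {Q : Set (JetBundle n M k)}
    {A : Set (OpenPartialHomeomorph M (EuclideanSpace ℝ (Fin n)))}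
    {w : OpenPartialHomeomorph M (EuclideanSpace ℝ (Fin n)) → Fin n → ℕ}
    (hA : ∀ e ∈ A, IsAdapted Q e (w e)) (hcov : ∀ p : M, ∃ e ∈ A, p ∈ e.source) (i : ℕ)
    (f : Func n M) : f ∈ curveOrderIdeal Q i ↔
      ∀ e ∈ A, restrictTo (chartDomain e) f ∈ monomialIdeal e (w e) i (chartDomain e) := by
  constructor
  · intro h e he
    rw [restrictTo_mem_monomialIdeal_iff (hA e he).mem_maximalAtlas]
    exact fun γ h0 hγ => h γ (((hA e he).jet_mem_iff γ h0).mpr hγ)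
  · intro h γ hγ
    obtain ⟨e, he, h0⟩ := hcov (γ 0)
    exact (restrictTo_mem_monomialIdeal_iff (hA e he).mem_maximalAtlas).mp (h e he) γ h0
      (((hA e he).jet_mem_iff γ h0).mp hγ)

/-- Both sides are tested by the same curves. In particular a weighting is determined, in all
degrees, by the subset it defines. -/
theorem IsWeightedCovering.eq_curveOrderIdeal {F : ℕ → Ideal (Func n M)}
    {A : Set (OpenPartialHomeomorph M (EuclideanSpace ℝ (Fin n)))}
    {w : OpenPartialHomeomorph M (EuclideanSpace ℝ (Fin n)) → Fin n → ℕ}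
    (H : IsWeightedCovering (k + 1) F A w) (i : ℕ) : F i = curveOrderIdeal (cutOut k F) i := by
  ext f
  rw [H.mem_iff, mem_curveOrderIdeal_iff_of_isAdapted (fun e he => H.isAdapted he) H.covers]

/-- On overlaps both monomial ideals are tested by the curves with jet in `Q`, a condition in which
the chart no longer occurs. -/
theorem isWeightedCovering_of_isAdapted {Q : Set (JetBundle n M k)}
    {A : Set (OpenPartialHomeomorph M (EuclideanSpace ℝ (Fin n)))}
    {w : OpenPartialHomeomorph M (EuclideanSpace ℝ (Fin n)) → Fin n → ℕ}
    (hA : ∀ e ∈ A, IsAdapted Q e (w e)) (hcov : ∀ p : M, ∃ e ∈ A, p ∈ e.source) :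
    IsWeightedCovering (k + 1) (curveOrderIdeal Q) A w where
  mem_maximalAtlas e he := (hA e he).mem_maximalAtlas
  covers := hcov
  monotone e he := (hA e he).monotone
  le_order e he := (hA e he).le_order
  agree e he e' he' i := by
    ext f
    rw [mem_monomialIdeal_iff (hA e he).mem_maximalAtlas inf_le_left,
      mem_monomialIdeal_iff (hA e' he').mem_maximalAtlas inf_le_right]
    refine forall_congr' fun γ => forall_congr' fun h0 => ?_
    rw [← (hA e he).jet_mem_iff γ h0.1, ← (hA e' he').jet_mem_iff γ h0.2]
  mem_iff i f := mem_curveOrderIdeal_iff_of_isAdapted hA hcov i f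

/-- A localized coordinate of an adapted chart has its weight as its filtration degree. -/
theorem IsAdapted.exists_localized_coord {Q : Set (JetBundle n M k)}
    {e : OpenPartialHomeomorph M (EuclideanSpace ℝ (Fin n))} {w : Fin n → ℕ}
    (h : IsAdapted Q e w) {p : M} (hp : p ∈ e.source) (a : Fin n) :
    ∃ f ∈ curveOrderIdeal Q (w a), ⇑f =ᶠ[𝓝 p] fun q => e q a := by
  obtain ⟨f, hf, hf'⟩ := exists_localized e.open_source hp (contMDiffOn_coord h.mem_maximalAtlas a)
  exact ⟨f, fun γ hγ => hf' γ _ fun h0 => (h.jet_mem_iff γ h0).mp hγ a, hf⟩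

theorem curveOrderIdeal_antitone (Q : Set (JetBundle n M k)) : Antitone (curveOrderIdeal Q) :=
  fun _ _ hij _ hf γ hγ => (pow_dvd_pow _ hij).trans (hf γ hγ)

/-- The nontrivial inclusion holds because the lifts of the localized coordinates of an adapted
chart give back the equations of `Q` in that chart. -/
theorem cutOut_curveOrderIdeal {Q : Set (JetBundle n M k)}
    (hcov : ∀ p : M, ∃ e w, IsAdapted Q e w ∧ p ∈ e.source) :
    Q = cutOut k (curveOrderIdeal Q) := by
  apply Subset.antisymm
  · intro u hu j f hf
    obtain ⟨γ, rfl⟩ := exists_jet u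
    rw [lift_jet]
    exact PowerSeries.X_pow_dvd_iff.mp (hf γ hu) j (Nat.lt_succ_self _)
  · intro u hu
    obtain ⟨γ, rfl⟩ := exists_jet u
    obtain ⟨e, w, h, h0⟩ := hcov (γ 0)
    refine (h.jet_mem_iff γ h0).mpr fun a => ?_
    obtain ⟨f, hf, hfe⟩ := h.exists_localized_coord h0 a
    rw [PowerSeries.X_pow_dvd_iff]
    intro j hj
    have h1 := hu ⟨j, hj.trans_le (h.le_order a)⟩ f (curveOrderIdeal_antitone Q hj hf)
    rw [lift_jet, tser_congr (comp_curve_congr γ hfe)] at h1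
    exact h1

/-- `Q` is defined by a weighting if and only if there are adapted charts around all points. -/
theorem exists_isWeighting_iff {Q : Set (JetBundle n M k)} :
    (∃ F : ℕ → Ideal (Func n M), IsWeighting (k + 1) F ∧ Q = cutOut k F) ↔
      ∀ p : M, ∃ e w, IsAdapted Q e w ∧ p ∈ e.source := by
  constructor
  · rintro ⟨F, ⟨A, w, H⟩, rfl⟩ p
    obtain ⟨e, he, hp⟩ := H.covers p
    exact ⟨e, w e, H.isAdapted he, hp⟩
  · intro hcov
    classical
    let A : Set (OpenPartialHomeomorph M (EuclideanSpace ℝ (Fin n))) := {e | ∃ w, IsAdapted Q e w}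
    -- A chart can be adapted for several weights, for instance if it misses the base of `Q`; any
    -- choice works. The default `0` is never used on `A`.
    let w : OpenPartialHomeomorph M (EuclideanSpace ℝ (Fin n)) → Fin n → ℕ := fun e =>
      if h : ∃ w, IsAdapted Q e w then h.choose else 0
    refine ⟨curveOrderIdeal Q, ⟨A, w, isWeightedCovering_of_isAdapted (fun e he => ?_) fun p => ?_⟩,
      cutOut_curveOrderIdeal hcov⟩
    · have he' : ∃ w, IsAdapted Q e w := he
      simp only [w, dif_pos he']
      exact he'.choose_spec
    · obtain ⟨e, w, h, hp⟩ := hcov p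
      exact ⟨e, ⟨w, h⟩, hp⟩

theorem exists_isWeightingWithWeights_iff {Q : Set (JetBundle n M k)} {w : Fin n → ℕ} :
    (∃ F : ℕ → Ideal (Func n M), IsWeightingWithWeights (k + 1) w F ∧ Q = cutOut k F) ↔
      ∀ p : M, ∃ e, IsAdapted Q e w ∧ p ∈ e.source := by
  constructor
  · rintro ⟨F, ⟨A, H⟩, rfl⟩ p
    obtain ⟨e, he, hp⟩ := H.covers p
    exact ⟨e, H.isAdapted he, hp⟩
  · intro hcov
    refine ⟨curveOrderIdeal Q, ⟨{e | IsAdapted Q e w}, isWeightedCovering_of_isAdapted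
      (fun e he => he) fun p => ?_⟩, cutOut_curveOrderIdeal fun p => ?_⟩
    · obtain ⟨e, h, hp⟩ := hcov p
      exact ⟨e, h, hp⟩
    · obtain ⟨e, h, hp⟩ := hcov p
      exact ⟨e, w, h, hp⟩

end AdaptedCharts

/-! ### Adapted charts imply the condition on lower lifts, and the formula for the filtration -/

section LowerLifts

variable {n : ℕ} {M : Type*} [TopologicalSpace M] [ChartedSpace (EuclideanSpace ℝ (Fin n)) M]
  [IsManifold (𝓡 n) ∞ M] {k : ℕ}

theorem lift_zero_apply (f : Func n M) (u : JetBundle n M k) :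
    lift f (0 : Fin (k + 1)) u = f u.base := by
  obtain ⟨γ, rfl⟩ := exists_jet u
  rw [lift_jet, Fin.val_zero, coeff_zero_tser]
  rfl

theorem IsWeightedCurve.comp {e : OpenPartialHomeomorph M (EuclideanSpace ℝ (Fin n))}
    (he : e ∈ IsManifold.maximalAtlas (𝓡 n) ∞ M) {w : Fin n → ℕ} {γ δ : Curve n M}
    (h0 : γ 0 ∈ e.source) (hγ : IsWeightedCurve e w γ) {ψ : ℝ → ℝ} (hψ : ContDiff ℝ ∞ ψ)
    (hψ0 : ψ 0 = 0) (hδ : ∀ t, δ t = γ (ψ t)) : IsWeightedCurve e w δ := by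
  intro a
  have := X_pow_dvd_tser_comp (w a)
    (contDiffAt_comp_curve e.open_source (contMDiffOn_coord he a) γ h0) hψ.contDiffAt hψ0 (hγ a)
  simp only [hδ]
  exact this

/-- Reparametrization of a curve. -/
noncomputable def reparam (γ : Curve n M) (ψ : ℝ → ℝ) (hψ : ContDiff ℝ ∞ ψ) : Curve n M :=
  mkSmooth (fun t => γ (ψ t)) (γ.contMDiff.comp hψ.contMDiff)

theorem IsAdapted.reparam_mem {Q : Set (JetBundle n M k)}
    {e : OpenPartialHomeomorph M (EuclideanSpace ℝ (Fin n))} {w : Fin n → ℕ}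
    (h : IsAdapted Q e w) {γ : Curve n M} (h0 : γ 0 ∈ e.source) (hγ : jet k γ ∈ Q) {ψ : ℝ → ℝ}
    (hψ : ContDiff ℝ ∞ ψ) (hψ0 : ψ 0 = 0) : jet k (reparam γ ψ hψ) ∈ Q := by
  have h0' : reparam γ ψ hψ 0 ∈ e.source := by
    change γ (ψ 0) ∈ e.source
    rwa [hψ0]
  exact (h.jet_mem_iff _ h0').mpr
    (IsWeightedCurve.comp h.mem_maximalAtlas h0 ((h.jet_mem_iff γ h0).mp hγ) hψ hψ0 fun _ => rfl)

/-- `Q` is stable under changes of parameter fixing `0`, so the coefficient of order `i` vanishes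
for every reparametrized curve. -/
theorem coeff_eq_zero_of_lift_mem {Q : Set (JetBundle n M k)}
    (hcov : ∀ p : M, ∃ e w, IsAdapted Q e w ∧ p ∈ e.source) {f : Func n M} {i : Fin (k + 1)}
    (hf : lift f i ∈ vanishingIdeal Q) {γ : Curve n M} (hγ : jet k γ ∈ Q) {j : ℕ} (hj : 1 ≤ j)
    (hji : j ≤ i) : PowerSeries.coeff j (tser (f ∘ γ)) = 0 := by
  obtain ⟨e, w, h, h0⟩ := hcov (γ 0)
  refine coeff_tser_eq_zero_of_reparam (contDiff_func_comp f γ) (i := i) ?_ j hj hji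
  intro ψ hψ hψ0
  exact lift_mem_vanishingIdeal.mp hf _ (h.reparam_mem h0 hγ hψ hψ0)

theorem IsWeightedCurve.coord_eq_zero {e : OpenPartialHomeomorph M (EuclideanSpace ℝ (Fin n))}
    {w : Fin n → ℕ} {γ : Curve n M} (hγ : IsWeightedCurve e w γ) {a : Fin n} (ha : 0 < w a) :
    e (γ 0) a = 0 := by
  have := PowerSeries.X_pow_dvd_iff.mp (hγ a) 0 ha
  rwa [coeff_zero_tser] at this

/-- For local constancy: in an adapted chart the base of `Q` is the plane where the coordinates of
positive weight vanish. Lines in this plane have jets in `Q`, and the vanishing of the first lift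
says that `f` has zero derivative along them. -/
theorem lowerLiftsVanish_of_isAdapted {Q : Set (JetBundle n M k)}
    (hcov : ∀ p : M, ∃ e w, IsAdapted Q e w ∧ p ∈ e.source) : LowerLiftsVanish Q := by
  intro f i hf
  refine ⟨fun j hj hji => lift_mem_vanishingIdeal.mpr fun γ hγ =>
    coeff_eq_zero_of_lift_mem hcov hf hγ hj hji, ?_⟩
  rw [IsLocallyConstant.iff_eventually_eq]
  rintro ⟨u, hu⟩
  -- For `i = 0` there is no first lift to use, but `f^{(0)}` vanishes on `Q` outright.
  rcases Nat.eq_zero_or_pos (i : ℕ) with hi | hi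
  · have hi' : i = 0 := Fin.ext hi
    subst hi'
    filter_upwards with v
    exact (hf v v.2).trans (hf u hu).symm
  obtain ⟨e, w, h, h0⟩ := hcov u.base
  have he := h.mem_maximalAtlas
  have hzero : ∀ v ∈ Q, v.base ∈ e.source → ∀ a, 0 < w a → e v.base a = 0 := by
    intro v hv hve a ha
    obtain ⟨γ, rfl⟩ := exists_jet v
    exact ((h.jet_mem_iff γ hve).mp hv).coord_eq_zero ha
  obtain ⟨ρ, hρ, hball⟩ := Metric.mem_nhds_iff.mp (e.open_target.mem_nhds (e.map_source h0))
  have hnear : ∀ᶠ v : Q in 𝓝 ⟨u, hu⟩, (v : JetBundle n M k).base ∈ e.source ∧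
      e (v : JetBundle n M k).base ∈ Metric.ball (e u.base) ρ := by
    have hc : ContinuousAt (fun v : Q => (v : JetBundle n M k).base) ⟨u, hu⟩ :=
      (continuous_base.comp continuous_subtype_val).continuousAt
    have h1 : ∀ᶠ q in 𝓝 u.base, q ∈ e.source ∧ e q ∈ Metric.ball (e u.base) ρ :=
      (e.open_source.eventually_mem h0).and
        ((e.continuousAt h0).eventually (Metric.ball_mem_nhds _ hρ))
    exact hc.eventually h1
  filter_upwards [hnear] with v ⟨hv, hvball⟩
  rw [lift_zero_apply, lift_zero_apply]
  set x := e u.base with hx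
  set y := e (v : JetBundle n M k).base with hy
  have hseg : ∀ s ∈ Icc (0 : ℝ) 1, x + s • (y - x) ∈ Metric.ball x ρ := fun s hs =>
    (convex_ball x ρ).add_smul_sub_mem (Metric.mem_ball_self hρ) hvball hs
  let φ : ℝ → ℝ := fun s => f (e.symm (x + s • (y - x)))
  -- At each parameter `s` the segment is continued as a line with origin at `s`. Both endpoints lie
  -- in the plane, so the line is a weighted curve.
  have hder : ∀ s ∈ Icc (0 : ℝ) 1, HasDerivAt φ 0 s := by
    intro s hs
    let c : ℝ → EuclideanSpace ℝ (Fin n) := fun t => x + (s + t) • (y - x)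
    have hc : ContDiff ℝ ∞ c := by fun_prop
    have hc0 : c 0 ∈ e.target := by
      simp only [c, add_zero]
      exact hball (hseg s hs)
    obtain ⟨γ, hγ0, hγ⟩ := exists_curve_of_germ he hc hc0
    have hγe : γ 0 ∈ e.source := hγ0 ▸ e.map_target hc0
    have hγQ : jet k γ ∈ Q := by
      refine (h.jet_mem_iff γ hγe).mpr fun a => ?_
      rcases Nat.eq_zero_or_pos (w a) with ha | ha
      · rw [ha, pow_zero]
        exact one_dvd _
      · have : (fun t => e (γ t) a) =ᶠ[𝓝 (0 : ℝ)] fun _ => 0 := by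
          filter_upwards [hγ] with t ht
          have h1 : e (γ t) = c t := ht
          have h2 : x a = 0 := hzero u hu h0 a ha
          have h3 : y a = 0 := hzero v v.2 hv a ha
          simp [h1, c, h2, h3]
        rw [tser_congr this, tser_const, map_zero]
        exact dvd_zero _
    have h1 := coeff_eq_zero_of_lift_mem hcov hf hγQ le_rfl hi
    rw [coeff_tser, iteratedDeriv_one, Nat.factorial_one, Nat.cast_one, inv_one, one_mul] at h1
    have h2 : (fun t => φ (s + t)) =ᶠ[𝓝 (0 : ℝ)] f ∘ γ := by
      filter_upwards [hγ, eventually_curve_mem e.open_source γ hγe] with t ht ht'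
      have h3 : e (γ t) = c t := ht
      change f (e.symm (c t)) = f (γ t)
      rw [← h3, e.left_inv ht']
    have h3 : HasDerivAt (f ∘ γ) 0 0 := by
      have := ((contDiff_func_comp f γ).differentiable (by simp) 0).hasDerivAt
      rwa [h1] at this
    have h4 : HasDerivAt (fun t => φ (s + t)) 0 0 := h3.congr_of_eventuallyEq h2
    have h5 := HasDerivAt.comp_sub_const (f := fun t => φ (s + t)) (f' := 0) s s (by simpa using h4)
    simpa using h5
  have hconst := constant_of_has_deriv_right_zero (f := φ) (a := 0) (b := 1)
    (fun s hs => (hder s hs).continuousAt.continuousWithinAt)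
    (fun s hs => (hder s (Ico_subset_Icc_self hs)).hasDerivWithinAt) 1 (by simp)
  simp only [φ, one_smul, zero_smul, add_zero, add_sub_cancel] at hconst
  rwa [hx, hy, e.left_inv h0, e.left_inv hv] at hconst

/-- Vanishing to order `j + 1` means that all lifts of orders `0, …, j` vanish. Those of orders `1,
…, j` follow from the last one; order `0` has to be required separately because of additive
constants. -/
theorem mem_curveOrderIdeal_iff_lift {Q : Set (JetBundle n M k)} (hQ : LowerLiftsVanish Q)
    (j : Fin (k + 1)) (f : Func n M) : f ∈ curveOrderIdeal Q (j + 1) ↔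
      lift f (0 : Fin (k + 1)) ∈ vanishingIdeal Q ∧ lift f j ∈ vanishingIdeal Q := by
  simp only [mem_curveOrderIdeal, PowerSeries.X_pow_dvd_iff]
  constructor
  · intro h
    exact ⟨lift_mem_vanishingIdeal.mpr fun γ hγ => h γ hγ _ (by simp),
      lift_mem_vanishingIdeal.mpr fun γ hγ => h γ hγ _ (Nat.lt_succ_self _)⟩
  · rintro ⟨h0, hj⟩ γ hγ m hm
    have hmk : m < k + 1 := lt_of_lt_of_le hm j.2
    rcases Nat.eq_zero_or_pos m with rfl | hm0
    · exact lift_mem_vanishingIdeal.mp h0 γ hγ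
    · exact lift_mem_vanishingIdeal.mp ((hQ f j hj).1 ⟨m, hmk⟩ hm0 (Nat.lt_succ_iff.mp hm)) γ hγ

end LowerLifts

/-! ### Functions that vanish near a point -/

section Germs

variable {V : Type*} [NormedAddCommGroup V] [NormedSpace ℝ V]
  {N : Type*} [TopologicalSpace N] [ChartedSpace V N]

/-- The functions that vanish near a point. -/
noncomputable def germIdeal (p : N) : Ideal C^∞⟮𝓘(ℝ, V), N; 𝓘(ℝ, ℝ), ℝ⟯ where
  carrier := {f | ⇑f =ᶠ[𝓝 p] 0}
  zero_mem' := EventuallyEq.rfl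
  add_mem' := fun {f g} hf hg => by
    have : ⇑(f + g) = ⇑f + ⇑g := rfl
    simpa [this] using EventuallyEq.add hf hg
  smul_mem' := fun c f hf => by
    have : ⇑(c • f) = ⇑c * ⇑f := rfl
    simpa [this] using EventuallyEq.mul (EventuallyEq.refl _ (⇑c)) hf

theorem mem_germIdeal {p : N} {f : C^∞⟮𝓘(ℝ, V), N; 𝓘(ℝ, ℝ), ℝ⟯} : f ∈ germIdeal p ↔ ⇑f =ᶠ[𝓝 p] 0 := Iff.rfl

theorem sub_mem_germIdeal {p : N} {f g : C^∞⟮𝓘(ℝ, V), N; 𝓘(ℝ, ℝ), ℝ⟯} : f - g ∈ germIdeal p ↔ ⇑f =ᶠ[𝓝 p] ⇑g := by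
  have : ⇑(f - g) = ⇑f - ⇑g := rfl
  rw [mem_germIdeal, this]
  refine ⟨fun h => ?_, fun h => ?_⟩
  · filter_upwards [h] with x hx
    exact sub_eq_zero.mp hx
  · filter_upwards [h] with x hx
    exact sub_eq_zero.mpr hx

theorem eventually_mem_germIdeal {p : N} {f : C^∞⟮𝓘(ℝ, V), N; 𝓘(ℝ, ℝ), ℝ⟯} (h : f ∈ germIdeal p) :
    ∀ᶠ q in 𝓝 p, f ∈ germIdeal q :=
  eventually_eventually_nhds.mpr h

theorem mem_span_sup_iff {R κ : Type*} [CommRing R] [Fintype κ] {g : κ → R} {I : Ideal R} {x : R} :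
    x ∈ Ideal.span (range g) ⊔ I ↔ ∃ c : κ → R, x - ∑ l, c l * g l ∈ I := by
  rw [Submodule.mem_sup]
  constructor
  · rintro ⟨y, hy, z, hz, rfl⟩
    obtain ⟨c, rfl⟩ := Ideal.mem_span_range_iff_exists_fun.mp hy
    exact ⟨c, by simpa using hz⟩
  · rintro ⟨c, hc⟩
    exact ⟨_, Ideal.mem_span_range_iff_exists_fun.mpr ⟨c, rfl⟩, _, hc, by ring⟩

variable [FiniteDimensional ℝ V] [IsManifold 𝓘(ℝ, V) ∞ N] [T2Space N] [SigmaCompactSpace N]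

/-- The germ of `u` is invertible, and a global extension of its inverse undoes the multiplication
up to a function vanishing near `p`. -/
theorem mem_of_mul_mem_sup_germIdeal {p : N} {K : Ideal C^∞⟮𝓘(ℝ, V), N; 𝓘(ℝ, ℝ), ℝ⟯} (hK : germIdeal p ≤ K)
    {u x : C^∞⟮𝓘(ℝ, V), N; 𝓘(ℝ, ℝ), ℝ⟯} (hu : u p ≠ 0) (h : u * x ∈ K) : x ∈ K := by
  have hopen : IsOpen {q | u q ≠ 0} := isOpen_ne_fun u.contMDiff.continuous continuous_const
  obtain ⟨v, hv⟩ := exists_extension (V := V) hopen hu (f := fun q => (u q)⁻¹)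
    (fun q hq => (u.contMDiff.contMDiffAt.inv₀ hq).contMDiffWithinAt)
  have h1 : v * (u * x) - x ∈ germIdeal p := by
    rw [sub_mem_germIdeal]
    filter_upwards [hv, hopen.mem_nhds hu] with q hq hq'
    change v q * (u q * x q) = x q
    rw [hq, inv_mul_cancel_left₀ hq']
  have h2 := K.sub_mem (K.mul_mem_left v h) (hK h1)
  simpa using h2

theorem mem_span_of_forall_mem_sup {ι : Type*} [Fintype ι] (v : ι → C^∞⟮𝓘(ℝ, V), N; 𝓘(ℝ, ℝ), ℝ⟯)
    (f : C^∞⟮𝓘(ℝ, V), N; 𝓘(ℝ, ℝ), ℝ⟯)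
    (h : ∀ x : N, f ∈ Ideal.span (range v) ⊔ germIdeal x) : f ∈ Ideal.span (range v) := by
  refine mem_span_of_locally v f fun x => ?_
  obtain ⟨c, hc⟩ := mem_span_sup_iff.mp (h x)
  rw [sub_mem_germIdeal] at hc
  refine ⟨_, hc, fun i => c i, fun i => (c i).contMDiff.contMDiffOn, fun y hy => ?_⟩
  rw [mem_ofPred_eq] at hy
  rw [hy, smooth_sum_apply]
  rfl

end Germs

/-! ### Bounding the number of generators over a compact set by general position -/

section FiniteGeneration

variable {n : ℕ} {M : Type*} [TopologicalSpace M] [ChartedSpace (EuclideanSpace ℝ (Fin n)) M]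
  [IsManifold (𝓡 n) ∞ M]

/-- A constant function. -/
noncomputable def constFunc (r : ℝ) : Func n M := mkSmooth (fun _ => r) contMDiff_const

@[simp] theorem constFunc_apply (r : ℝ) (p : M) : (constFunc r : Func n M) p = r := rfl

/-- `J` is locally generated by families indexed by `ι`. -/
def IsLocallyGenerated (J : Ideal (Func n M)) (ι : Type*) : Prop :=
  ∀ p : M, ∃ g : ι → Func n M, (∀ b, g b ∈ J) ∧
    ∀ᶠ q in 𝓝 p, J ≤ Ideal.span (range g) ⊔ germIdeal q

variable [T2Space M] [SecondCountableTopology M]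

theorem exists_func_eq {U : Set M} (hU : IsOpen U) {p : M} (hp : p ∈ U) {f : M → ℝ}
    (hf : ContMDiffOn (𝓡 n) 𝓘(ℝ, ℝ) ∞ f U) : ∃ F : Func n M, ⇑F =ᶠ[𝓝 p] f :=
  have := sigmaCompactSpace_of_chartedSpace n M
  exists_extension (V := EuclideanSpace ℝ (Fin n)) hU hp hf

/-- One generator is eliminated by passing to `f_l - (a_l / a_0) f_0` for a generic vector `a`.
Locally `f = C g` with a matrix `C`, and the ranges of the matrices `C q`, for `q ∈ K`, sweep out a
set of dimension at most `n + card ι < N + 1`, so `a` can avoid it. At each `q` some functional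
kills the range of `C q` but not `a`; applied to `f = C g` it yields a relation in which `f_0` has
an invertible coefficient, so `f_0` lies in the new span. -/
theorem exists_generators_sub_one {J : Ideal (Func n M)} {ι : Type*} [Fintype ι]
    (hJ : IsLocallyGenerated J ι) {K : Set M} (hK : IsCompact K) {N : ℕ}
    (hN : n + Fintype.card ι < N + 1) (f : Fin (N + 1) → Func n M) (hfJ : ∀ l, f l ∈ J)
    (hf : ∀ q ∈ K, J ≤ Ideal.span (range f) ⊔ germIdeal q) :
    ∃ f' : Fin N → Func n M, (∀ l, f' l ∈ J) ∧
      ∀ q ∈ K, J ≤ Ideal.span (range f') ⊔ germIdeal q := by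
  choose g hgJ hg using hJ
  have hC : ∀ p l, ∃ c : ι → Func n M, f l - ∑ b, c b * g p b ∈ germIdeal p := fun p l =>
    mem_span_sup_iff.mp ((hg p).self_of_nhds (hfJ l))
  choose C hC using hC
  -- Balls are used because the dimension estimate for smooth images requires a convex domain.
  have hball : ∀ p : M, ∃ ρ > 0, Metric.ball (chartAt (EuclideanSpace ℝ (Fin n)) p p) ρ ⊆
      (chartAt (EuclideanSpace ℝ (Fin n)) p).target ∧
      ∀ q ∈ (chartAt (EuclideanSpace ℝ (Fin n)) p).source,
        chartAt (EuclideanSpace ℝ (Fin n)) p q ∈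
          Metric.ball (chartAt (EuclideanSpace ℝ (Fin n)) p p) ρ →
        ∀ l, f l - ∑ b, C p l b * g p b ∈ germIdeal q := by
    intro p
    set e := chartAt (EuclideanSpace ℝ (Fin n)) p
    have hp : p ∈ e.source := mem_chart_source _ p
    have h1 : ∀ᶠ q in 𝓝 p, ∀ l, f l - ∑ b, C p l b * g p b ∈ germIdeal q :=
      eventually_all.mpr fun l => eventually_mem_germIdeal (hC p l)
    have h2 : ∀ᶠ x in 𝓝 (e p), ∀ l, f l - ∑ b, C p l b * g p b ∈ germIdeal (e.symm x) := by
      have := e.continuousAt_symm (e.map_source hp)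
      rw [ContinuousAt, e.left_inv hp] at this
      exact this.eventually h1
    obtain ⟨ρ, hρ, h⟩ := Metric.mem_nhds_iff.mp
      (Filter.inter_mem (e.open_target.mem_nhds (e.map_source hp)) h2)
    refine ⟨ρ, hρ, fun x hx => (h hx).1, fun q hq hqρ l => ?_⟩
    have := (h hqρ).2 l
    rwa [e.left_inv hq] at this
  choose ρ hρ hρt hρC using hball
  let U : M → Set M := fun p => (chartAt (EuclideanSpace ℝ (Fin n)) p).source ∩
    chartAt (EuclideanSpace ℝ (Fin n)) p ⁻¹'
      Metric.ball (chartAt (EuclideanSpace ℝ (Fin n)) p p) (ρ p)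
  obtain ⟨t, -, ht⟩ := hK.elim_nhds_subcover U fun p _ =>
    ((chartAt (EuclideanSpace ℝ (Fin n)) p).isOpen_inter_preimage Metric.isOpen_ball).mem_nhds
      ⟨mem_chart_source _ p, Metric.mem_ball_self (hρ p)⟩
  let Φ : M → EuclideanSpace ℝ (Fin n) × (ι → ℝ) → Fin (N + 1) → ℝ := fun p q l =>
    ∑ b, C p l b ((chartAt (EuclideanSpace ℝ (Fin n)) p).symm q.1) * q.2 b
  let D : M → Set (EuclideanSpace ℝ (Fin n) × (ι → ℝ)) := fun p =>
    Metric.ball (chartAt (EuclideanSpace ℝ (Fin n)) p p) (ρ p) ×ˢ univ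
  have hΦ : ∀ p, ContDiffOn ℝ ∞ (Φ p) (D p) := by
    intro p
    rw [contDiffOn_pi]
    intro l
    refine ContDiffOn.sum fun b _ => ?_
    have h1 : ContDiffOn ℝ ∞ (fun x => C p l b ((chartAt (EuclideanSpace ℝ (Fin n)) p).symm x))
        (chartAt (EuclideanSpace ℝ (Fin n)) p).target :=
      ((C p l b).contMDiff.comp_contMDiffOn (contMDiffOn_symm_of_mem_maximalAtlas
        (IsManifold.chart_mem_maximalAtlas p))).contDiffOn
    refine ContDiffOn.mul (h1.comp contDiff_fst.contDiffOn fun q hq => hρt p hq.1) ?_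
    have : ContDiff ℝ ∞ fun q : EuclideanSpace ℝ (Fin n) × (ι → ℝ) => q.2 b := by fun_prop
    exact this.contDiffOn
  -- The parameters are a point of `M` and a vector of `ι → ℝ`, and smooth maps do not raise
  -- Hausdorff dimension. The complement is therefore dense and contains a vector with nonzero entry
  -- `0`.
  have hdim : dimH (⋃ p ∈ (t : Set M), Φ p '' D p) < Module.finrank ℝ (Fin (N + 1) → ℝ) := by
    rw [dimH_bUnion t.countable_toSet]
    refine lt_of_le_of_lt (b := ((n + Fintype.card ι : ℕ) : ENNReal)) ?_ (by
      rw [Module.finrank_fin_fun]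
      exact_mod_cast hN)
    refine iSup₂_le fun p _ => ?_
    refine (((hΦ p).of_le (by simp)).dimH_image_le
      ((convex_ball _ _).prod convex_univ) subset_rfl).trans ?_
    refine (dimH_mono (subset_univ _)).trans (le_of_eq ?_)
    rw [Real.dimH_univ_eq_finrank, Module.finrank_prod, finrank_euclideanSpace_fin,
      Module.finrank_fintype_fun_eq_card]
  obtain ⟨a, ha0, ha⟩ := (dense_compl_of_dimH_lt_finrank hdim).inter_open_nonempty
    {a : Fin (N + 1) → ℝ | a 0 ≠ 0} (isOpen_ne_fun (continuous_apply 0) continuous_const)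
    ⟨fun _ => 1, one_ne_zero⟩
  simp only [mem_ofPred_eq] at ha0
  refine ⟨fun l => f l.succ - constFunc (a l.succ / a 0) * f 0,
    fun l => J.sub_mem (hfJ _) (J.mul_mem_left _ (hfJ _)), fun q hq => ?_⟩
  set S := Ideal.span (range fun l : Fin N => f l.succ - constFunc (a l.succ / a 0) * f 0) ⊔
    germIdeal q with hS
  have hqS : germIdeal q ≤ S := le_sup_right
  have hfS : ∀ l, f l - constFunc (a l / a 0) * f 0 ∈ S := by
    intro l
    refine Fin.cases ?_ (fun l => ?_) l
    · have : (constFunc (a 0 / a 0) : Func n M) = 1 := by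
        ext x
        rw [constFunc_apply, div_self ha0]
        rfl
      rw [this, one_mul, sub_self]
      exact zero_mem _
    · exact le_sup_left (α := Ideal (Func n M)) (Ideal.subset_span (mem_range_self l))
  suffices h0 : f 0 ∈ S by
    refine (hf q hq).trans (sup_le (Ideal.span_le.mpr ?_) hqS)
    rintro _ ⟨l, rfl⟩
    have := S.add_mem (hfS l) (S.mul_mem_left (constFunc (a l / a 0)) h0)
    simpa using this
  obtain ⟨p, hpt, hqU⟩ := mem_iUnion₂.mp (ht hq)
  set e := chartAt (EuclideanSpace ℝ (Fin n)) p
  have hCq := hρC p q hqU.1 hqU.2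
  let L : (ι → ℝ) →ₗ[ℝ] Fin (N + 1) → ℝ :=
    { toFun := fun z l => ∑ b, C p l b q * z b
      map_add' := fun y z => by
        ext l
        simp [mul_add, Finset.sum_add_distrib]
      map_smul' := fun r z => by
        ext l
        simp only [Pi.smul_apply, smul_eq_mul, RingHom.id_apply, Finset.mul_sum]
        exact Finset.sum_congr rfl fun b _ => by ring }
  have haL : a ∉ LinearMap.range L := by
    rintro ⟨z, hz⟩
    refine ha (mem_iUnion₂.mpr ⟨p, hpt, (e q, z), ⟨hqU.2, mem_univ _⟩, ?_⟩)
    rw [← hz]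
    ext l
    change ∑ b, C p l b (e.symm (e q)) * z b = _
    rw [e.left_inv hqU.1]
    rfl
  obtain ⟨φ, hφa, hφ⟩ := Submodule.exists_le_ker_of_notMem haL
  let lam : Fin (N + 1) → ℝ := fun l => φ (Pi.single l 1)
  have hφsum : ∀ v, φ v = ∑ l, v l * lam l := fun v => by
    rw [LinearMap.pi_apply_eq_sum_univ φ v]
    refine Finset.sum_congr rfl fun l _ => ?_
    rw [smul_eq_mul]
    congr 2
    ext m
    simp [Pi.single_apply, eq_comm]
  have hlamC : ∀ b, ∑ l, C p l b q * lam l = 0 := by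
    classical
    intro b
    have h1 : φ (L (Pi.single b 1)) = 0 := hφ ⟨_, rfl⟩
    rw [hφsum] at h1
    rw [← h1]
    refine Finset.sum_congr rfl fun l _ => ?_
    congr 1
    change _ = ∑ b', C p l b' q * (Pi.single b (1 : ℝ) : ι → ℝ) b'
    simp [Pi.single_apply]
  -- Modulo `S` every `f_l` is a multiple of `f 0`, so the same holds for every element of `J`.
  have hJS : ∀ x ∈ J, ∃ H : Func n M, x - H * f 0 ∈ S := by
    intro x hx
    obtain ⟨c, hc⟩ := mem_span_sup_iff.mp (hf q hq hx)
    refine ⟨∑ l, c l * constFunc (a l / a 0), ?_⟩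
    have h1 : ∑ l, c l * (f l - constFunc (a l / a 0) * f 0) ∈ S :=
      S.sum_mem fun l _ => S.mul_mem_left _ (hfS l)
    have h2 := S.add_mem (hqS hc) h1
    convert h2 using 1
    simp only [mul_sub, Finset.sum_sub_distrib, Finset.sum_mul, mul_assoc]
    ring
  choose H hH using fun b => hJS (g p b) (hgJ p b)
  have := sigmaCompactSpace_of_chartedSpace n M
  -- The multiplier is the difference of the coefficients of `f 0` in two expressions for `∑ λ_l
  -- f_l` modulo `S`: through `f_l ≡ (a_l / a_0) f_0` and through `C`. At `q` the second part
  -- vanishes by the choice of `λ`, which leaves `φ a / a_0 ≠ 0`.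
  refine mem_of_mul_mem_sup_germIdeal (p := q) (u := ∑ l, constFunc (lam l) *
    constFunc (a l / a 0) - ∑ b, (∑ l, constFunc (lam l) * C p l b) * H b) hqS ?_ ?_
  · rw [smooth_sub_apply, smooth_sum_apply, smooth_sum_apply]
    have h1 : ∑ b, ((∑ l, constFunc (lam l) * C p l b) * H b) q = 0 := by
      refine Finset.sum_eq_zero fun b _ => ?_
      rw [smooth_mul_apply, smooth_sum_apply]
      have : ∑ l, (constFunc (lam l) * C p l b : Func n M) q = 0 := by
        rw [← hlamC b]
        exact Finset.sum_congr rfl fun l _ => mul_comm _ _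
      rw [this, zero_mul]
    rw [h1, sub_zero]
    have h2 : ∑ l, (constFunc (lam l) * constFunc (a l / a 0) : Func n M) q = φ a / a 0 := by
      rw [hφsum, Finset.sum_div]
      refine Finset.sum_congr rfl fun l _ => ?_
      rw [smooth_mul_apply, constFunc_apply, constFunc_apply]
      ring
    rw [h2]
    exact div_ne_zero hφa ha0
  · have t1 : ∑ l, constFunc (lam l) * (f l - constFunc (a l / a 0) * f 0) ∈ S :=
      S.sum_mem fun l _ => S.mul_mem_left _ (hfS l)
    have t2 : ∑ l, constFunc (lam l) * (f l - ∑ b, C p l b * g p b) ∈ S :=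
      S.sum_mem fun l _ => S.mul_mem_left _ (hqS (hCq l))
    have t3 : ∑ b, (∑ l, constFunc (lam l) * C p l b) * (g p b - H b * f 0) ∈ S :=
      S.sum_mem fun b _ => S.mul_mem_left _ (hH b)
    have t4 := S.add_mem (S.sub_mem t2 t1) t3
    convert t4 using 1
    simp only [mul_sub, Finset.sum_sub_distrib, sub_mul, Finset.sum_mul, Finset.mul_sum]
    rw [Finset.sum_comm (s := (Finset.univ : Finset (Fin (N + 1)))) (t := (Finset.univ : Finset ι))
      (f := fun l b => constFunc (lam l) * (C p l b * g p b))]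
    simp only [mul_assoc]
    ring

/-- A finite subcover gives some finite number of generators, which are eliminated one by one. The
final number does not depend on `K`, as the gluing over an exhaustion requires. -/
theorem exists_generators_of_isCompact {J : Ideal (Func n M)} {ι : Type*} [Fintype ι]
    (hJ : IsLocallyGenerated J ι) {K : Set M} (hK : IsCompact K) :
    ∃ f : Fin (n + Fintype.card ι) → Func n M, (∀ l, f l ∈ J) ∧
      ∀ q ∈ K, J ≤ Ideal.span (range f) ⊔ germIdeal q := by
  have reduce : ∀ N : ℕ, (∃ f : Fin N → Func n M, (∀ l, f l ∈ J) ∧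
      ∀ q ∈ K, J ≤ Ideal.span (range f) ⊔ germIdeal q) →
      ∃ f : Fin (n + Fintype.card ι) → Func n M, (∀ l, f l ∈ J) ∧
      ∀ q ∈ K, J ≤ Ideal.span (range f) ⊔ germIdeal q := by
    intro N
    induction N with
    | zero =>
      rintro ⟨f, -, hf⟩
      refine ⟨fun _ => 0, fun _ => zero_mem _, fun q hq => (hf q hq).trans (sup_le_sup_right ?_ _)⟩
      rw [range_eq_empty, Ideal.span_empty]
      exact bot_le
    | succ N ih =>
      rintro ⟨f, hfJ, hf⟩
      rcases lt_or_ge (n + Fintype.card ι) (N + 1) with h | h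
      · exact ih (exists_generators_sub_one hJ hK h f hfJ hf)
      · refine ⟨fun l => if hl : (l : ℕ) < N + 1 then f ⟨l, hl⟩ else 0, fun l => ?_,
          fun q hq => (hf q hq).trans (sup_le_sup_right (Ideal.span_mono ?_) _)⟩
        · dsimp only
          split_ifs
          · exact hfJ _
          · exact zero_mem _
        · rintro _ ⟨l, rfl⟩
          exact ⟨⟨l, l.2.trans_le h⟩, dif_pos l.2⟩
  choose g hgJ hg using id hJ
  obtain ⟨t, -, ht⟩ := hK.elim_nhds_subcover
    (fun p => {q | J ≤ Ideal.span (range (g p)) ⊔ germIdeal q}) fun p _ => hg p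
  let ε := (Fintype.equivFin (t × ι)).symm
  refine reduce (Fintype.card (t × ι)) ⟨fun l => g (ε l).1 (ε l).2, fun l => hgJ _ _, fun q hq => ?_⟩
  obtain ⟨p, hp, hqp⟩ := mem_iUnion₂.mp (ht hq)
  refine le_trans hqp (sup_le_sup_right (Ideal.span_mono ?_) _)
  rintro _ ⟨b, rfl⟩
  exact ⟨ε.symm (⟨p, hp⟩, b), by simp⟩

end FiniteGeneration

/-! ### Finitely many generators on the whole manifold -/

section GlobalGenerators

variable {n : ℕ} {M : Type*} [TopologicalSpace M] [ChartedSpace (EuclideanSpace ℝ (Fin n)) M]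
  [IsManifold (𝓡 n) ∞ M]

/-- Functions with disjoint supports can be glued. -/
theorem exists_glue {W : ℕ → Set M} (hW : ∀ m, IsOpen (W m))
    (hdisj : Pairwise fun m m' => Disjoint (W m) (W m')) (hfin : LocallyFinite W)
    {f : ℕ → Func n M} (hf : ∀ m, tsupport (f m) ⊆ W m) :
    ∃ F : Func n M, (∀ m, ∀ q ∈ W m, ⇑F =ᶠ[𝓝 q] f m) ∧
      ∀ q, (∀ m, q ∉ W m) → ⇑F =ᶠ[𝓝 q] 0 := by
  have hfin' : LocallyFinite fun m => tsupport (f m) := hfin.subset hf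
  have hsm : ContMDiff (𝓡 n) 𝓘(ℝ, ℝ) ∞ fun x => ∑ᶠ m, f m x := contMDiff_finsum
    (fun m => (f m).contMDiff) (hfin'.subset fun m => subset_tsupport _)
  have hval : ∀ m, ∀ q ∈ W m, ∑ᶠ i, f i q = f m q := fun m q hq =>
    finsum_eq_single _ m fun i hi => by
      by_contra h
      exact (hdisj hi).le_bot ⟨hf i (subset_tsupport _ h), hq⟩
  refine ⟨mkSmooth _ hsm, fun m q hq => ?_, fun q hq => ?_⟩
  · filter_upwards [(hW m).mem_nhds hq] with x hx
    exact hval m x hx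
  · have hcl : IsClosed (⋃ m, tsupport (f m)) :=
      hfin'.isClosed_iUnion fun m => isClosed_tsupport _
    have : q ∈ (⋃ m, tsupport (f m))ᶜ := fun h => by
      obtain ⟨m, hm⟩ := mem_iUnion.mp h
      exact hq m (hf m hm)
    filter_upwards [hcl.isOpen_compl.mem_nhds this] with x hx
    change ∑ᶠ i, f i x = 0
    rw [finsum_eq_zero_of_forall_eq_zero]
    intro i
    by_contra h
    exact hx (mem_iUnion.mpr ⟨i, subset_tsupport _ h⟩)

variable [T2Space M] [SecondCountableTopology M]

/-- The compact sets are the successive differences in an exhaustion. Their neighbourhoods reach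
only into adjacent layers, so indices differing by at least `3` give disjoint ones. -/
theorem exists_shells (n : ℕ) (M : Type*) [TopologicalSpace M]
    [ChartedSpace (EuclideanSpace ℝ (Fin n)) M] [T2Space M] [SecondCountableTopology M] :
    ∃ S W : ℕ → Set M, (∀ m, IsCompact (S m)) ∧ (∀ m, IsOpen (W m)) ∧ (∀ m, S m ⊆ W m) ∧
      (⋃ m, S m = univ) ∧ LocallyFinite W ∧ ∀ m m', m + 3 ≤ m' → Disjoint (W m) (W m') := by
  have := sigmaCompactSpace_of_chartedSpace n M
  have := Manifold.locallyCompact_of_finiteDimensional (M := M) (𝓡 n)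
  -- The shift makes `K 0` empty, so that the truncated `m - 1` causes no trouble at `m = 0`.
  let K := (CompactExhaustion.choice M).shiftr
  have hK0 : K 0 = ∅ := rfl
  have hint : ∀ m, K m ⊆ interior (K (m + 1)) := K.subset_interior_succ
  refine ⟨fun m => K (m + 1) \ interior (K m), fun m => interior (K (m + 2)) \ K (m - 1),
    fun m => (K.isCompact _).diff isOpen_interior,
    fun m => isOpen_interior.sdiff (K.isCompact _).isClosed, fun m x hx => ⟨hint _ hx.1, ?_⟩,
    eq_univ_of_forall fun x => mem_iUnion.mpr ⟨(CompactExhaustion.choice M).find x, ?_⟩,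
    fun x => ?_, fun m m' h => ?_⟩
  · cases m with
    | zero => simp [hK0]
    | succ m => exact fun h => hx.2 (hint _ h)
  · have := (CompactExhaustion.choice M).mem_sdiff_shiftr_find x
    exact ⟨this.1, fun h => this.2 (interior_subset h)⟩
  · obtain ⟨N, hN⟩ := K.exists_mem x
    refine ⟨interior (K (N + 1)), isOpen_interior.mem_nhds (hint _ hN),
      (finite_lt_nat (N + 2)).subset fun m hm => ?_⟩
    obtain ⟨y, hy, hy'⟩ := hm
    by_contra h
    simp only [mem_ofPred_eq, not_lt] at h
    exact hy.2 (K.subset (by omega : N + 1 ≤ m - 1) (interior_subset hy'))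
  · rw [Set.disjoint_left]
    rintro x hx hx'
    exact hx'.2 (K.subset (by omega : m + 2 ≤ m' - 1) (interior_subset hx.1))

/-- An ideal that is a sheaf and that is locally generated by `ι`-indexed families is finitely
generated at all points simultaneously. -/
theorem exists_generators {J : Ideal (Func n M)} {ι : Type*} [Fintype ι]
    (hJ : IsLocallyGenerated J ι) (hloc : ∀ f, (∀ p, ∃ g ∈ J, f - g ∈ germIdeal p) → f ∈ J) :
    ∃ F : Fin 3 × Fin (n + Fintype.card ι) → Func n M, (∀ l, F l ∈ J) ∧
      ∀ q, J ≤ Ideal.span (range F) ⊔ germIdeal q := by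
  obtain ⟨S, W, hS, hW, hSW, hcov, hfin, hdisj⟩ := exists_shells n M
  have := sigmaCompactSpace_of_chartedSpace n M
  choose f hfJ hf using fun m => exists_generators_of_isCompact hJ (hS m)
  choose χ hχ1 hχ using fun m => exists_bump (V := EuclideanSpace ℝ (Fin n)) (hW m)
    (hS m).isClosed (hSW m)
  -- Shells whose indices have the same residue `c` modulo `3` have disjoint neighbourhoods, so
  -- their cut-off generators with the same label `l` form one global function.
  have hglue : ∀ (c : Fin 3) (l : Fin (n + Fintype.card ι)), ∃ F : Func n M,
      (∀ m, ∀ q ∈ W (3 * m + c), ⇑F =ᶠ[𝓝 q] ⇑(χ (3 * m + c) * f (3 * m + c) l)) ∧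
      ∀ q, (∀ m, q ∉ W (3 * m + c)) → ⇑F =ᶠ[𝓝 q] 0 := by
    intro c l
    refine exists_glue (W := fun m => W (3 * m + c)) (fun m => hW _) (fun m m' h => ?_)
      (hfin.comp_injective fun m m' h => by simpa using h)
      (f := fun m => χ (3 * m + c) * f (3 * m + c) l) fun m => ?_
    · rcases lt_or_gt_of_ne h with h | h
      · exact hdisj _ _ (by omega)
      · exact (hdisj _ _ (by omega)).symm
    · exact (tsupport_mul_subset_left (f := ⇑(χ (3 * m + c)))).trans (hχ _)
  choose F hF1 hF2 using hglue
  refine ⟨fun l => F l.1 l.2, fun l => hloc _ fun p => ?_, fun q => ?_⟩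
  · by_cases h : ∃ m, p ∈ W (3 * m + l.1)
    · obtain ⟨m, hm⟩ := h
      exact ⟨_, J.mul_mem_left _ (hfJ _ l.2), sub_mem_germIdeal.mpr (hF1 _ _ m p hm)⟩
    · push Not at h
      exact ⟨0, zero_mem _, by rw [sub_zero]; exact hF2 _ _ p h⟩
  · obtain ⟨m, hm⟩ := mem_iUnion.mp (hcov.ge (mem_univ q))
    refine (hf m q hm).trans (sup_le (Ideal.span_le.mpr ?_) le_sup_right)
    rintro _ ⟨l, rfl⟩
    have hm3 : 3 * (m / 3) + (⟨m % 3, Nat.mod_lt _ (by norm_num)⟩ : Fin 3) = m := Nat.div_add_mod m 3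
    have h1 := hF1 ⟨m % 3, Nat.mod_lt _ (by norm_num)⟩ l (m / 3) q (by rw [hm3]; exact hSW m hm)
    rw [hm3] at h1
    have h2 : f m l - F ⟨m % 3, Nat.mod_lt _ (by norm_num)⟩ l ∈ germIdeal q := by
      rw [sub_mem_germIdeal]
      filter_upwards [h1, (eventually_nhdsSet_iff_forall.mp (hχ1 m)) q hm] with x hx hx'
      rw [hx, smooth_mul_apply, hx', one_mul]
    have h3 : F ⟨m % 3, Nat.mod_lt _ (by norm_num)⟩ l ∈
        Ideal.span (range fun l : Fin 3 × Fin (n + Fintype.card ι) => F l.1 l.2) ⊔ germIdeal q :=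
      Ideal.mem_sup_left (Ideal.subset_span ⟨(⟨m % 3, Nat.mod_lt _ (by norm_num)⟩, l), rfl⟩)
    have h4 := Submodule.add_mem _ h3 (Ideal.mem_sup_right h2)
    simpa using h4

end GlobalGenerators

/-! ### Adapted charts imply generation by lifts -/

section GeneratedByLifts

variable {n : ℕ} {M : Type*} [TopologicalSpace M] [ChartedSpace (EuclideanSpace ℝ (Fin n)) M]
  [IsManifold (𝓡 n) ∞ M] {k : ℕ}

theorem tser_comp_congr {f g : Func n M} (γ : Curve n M) (h : ⇑f =ᶠ[𝓝 (γ 0)] ⇑g) :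
    tser (f ∘ γ) = tser (g ∘ γ) :=
  tser_congr (comp_curve_congr γ h)

theorem lift_congr {f g : Func n M} {u : JetBundle n M k} (h : ⇑f =ᶠ[𝓝 u.base] ⇑g)
    (j : Fin (k + 1)) : lift f j u = lift g j u := by
  obtain ⟨γ, rfl⟩ := exists_jet u
  rw [lift_jet, lift_jet, tser_comp_congr γ h]

theorem lift_sub_lift_mem_germIdeal {f g : Func n M} {u : JetBundle n M k}
    (h : f - g ∈ germIdeal u.base) (j : Fin (k + 1)) : lift f j - lift g j ∈ germIdeal u := by
  rw [sub_mem_germIdeal] at h ⊢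
  have := continuous_base.continuousAt.eventually (eventually_eventually_nhds.mpr h)
  filter_upwards [this] with v hv
  exact lift_congr hv j

theorem lift_add (f g : Func n M) (j : Fin (k + 1)) : lift (f + g) j = lift f j + lift g j := by
  ext u
  obtain ⟨γ, rfl⟩ := exists_jet u
  rw [smooth_add_apply, lift_jet, lift_jet, lift_jet]
  have : ⇑(f + g) ∘ γ = f ∘ γ + g ∘ γ := rfl
  rw [this, tser_add (contDiff_func_comp f γ).contDiffAt (contDiff_func_comp g γ).contDiffAt,
    map_add]

theorem lift_zero (j : Fin (k + 1)) : lift (0 : Func n M) j = 0 := by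
  have := lift_add (0 : Func n M) 0 j
  simpa using this

theorem lift_sum {ι : Type*} (s : Finset ι) (f : ι → Func n M) (j : Fin (k + 1)) :
    lift (∑ i ∈ s, f i) j = ∑ i ∈ s, lift (f i) j := by
  classical
  induction s using Finset.induction_on with
  | empty => simp [lift_zero]
  | insert a s ha ih => rw [Finset.sum_insert ha, Finset.sum_insert ha, lift_add, ih]

/-- The Leibniz rule for lifts. -/
theorem lift_mul (f g : Func n M) (j : Fin (k + 1)) : lift (f * g) j =
    ∑ x : Finset.HasAntidiagonal.antidiagonal (j : ℕ),
      lift f ⟨x.1.1, by have := Finset.HasAntidiagonal.mem_antidiagonal.mp x.2; omega⟩ *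
        lift g ⟨x.1.2, by have := Finset.HasAntidiagonal.mem_antidiagonal.mp x.2; omega⟩ := by
  ext u
  obtain ⟨γ, rfl⟩ := exists_jet u
  have : ⇑(f * g) ∘ γ = (f ∘ γ) * (g ∘ γ) := rfl
  rw [smooth_sum_apply, lift_jet, this, tser_mul (contDiff_func_comp f γ).contDiffAt
    (contDiff_func_comp g γ).contDiffAt, PowerSeries.coeff_mul, ← Finset.sum_coe_sort]
  refine Finset.sum_congr rfl fun x _ => ?_
  rw [smooth_mul_apply, lift_jet, lift_jet]

theorem lift_mul_mem {f g : Func n M} {j : Fin (k + 1)} {I : Ideal (JetFunc n M k)}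
    (h : ∀ m ≤ j, lift g m ∈ I) : lift (f * g) j ∈ I := by
  rw [lift_mul]
  refine I.sum_mem fun x _ => I.mul_mem_left _ (h _ (Fin.le_def.mpr ?_))
  have := Finset.HasAntidiagonal.mem_antidiagonal.mp x.2
  dsimp only
  omega

theorem jetCoord_jet_apply {e : OpenPartialHomeomorph M (EuclideanSpace ℝ (Fin n))}
    (he : e ∈ IsManifold.maximalAtlas (𝓡 n) ∞ M) (γ : Curve n M) (h : γ 0 ∈ e.source)
    (j : Fin (k + 1)) (a : Fin n) :
    jetCoord e (jet k γ) j a = PowerSeries.coeff (j : ℕ) (tser fun t => e (γ t) a) := by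
  have h1 := (EuclideanSpace.proj (𝕜 := ℝ) (ι := Fin n) a).iteratedFDeriv_comp_left
    (contDiffAt_chart_comp he γ h) (natCast_le_infty j)
  have h2 : iteratedDeriv j (fun t => e (γ t) a) 0 = iteratedDeriv j (e ∘ γ) 0 a := by
    rw [iteratedDeriv_eq_iteratedFDeriv, iteratedDeriv_eq_iteratedFDeriv]
    exact DFunLike.congr_fun h1 fun _ => (1 : ℝ)
  rw [jetCoord_jet he γ h, coeff_tser, h2]
  rfl

theorem lift_eq_jetCoord {e : OpenPartialHomeomorph M (EuclideanSpace ℝ (Fin n))}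
    (he : e ∈ IsManifold.maximalAtlas (𝓡 n) ∞ M) {u : JetBundle n M k} (hu : u.base ∈ e.source)
    {f : Func n M} {a : Fin n} (hf : ⇑f =ᶠ[𝓝 u.base] fun q => e q a) (j : Fin (k + 1)) :
    lift f j u = jetCoord e u j a := by
  obtain ⟨γ, rfl⟩ := exists_jet u
  rw [jetCoord_jet_apply he γ hu, lift_jet, tser_congr (comp_curve_congr γ hf)]
  rfl

theorem isWeightedCurve_iff {e : OpenPartialHomeomorph M (EuclideanSpace ℝ (Fin n))}
    (he : e ∈ IsManifold.maximalAtlas (𝓡 n) ∞ M) {w : Fin n → ℕ} (hw : ∀ a, w a ≤ k + 1)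
    {γ : Curve n M} (h0 : γ 0 ∈ e.source) : IsWeightedCurve e w γ ↔
      ∀ a, ∀ j : Fin (k + 1), (j : ℕ) < w a → jetCoord e (jet k γ) j a = 0 := by
  refine forall_congr' fun a => ?_
  rw [PowerSeries.X_pow_dvd_iff]
  simp only [jetCoord_jet_apply he γ h0]
  exact ⟨fun H j hj => H j hj, fun H j hj => H ⟨j, hj.trans_le (hw a)⟩ hj⟩

theorem IsAdapted.mem_iff {Q : Set (JetBundle n M k)}
    {e : OpenPartialHomeomorph M (EuclideanSpace ℝ (Fin n))} {w : Fin n → ℕ}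
    (h : IsAdapted Q e w) {u : JetBundle n M k} (hu : u.base ∈ e.source) :
    u ∈ Q ↔ ∀ a, ∀ j : Fin (k + 1), (j : ℕ) < w a → jetCoord e u j a = 0 := by
  obtain ⟨γ, rfl⟩ := exists_jet u
  rw [h.jet_mem_iff γ hu, isWeightedCurve_iff h.mem_maximalAtlas h.le_order hu]

/-- The coordinate `j, a` of the model space of `T_k M`. -/
noncomputable def jetProj (j : Fin (k + 1)) (a : Fin n) :
    (Fin (k + 1) → EuclideanSpace ℝ (Fin n)) →L[ℝ] ℝ :=
  (EuclideanSpace.proj a).comp (ContinuousLinearMap.proj j)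

@[simp] theorem jetProj_apply (j : Fin (k + 1)) (a : Fin n)
    (x : Fin (k + 1) → EuclideanSpace ℝ (Fin n)) : jetProj j a x = x j a := rfl

variable [T2Space M] [SecondCountableTopology M]

/-- The local generators are the localized monomials with truncated exponents. The index type
depends only on `n` and `i`, not on the chart. -/
theorem isLocallyGenerated_curveOrderIdeal {Q : Set (JetBundle n M k)}
    (hcov : ∀ p : M, ∃ e w, IsAdapted Q e w ∧ p ∈ e.source) (i : ℕ) :
    IsLocallyGenerated (curveOrderIdeal Q i) (Fin n → Fin (i + 1)) := by
  intro p
  obtain ⟨e, w, h, hp⟩ := hcov p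
  have he := h.mem_maximalAtlas
  choose g hgp hg using fun s => exists_localized (n := n) e.open_source hp
    (contMDiffOn_extendZero (monGen (coordOn he le_rfl) w i s))
  refine ⟨g, fun s γ hγ => hg s γ i fun h0 => ?_, ?_⟩
  · refine X_pow_dvd_tser_of_mem_monomialIdeal he le_rfl ?_ h0 ((h.jet_mem_iff γ h0).mp hγ)
    rw [monomialIdeal_eq he le_rfl]
    exact monGen_mem _ _ _ _
  filter_upwards [eventually_all.mpr fun s => eventually_eventually_nhds.mpr (hgp s),
    e.open_source.mem_nhds hp] with q hq hqe f hf
  have hmem : restrictTo (chartDomain e) f ∈ monomialIdeal e w i (chartDomain e) :=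
    (restrictTo_mem_monomialIdeal_iff he).mpr fun γ h0 hγ => hf γ ((h.jet_mem_iff γ h0).mpr hγ)
  rw [monomialIdeal_eq he le_rfl, monIdeal_eq_span_range,
    Ideal.mem_span_range_iff_exists_fun] at hmem
  obtain ⟨c, hc⟩ := hmem
  choose C hC using fun s => exists_func_eq (n := n) e.open_source hqe (contMDiffOn_extendZero (c s))
  rw [mem_span_sup_iff]
  refine ⟨C, sub_mem_germIdeal.mpr ?_⟩
  filter_upwards [eventually_all.mpr hC, eventually_all.mpr hq, e.open_source.mem_nhds hqe]
    with x hx hx' hxe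
  have h1 := DFunLike.congr_fun hc (⟨x, hxe⟩ : chartDomain e)
  rw [smooth_sum_apply] at h1
  rw [smooth_sum_apply]
  refine h1.symm.trans (Finset.sum_congr rfl fun s _ => ?_)
  rw [smooth_mul_apply, smooth_mul_apply, hx, hx']
  exact (congrArg₂ _ (extendZero_apply (V := chartDomain e) _ ⟨x, hxe⟩)
    (extendZero_apply (V := chartDomain e) _ ⟨x, hxe⟩)).symm

theorem mem_curveOrderIdeal_of_locally {Q : Set (JetBundle n M k)} {i : ℕ} {f : Func n M}
    (h : ∀ p, ∃ g ∈ curveOrderIdeal Q i, f - g ∈ germIdeal p) : f ∈ curveOrderIdeal Q i := by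
  intro γ hγ
  obtain ⟨g, hg, hfg⟩ := h (γ 0)
  rw [tser_comp_congr γ (sub_mem_germIdeal.mp hfg)]
  exact hg γ hγ

/-- Near any point of `T_k M`, a function vanishing on `Q` is a combination of the lifts of the
localized coordinates that vanish on `Q`. -/
theorem IsAdapted.mem_span_lift_coord_sup {Q : Set (JetBundle n M k)}
    {e : OpenPartialHomeomorph M (EuclideanSpace ℝ (Fin n))} {w : Fin n → ℕ}
    (h : IsAdapted Q e w) {u : JetBundle n M k} (hu : u.base ∈ e.source) {x : Fin n → Func n M}
    (hx : ∀ a, ⇑(x a) =ᶠ[𝓝 u.base] fun q => e q a) {g : JetFunc n M k}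
    (hg : g ∈ vanishingIdeal Q) :
    g ∈ Ideal.span (range fun b : {b : Fin n × Fin (k + 1) // (b.2 : ℕ) < w b.1} =>
      lift (x b.1.1) b.1.2) ⊔ germIdeal u := by
  have he := h.mem_maximalAtlas
  -- Off `Q` one of the defining coordinate lifts is nonzero at `u`, so its germ is invertible and
  -- generates everything.
  by_cases hQ : u ∈ Q
  swap
  · rw [h.mem_iff hu] at hQ
    push Not at hQ
    obtain ⟨a, j, hj, hne⟩ := hQ
    rw [← lift_eq_jetCoord he hu (hx a)] at hne
    refine mem_of_mul_mem_sup_germIdeal le_sup_right hne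
      (Ideal.mul_mem_right _ _ (Ideal.mem_sup_left (Ideal.subset_span ⟨⟨(a, j), hj⟩, rfl⟩)))
  let H := jetHomeo k e he
  have hu' : u ∈ H.source := hu
  have hG : ContMDiffOn 𝓘(ℝ, Fin (k + 1) → EuclideanSpace ℝ (Fin n)) 𝓘(ℝ, ℝ) ∞ (g ∘ H.symm)
      H.target := g.contMDiff.comp_contMDiffOn (contMDiffOn_jetChart_symm he)
  obtain ⟨G, hGe⟩ := exists_extension (V := Fin (k + 1) → EuclideanSpace ℝ (Fin n)) H.open_target
    (H.map_source hu') hG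
  obtain ⟨η, hη, hGη⟩ := exists_sum_eq_sub (g := G) G.contMDiff.contDiff
    (fun b : {b : Fin n × Fin (k + 1) // (b.2 : ℕ) < w b.1} => jetProj b.1.2 b.1.1)
    (fun b => Pi.single b.1.2 (EuclideanSpace.single b.1.1 1))
  -- `P` sets to zero the jet coordinates that define `Q`. It fixes `H u` and maps nearby points
  -- into `Q`, where `g` vanishes, so Hadamard's lemma writes `G = G - G ∘ P` near `H u` in terms of
  -- these coordinates.
  let P : (Fin (k + 1) → EuclideanSpace ℝ (Fin n)) → Fin (k + 1) → EuclideanSpace ℝ (Fin n) :=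
    fun y => y - ∑ b : {b : Fin n × Fin (k + 1) // (b.2 : ℕ) < w b.1},
      jetProj b.1.2 b.1.1 y •
        (Pi.single b.1.2 (EuclideanSpace.single b.1.1 1) : Fin (k + 1) → EuclideanSpace ℝ (Fin n))
  have hPc : Continuous P := by fun_prop
  have hPz : ∀ y a (j : Fin (k + 1)), (j : ℕ) < w a → P y j a = 0 := by
    intro y a j hj
    have h1 : jetProj j a (P y) = 0 := by
      simp only [P, map_sub, map_sum, map_smul, smul_eq_mul]
      rw [Finset.sum_eq_single ⟨(a, j), hj⟩]
      · simp
      · rintro ⟨⟨a', j'⟩, hb⟩ - hne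
        rw [jetProj_apply (x := Pi.single _ _)]
        by_cases hjj : j = j'
        · subst hjj
          have : a ≠ a' := fun h => hne (by subst h; rfl)
          simp [this]
        · simp [hjj]
      · simp
    exact h1
  have hPu : P (H u) = H u := by
    have : ∀ b : {b : Fin n × Fin (k + 1) // (b.2 : ℕ) < w b.1}, jetProj b.1.2 b.1.1 (H u) = 0 :=
      fun b => (h.mem_iff hu).mp hQ b.1.1 b.1.2 b.2
    simp only [P, this, zero_smul, Finset.sum_const_zero, sub_zero]
  choose η' hη' using fun b => exists_extension (V := Fin (k + 1) → EuclideanSpace ℝ (Fin n))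
    (N := JetBundle n M k) H.open_source hu' (f := η b ∘ H)
    ((hη b).contMDiff.comp_contMDiffOn (contMDiffOn_jetChart he))
  refine mem_span_sup_iff.mpr ⟨η', sub_mem_germIdeal.mpr ?_⟩
  have hPH : ContinuousAt (fun v => P (H v)) u := hPc.continuousAt.comp (H.continuousAt hu')
  have ev1 : ∀ᶠ v in 𝓝 u, G (H v) = g v := by
    filter_upwards [(H.continuousAt hu').eventually hGe, H.open_source.mem_nhds hu'] with v hv hvs
    rw [hv, Function.comp_apply, H.left_inv hvs]
  have ev2 : ∀ᶠ v in 𝓝 u, G (P (H v)) = 0 := by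
    have t1 : ∀ᶠ y in 𝓝 (P (H u)), G y = g (H.symm y) ∧ y ∈ H.target := by
      rw [hPu]
      exact hGe.and (H.open_target.mem_nhds (H.map_source hu'))
    filter_upwards [hPH.eventually t1] with v hv
    rw [hv.1]
    refine hg _ ((h.mem_iff (H.map_target hv.2)).mpr fun a j hj => ?_)
    have : jetCoord e (H.symm (P (H v))) = P (H v) := H.right_inv hv.2
    rw [this]
    exact hPz _ _ _ hj
  have ev3 : ∀ᶠ v : JetBundle n M k in 𝓝 u, ∀ a j, lift (x a) j v = jetCoord e v j a := by
    have := continuous_base.continuousAt.eventually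
      (eventually_eventually_nhds.mpr (eventually_all.mpr hx))
    filter_upwards [this, H.open_source.mem_nhds hu'] with v hv hvs a j
    exact lift_eq_jetCoord he hvs (eventually_all.mp hv a) j
  filter_upwards [ev1, ev2, ev3, eventually_all.mpr hη'] with v h1 h2 h3 h4
  rw [← h1, smooth_sum_apply, ← sub_zero (G (H v)), ← h2]
  refine (hGη (H v)).trans (Finset.sum_congr rfl fun b _ => ?_)
  rw [smooth_mul_apply, h3, h4, mul_comm]
  rfl

/-- The localized coordinates vary with the point, while membership in the ideal requires one finite
sum. A coordinate of weight `w a` is a combination of the finitely many global generators of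
`curveOrderIdeal Q (w a)`, and by the Leibniz rule its lift of order `j` is a combination of their
lifts of orders `≤ j`. -/
theorem generatedByLifts_of_isAdapted {Q : Set (JetBundle n M k)}
    (hcov : ∀ p : M, ∃ e w, IsAdapted Q e w ∧ p ∈ e.source) : GeneratedByLifts Q := by
  choose F hFmem hF using fun i => exists_generators (isLocallyGenerated_curveOrderIdeal hcov i)
    (fun _ => mem_curveOrderIdeal_of_locally)
  -- Only lifts of order below the degree `i` are known to vanish on `Q`; the others are replaced by
  -- `0`.
  let v : (Σ i : Fin (k + 2), (Fin 3 × Fin (n + Fintype.card (Fin n → Fin ((i : ℕ) + 1)))) ×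
      Fin (k + 1)) → JetFunc n M k := fun b =>
    if (b.2.2 : ℕ) < b.1 then lift (F b.1 b.2.1) b.2.2 else 0
  apply le_antisymm
  · intro g hg
    refine Ideal.span_mono ?_ (mem_span_of_forall_mem_sup v g fun u => ?_)
    · rintro _ ⟨b, rfl⟩
      simp only [v]
      split_ifs with hb
      · exact ⟨lift_mem_vanishingIdeal.mpr fun γ hγ =>
          PowerSeries.X_pow_dvd_iff.mp (hFmem _ _ γ hγ) _ hb, _, _, rfl⟩
      · exact ⟨zero_mem _, 0, 0, (lift_zero _).symm⟩
    · obtain ⟨e, w, h, hu⟩ := hcov u.base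
      choose x hxmem hx using h.exists_localized_coord hu
      refine (sup_le (Ideal.span_le.mpr ?_) le_sup_right : _ ≤ Ideal.span (range v) ⊔ germIdeal u)
        (h.mem_span_lift_coord_sup hu hx hg)
      rintro _ ⟨⟨⟨a, j⟩, hj⟩, rfl⟩
      obtain ⟨c, hc⟩ := mem_span_sup_iff.mp (hF (w a) u.base (hxmem a))
      have h1 : lift (x a - ∑ l, c l * F (w a) l) j ∈ Ideal.span (range v) ⊔ germIdeal u := by
        refine Ideal.mem_sup_right ?_
        have := lift_sub_lift_mem_germIdeal (k := k) (u := u) (by rwa [sub_zero]) j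
        rwa [lift_zero, sub_zero] at this
      have h2 : lift (∑ l, c l * F (w a) l) j ∈ Ideal.span (range v) ⊔ germIdeal u := by
        rw [lift_sum]
        refine Ideal.sum_mem _ fun l _ => lift_mul_mem fun m hm => Ideal.mem_sup_left
          (Ideal.subset_span ⟨⟨⟨w a, Nat.lt_succ_of_le (h.le_order a)⟩, l, m⟩, ?_⟩)
        have : (m : ℕ) < w a := lt_of_le_of_lt hm hj
        simp only [v, if_pos this]
      have h3 := Ideal.add_mem _ h1 h2
      rwa [← lift_add, sub_add_cancel] at h3
  · exact Ideal.span_le.mpr fun g hg => hg.1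

end GeneratedByLifts

/-! ### Differentials in charts and transition maps -/

section Differentials

variable {V : Type*} [NormedAddCommGroup V] [NormedSpace ℝ V]
  {N : Type*} [TopologicalSpace N] [ChartedSpace V N]

/-- The differential at `u` of a function, in a chart `c`. -/
noncomputable def derivAt (c : OpenPartialHomeomorph N V) (u : N) (g : N → ℝ) : V →L[ℝ] ℝ :=
  fderiv ℝ (g ∘ c.symm) (c u)

variable {c c' : OpenPartialHomeomorph N V} {u : N}

theorem derivAt_congr (hu : u ∈ c.source) {g h : N → ℝ} (hgh : g =ᶠ[𝓝 u] h) :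
    derivAt c u g = derivAt c u h := by
  refine Filter.EventuallyEq.fderiv_eq ?_
  have := c.continuousAt_symm (c.map_source hu)
  rw [ContinuousAt, c.left_inv hu] at this
  exact this.eventually hgh

theorem derivAt_const (r : ℝ) : derivAt c u (fun _ => r) = 0 := by
  unfold derivAt
  exact fderiv_const_apply (𝕜 := ℝ) r

theorem derivAt_linear (hu : u ∈ c.source) {g : N → ℝ} (φ : V →L[ℝ] ℝ) {r : ℝ}
    (hg : g =ᶠ[𝓝 u] fun v => φ (c v) - r) : derivAt c u g = φ := by
  have h1 : g ∘ c.symm =ᶠ[𝓝 (c u)] fun y => φ y - r := by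
    have hc := c.continuousAt_symm (c.map_source hu)
    rw [ContinuousAt, c.left_inv hu] at hc
    filter_upwards [hc.eventually hg, c.open_target.mem_nhds (c.map_source hu)] with y hy hyt
    rw [Function.comp_apply, hy, c.right_inv hyt]
  exact h1.fderiv_eq.trans (φ.hasFDerivAt.sub_const _).fderiv

variable [IsManifold 𝓘(ℝ, V) ∞ N]

theorem contDiffAt_comp_chart_symm (hc : c ∈ IsManifold.maximalAtlas 𝓘(ℝ, V) ∞ N)
    (hu : u ∈ c.source) (g : C^∞⟮𝓘(ℝ, V), N; 𝓘(ℝ, ℝ), ℝ⟯) : ContDiffAt ℝ ∞ (g ∘ c.symm) (c u) :=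
  (g.contMDiff.contMDiffAt.comp _
    (contMDiffAt_symm_of_mem_maximalAtlas hc (c.map_source hu))).contDiffAt

theorem hasFDerivAt_derivAt (hc : c ∈ IsManifold.maximalAtlas 𝓘(ℝ, V) ∞ N) (hu : u ∈ c.source)
    (g : C^∞⟮𝓘(ℝ, V), N; 𝓘(ℝ, ℝ), ℝ⟯) : HasFDerivAt (g ∘ c.symm) (derivAt c u g) (c u) :=
  ((contDiffAt_comp_chart_symm hc hu g).differentiableAt (by simp)).hasFDerivAt

theorem derivAt_add (hc : c ∈ IsManifold.maximalAtlas 𝓘(ℝ, V) ∞ N) (hu : u ∈ c.source)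
    (g h : C^∞⟮𝓘(ℝ, V), N; 𝓘(ℝ, ℝ), ℝ⟯) :
    derivAt c u ⇑(g + h) = derivAt c u g + derivAt c u h :=
  ((hasFDerivAt_derivAt hc hu g).add (hasFDerivAt_derivAt hc hu h)).fderiv

theorem derivAt_mul (hc : c ∈ IsManifold.maximalAtlas 𝓘(ℝ, V) ∞ N) (hu : u ∈ c.source)
    (g h : C^∞⟮𝓘(ℝ, V), N; 𝓘(ℝ, ℝ), ℝ⟯) :
    derivAt c u ⇑(g * h) = g u • derivAt c u h + h u • derivAt c u g := by
  have := ((hasFDerivAt_derivAt hc hu g).mul (hasFDerivAt_derivAt hc hu h)).fderiv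
  simp only [Function.comp_apply, c.left_inv hu] at this
  exact this

/-- The differential at a point, as a linear map on smooth functions. -/
noncomputable def derivAtₗ (hc : c ∈ IsManifold.maximalAtlas 𝓘(ℝ, V) ∞ N) (hu : u ∈ c.source) :
    C^∞⟮𝓘(ℝ, V), N; 𝓘(ℝ, ℝ), ℝ⟯ →ₗ[ℝ] V →L[ℝ] ℝ where
  toFun g := derivAt c u g
  map_add' := derivAt_add hc hu
  map_smul' r g := ((hasFDerivAt_derivAt hc hu g).const_smul r).fderiv

@[simp] theorem derivAtₗ_apply (hc : c ∈ IsManifold.maximalAtlas 𝓘(ℝ, V) ∞ N) (hu : u ∈ c.source)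
    (g : C^∞⟮𝓘(ℝ, V), N; 𝓘(ℝ, ℝ), ℝ⟯) : derivAtₗ hc hu g = derivAt c u g := rfl

theorem contDiffAt_transition (hc : c ∈ IsManifold.maximalAtlas 𝓘(ℝ, V) ∞ N)
    (hc' : c' ∈ IsManifold.maximalAtlas 𝓘(ℝ, V) ∞ N) (hu : u ∈ c.source) (hu' : u ∈ c'.source) :
    ContDiffAt ℝ ∞ (c ∘ c'.symm) (c' u) := by
  refine ContMDiffAt.contDiffAt (ContMDiffAt.comp (c' u) (g := c) (f := c'.symm)
    (I' := 𝓘(ℝ, V)) ?_ (contMDiffAt_symm_of_mem_maximalAtlas hc' (c'.map_source hu')))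
  rw [c'.left_inv hu']
  exact contMDiffAt_of_mem_maximalAtlas hc hu

/-- The derivative at a point of a transition map. -/
noncomputable def transitionDeriv (c c' : OpenPartialHomeomorph N V) (u : N) : V →L[ℝ] V :=
  fderiv ℝ (c' ∘ c.symm) (c u)

theorem hasFDerivAt_transition (hc : c ∈ IsManifold.maximalAtlas 𝓘(ℝ, V) ∞ N)
    (hc' : c' ∈ IsManifold.maximalAtlas 𝓘(ℝ, V) ∞ N) (hu : u ∈ c.source) (hu' : u ∈ c'.source) :
    HasFDerivAt (c' ∘ c.symm) (transitionDeriv c c' u) (c u) :=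
  ((contDiffAt_transition hc' hc hu' hu).differentiableAt (by simp)).hasFDerivAt

theorem derivAt_eq_comp (hc : c ∈ IsManifold.maximalAtlas 𝓘(ℝ, V) ∞ N)
    (hc' : c' ∈ IsManifold.maximalAtlas 𝓘(ℝ, V) ∞ N) (hu : u ∈ c.source) (hu' : u ∈ c'.source)
    (g : C^∞⟮𝓘(ℝ, V), N; 𝓘(ℝ, ℝ), ℝ⟯) :
    derivAt c u g = (derivAt c' u g).comp (transitionDeriv c c' u) := by
  have h1 := hasFDerivAt_derivAt hc' hu' g
  have h2 := hasFDerivAt_transition hc hc' hu hu'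
  have h3 : (c' ∘ c.symm) (c u) = c' u := by simp [c.left_inv hu]
  rw [← h3] at h1
  have h4 := (h1.comp (c u) h2).fderiv
  rw [← h4]
  refine Filter.EventuallyEq.fderiv_eq ?_
  have h5 : ∀ᶠ x in 𝓝 (c u), c.symm x ∈ c'.source := by
    have := c.continuousAt_symm (c.map_source hu)
    rw [ContinuousAt, c.left_inv hu] at this
    exact this.eventually (c'.open_source.mem_nhds hu')
  filter_upwards [h5] with x hx
  simp [c'.left_inv hx]

theorem transitionDeriv_comp (hc : c ∈ IsManifold.maximalAtlas 𝓘(ℝ, V) ∞ N)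
    (hc' : c' ∈ IsManifold.maximalAtlas 𝓘(ℝ, V) ∞ N) (hu : u ∈ c.source) (hu' : u ∈ c'.source) :
    (transitionDeriv c' c u).comp (transitionDeriv c c' u) = ContinuousLinearMap.id ℝ V := by
  have h1 := hasFDerivAt_transition hc' hc hu' hu
  have h2 := hasFDerivAt_transition hc hc' hu hu'
  have h3 : (c' ∘ c.symm) (c u) = c' u := by simp [c.left_inv hu]
  rw [← h3] at h1
  rw [← (h1.comp (c u) h2).fderiv, ← fderiv_id (x := c u)]
  refine Filter.EventuallyEq.fderiv_eq ?_
  have h5 : ∀ᶠ x in 𝓝 (c u), c.symm x ∈ c'.source := by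
    have := c.continuousAt_symm (c.map_source hu)
    rw [ContinuousAt, c.left_inv hu] at this
    exact this.eventually (c'.open_source.mem_nhds hu')
  filter_upwards [h5, c.open_target.mem_nhds (c.map_source hu)] with x hx hx'
  simp [c'.left_inv hx, c.right_inv hx']

theorem restr_mem_maximalAtlas (hc : c ∈ IsManifold.maximalAtlas 𝓘(ℝ, V) ∞ N) {U : Set N}
    (hU : IsOpen U) : c.restr U ∈ IsManifold.maximalAtlas 𝓘(ℝ, V) ∞ N :=
  _root_.restr_mem_maximalAtlas _ hc hU

end Differentials

/-! ### Charts from functions with independent differentials -/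

section Coordinates

variable {n : ℕ} {M : Type*} [TopologicalSpace M] [ChartedSpace (EuclideanSpace ℝ (Fin n)) M]
  [IsManifold (𝓡 n) ∞ M]

/-- A functional vanishing on the range of `L` would be a linear relation between its components, so
`L` is onto. -/
theorem bijective_of_linearIndependent
    {φ : Fin n → EuclideanSpace ℝ (Fin n) →L[ℝ] ℝ} (hφ : LinearIndependent ℝ φ)
    (L : EuclideanSpace ℝ (Fin n) →L[ℝ] EuclideanSpace ℝ (Fin n)) (hL : ∀ v a, L v a = φ a v) :
    IsUnit L := by
  have hsurj : LinearMap.range L.toLinearMap = ⊤ := by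
    by_contra h
    obtain ⟨y, -, hy⟩ := SetLike.exists_of_lt (lt_top_iff_ne_top.mpr h)
    obtain ⟨ψ, hψ, hk⟩ := Submodule.exists_le_ker_of_notMem hy
    apply hψ
    have hsum : ∀ x : EuclideanSpace ℝ (Fin n), ψ x = ∑ a, x a * ψ (EuclideanSpace.single a 1) := by
      intro x
      have hx : x = ∑ a, x a • EuclideanSpace.single a (1 : ℝ) := by
        ext b
        simp [Pi.single_apply]
      conv_lhs => rw [hx]
      simp
    have h0 : ∑ a, ψ (EuclideanSpace.single a 1) • φ a = 0 := by
      ext v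
      have h1 : ψ (L v) = 0 := hk ⟨v, rfl⟩
      rw [hsum] at h1
      simp only [hL] at h1
      rw [sum_apply, zero_apply, ← h1]
      exact Finset.sum_congr rfl fun a _ => mul_comm _ _
    have h2 := Fintype.linearIndependent_iff.mp hφ _ h0
    rw [hsum]
    simp [h2]
  have hs : Function.Surjective L.toLinearMap := LinearMap.range_eq_top.mp hsurj
  have hb : Function.Bijective L.toLinearMap := ⟨LinearMap.injective_iff_surjective.mpr hs, hs⟩
  refine ⟨(ContinuousLinearEquiv.unitsEquiv ℝ _).symm
    (LinearEquiv.ofBijective L.toLinearMap hb).toContinuousLinearEquiv, ?_⟩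
  ext1 x
  rfl

theorem contMDiff_toLp (f : Fin n → Func n M) :
    ContMDiff (𝓡 n) (𝓡 n) ∞ fun q => WithLp.toLp 2 fun a => f a q :=
  (PiLp.contDiff_toLp (𝕜 := ℝ) (p := 2) (n := ∞) (E := fun _ : Fin n => ℝ)).contMDiff.comp
    (contMDiff_pi_space.mpr fun a => (f a).contMDiff)

/-- Functions with independent differentials at a point are the coordinates of a chart. -/
theorem exists_chart_of_linearIndependent {c : OpenPartialHomeomorph M (EuclideanSpace ℝ (Fin n))}
    (hc : c ∈ IsManifold.maximalAtlas (𝓡 n) ∞ M) {p : M} (hp : p ∈ c.source)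
    {f : Fin n → Func n M} (hf : LinearIndependent ℝ fun a => derivAt c p (f a)) :
    ∃ e ∈ IsManifold.maximalAtlas (𝓡 n) ∞ M, p ∈ e.source ∧ ∀ q ∈ e.source, ∀ a, e q a = f a q := by
  let G : EuclideanSpace ℝ (Fin n) → EuclideanSpace ℝ (Fin n) :=
    fun x => WithLp.toLp 2 fun a => f a (c.symm x)
  have hG : ContDiffOn ℝ ∞ G c.target :=
    ((contMDiff_toLp f).comp_contMDiffOn (contMDiffOn_symm_of_mem_maximalAtlas hc)).contDiffOn
  have hGat : ∀ x ∈ c.target, ContDiffAt ℝ ∞ G x := fun x hx =>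
    hG.contDiffAt (c.open_target.mem_nhds hx)
  have hGd : ∀ x ∈ c.target, HasFDerivAt G (fderiv ℝ G x) x := fun x hx =>
    ((hGat x hx).differentiableAt (by simp)).hasFDerivAt
  have hunit : IsUnit (fderiv ℝ G (c p)) := by
    refine bijective_of_linearIndependent hf _ fun v a => ?_
    have h1 := (EuclideanSpace.proj (𝕜 := ℝ) (ι := Fin n) a).hasFDerivAt.comp (c p)
      (hGd _ (c.map_source hp))
    exact (DFunLike.congr_fun h1.fderiv v).symm
  -- Restricting to the points with invertible derivative makes the inverse smooth on all of its
  -- domain, not just at the image of `p`.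
  let S := c.target ∩ fderiv ℝ G ⁻¹' {L | IsUnit L}
  have hS : IsOpen S := (hG.continuousOn_fderiv_of_isOpen c.open_target (by simp)).isOpen_inter_preimage
    c.open_target Units.isOpen
  let equiv : ∀ L : EuclideanSpace ℝ (Fin n) →L[ℝ] EuclideanSpace ℝ (Fin n), IsUnit L →
      EuclideanSpace ℝ (Fin n) ≃L[ℝ] EuclideanSpace ℝ (Fin n) := fun L hL =>
    ContinuousLinearEquiv.unitsEquiv ℝ _ hL.unit
  have hequiv : ∀ L hL, (equiv L hL : EuclideanSpace ℝ (Fin n) →L[ℝ] EuclideanSpace ℝ (Fin n)) = L :=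
    fun L hL => by
      ext1 x
      rfl
  have hGp : HasFDerivAt G (equiv _ hunit : _ →L[ℝ] _) (c p) := by
    rw [hequiv]
    exact hGd _ (c.map_source hp)
  let g := (hGat _ (c.map_source hp)).toOpenPartialHomeomorph G hGp (by simp)
  let e := c.trans (g.restr S)
  have hsrc : ∀ q, q ∈ e.source ↔ q ∈ c.source ∧ c q ∈ g.source ∧ c q ∈ S := by
    intro q
    simp only [e, OpenPartialHomeomorph.trans_source, OpenPartialHomeomorph.restr_source,
      hS.interior_eq, mem_inter_iff, mem_preimage]
  have heq : ∀ q ∈ e.source, e q = WithLp.toLp 2 fun a => f a q := by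
    intro q hq
    change (WithLp.toLp 2 fun a => f a (c.symm (c q))) = _
    rw [c.left_inv ((hsrc q).mp hq).1]
  refine ⟨e, ?_, ?_, fun q hq a => by rw [heq q hq]⟩
  · refine e.mem_maximalAtlas_of_contMDiffOn ((contMDiff_toLp f).contMDiffOn.congr heq) ?_
    have h1 : e.target = (g.restr S).target ∩ (g.restr S).symm ⁻¹' c.target := rfl
    refine (contMDiffOn_symm_of_mem_maximalAtlas hc).comp (t := c.target) ?_
      (fun y hy => (h1 ▸ hy).2)
    intro y hy
    have hy1 : y ∈ (g.restr S).target := (h1 ▸ hy).1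
    have hy2 := (g.restr S).map_target hy1
    rw [OpenPartialHomeomorph.restr_source, hS.interior_eq] at hy2
    have hyS : g.symm y ∈ S := hy2.2
    have hyg : y ∈ g.target := hy1.1
    have h2 : HasFDerivAt g (equiv _ hyS.2 : _ →L[ℝ] _) (g.symm y) := by
      rw [hequiv]
      exact hGd _ hyS.1
    exact (g.contDiffAt_symm hyg h2 (hGat _ hyS.1)).contMDiffAt.contMDiffWithinAt
  · rw [hsrc]
    exact ⟨hp, (hGat _ (c.map_source hp)).mem_toOpenPartialHomeomorph_source hGp (by simp),
      c.map_source hp, hunit⟩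

end Coordinates

/-! ### Differentials of lifts at constant jets -/

section LiftDifferentials

variable {n : ℕ} {M : Type*} [TopologicalSpace M] [ChartedSpace (EuclideanSpace ℝ (Fin n)) M]
  [IsManifold (𝓡 n) ∞ M] {k : ℕ}

theorem lift_constFunc_apply (r : ℝ) (j : Fin (k + 1)) (u : JetBundle n M k) :
    lift (constFunc r : Func n M) j u = PowerSeries.coeff (j : ℕ) (PowerSeries.C r) := by
  obtain ⟨γ, rfl⟩ := exists_jet u
  rw [lift_jet, ← tser_const]
  rfl

theorem lift_constJet (f : Func n M) (j : Fin (k + 1)) (p : M) :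
    lift f j (constJet k p) = if j = 0 then f p else 0 := by
  have : lift f j (constJet k p) = PowerSeries.coeff (j : ℕ) (tser fun _ => f p) := lift_jet f j _
  rw [this, tser_const, PowerSeries.coeff_C]
  exact if_congr (by rw [Fin.ext_iff, Fin.val_zero]) rfl rfl

theorem derivAt_lift_coord {e : OpenPartialHomeomorph M (EuclideanSpace ℝ (Fin n))}
    (he : e ∈ IsManifold.maximalAtlas (𝓡 n) ∞ M) {p : M} (hp : p ∈ e.source) {f : Func n M}
    {a : Fin n} {r : ℝ} (hf : ⇑f =ᶠ[𝓝 p] fun q => e q a - r) (j : Fin (k + 1)) :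
    derivAt (jetHomeo k e he) (constJet k p) (lift f j) = jetProj j a := by
  have hp' : (constJet k p : JetBundle n M k) ∈ (jetHomeo k e he).source := hp
  have hf' : ⇑(f + (constFunc r : Func n M)) =ᶠ[𝓝 p] fun q => e q a := by
    filter_upwards [hf] with q hq
    rw [smooth_add_apply, hq, constFunc_apply, sub_add_cancel]
  refine derivAt_linear hp' (jetProj j a) (r := PowerSeries.coeff (j : ℕ) (PowerSeries.C r)) ?_
  filter_upwards [continuous_base.continuousAt.eventually (eventually_eventually_nhds.mpr hf'),
    (jetHomeo k e he).open_source.mem_nhds hp'] with v hv hvs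
  have h2 := lift_eq_jetCoord he hvs hv j
  rw [lift_add, smooth_add_apply, lift_constFunc_apply] at h2
  exact eq_sub_of_add_eq h2

variable [T2Space M] [SecondCountableTopology M]

/-- Hadamard's lemma at a point of a manifold. -/
theorem exists_sub_mem_germIdeal {e : OpenPartialHomeomorph M (EuclideanSpace ℝ (Fin n))}
    (he : e ∈ IsManifold.maximalAtlas (𝓡 n) ∞ M) {p : M} (hp : p ∈ e.source) (f : Func n M) :
    ∃ X h : Fin n → Func n M, (∀ a, ⇑(X a) =ᶠ[𝓝 p] fun q => e q a - e p a) ∧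
      f - (constFunc (f p) + ∑ a, X a * h a) ∈ germIdeal p := by
  obtain ⟨φ, hφ⟩ := exists_extension (V := EuclideanSpace ℝ (Fin n)) e.open_target
    (e.map_source hp) (f.contMDiff.comp_contMDiffOn (contMDiffOn_symm_of_mem_maximalAtlas he))
  obtain ⟨h, hh, hφh⟩ := exists_sum_eq_sub (g := fun y => φ (e p + y))
    (φ.contMDiff.contDiff.comp (contDiff_const.add contDiff_id))
    (fun a : Fin n => EuclideanSpace.proj a) fun a => EuclideanSpace.single a (1 : ℝ)
  choose X hX using fun a => exists_func_eq (n := n) e.open_source hp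
    (f := fun q => e q a - e p a) ((contMDiffOn_coord he a).sub contMDiffOn_const)
  choose h' hh' using fun a => exists_func_eq (n := n) e.open_source hp
    (f := fun q => h a (e q - e p)) (((hh a).comp
      (contDiff_id.sub contDiff_const)).contMDiff.comp_contMDiffOn
        (contMDiffOn_of_mem_maximalAtlas he))
  refine ⟨X, h', hX, sub_mem_germIdeal.mpr ?_⟩
  filter_upwards [eventually_all.mpr hX, eventually_all.mpr hh', e.open_source.mem_nhds hp,
    (e.continuousAt hp).eventually hφ] with q h1 h2 hq h3
  have h4 := hφh (e q - e p)
  have h5 : e q - e p - ∑ a, (EuclideanSpace.proj a : EuclideanSpace ℝ (Fin n) →L[ℝ] ℝ)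
      (e q - e p) • EuclideanSpace.single a (1 : ℝ) = 0 := by
    ext b
    simp [Pi.single_apply]
  have h6 : φ (e p) = f p := by
    have := hφ.self_of_nhds
    rwa [Function.comp_apply, e.left_inv hp] at this
  rw [h5, add_zero, add_sub_cancel, h6, h3, Function.comp_apply, e.left_inv hq] at h4
  rw [smooth_add_apply, constFunc_apply, smooth_sum_apply, ← sub_eq_iff_eq_add', h4]
  refine Finset.sum_congr rfl fun a _ => ?_
  rw [smooth_mul_apply, h1, h2]
  rfl

theorem derivAt_coord {e : OpenPartialHomeomorph M (EuclideanSpace ℝ (Fin n))}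
    {p : M} (hp : p ∈ e.source) {f : M → ℝ}
    {a : Fin n} {r : ℝ} (hf : f =ᶠ[𝓝 p] fun q => e q a - r) :
    derivAt e p f = EuclideanSpace.proj a :=
  derivAt_linear hp (EuclideanSpace.proj a) hf

/-- The differential of a lift along the zero section. -/
theorem derivAt_lift_constJet {e : OpenPartialHomeomorph M (EuclideanSpace ℝ (Fin n))}
    (he : e ∈ IsManifold.maximalAtlas (𝓡 n) ∞ M) {p : M} (hp : p ∈ e.source) (f : Func n M)
    (j : Fin (k + 1)) (z : Fin (k + 1) → EuclideanSpace ℝ (Fin n)) :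
    derivAt (jetHomeo k e he) (constJet k p) (lift f j) z = derivAt e p f (z j) := by
  have hp' : (constJet k p : JetBundle n M k) ∈ (jetHomeo k e he).source := hp
  have hH := jetHomeo_mem_maximalAtlas (k := k) he
  obtain ⟨X, h, hX, hf⟩ := exists_sub_mem_germIdeal he hp f
  have hX0 : ∀ a, X a p = 0 := fun a => (hX a).self_of_nhds.trans (sub_self _)
  have e1 : derivAt e p f = ∑ a, h a p • (EuclideanSpace.proj a : EuclideanSpace ℝ (Fin n) →L[ℝ] ℝ) := by
    rw [derivAt_congr hp (sub_mem_germIdeal.mp hf), ← derivAtₗ_apply he hp, map_add, map_sum,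
      derivAtₗ_apply]
    have : derivAt e p (constFunc (f p) : Func n M) = 0 := derivAt_const _
    rw [this, zero_add]
    refine Finset.sum_congr rfl fun a _ => ?_
    rw [derivAtₗ_apply, derivAt_mul he hp, hX0, zero_smul, zero_add, derivAt_coord hp (hX a)]
  have e2 : derivAt (jetHomeo k e he) (constJet k p) (lift f j) = ∑ a, h a p • jetProj j a := by
    have hgerm := lift_sub_lift_mem_germIdeal (u := constJet k p) hf j
    rw [derivAt_congr hp' (sub_mem_germIdeal.mp hgerm), lift_add, lift_sum,
      ← derivAtₗ_apply hH hp', map_add, map_sum, derivAtₗ_apply]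
    have : ⇑(lift (constFunc (f p) : Func n M) j) =
        fun _ => PowerSeries.coeff (j : ℕ) (PowerSeries.C (f p)) :=
      funext fun u => lift_constFunc_apply _ _ u
    rw [this, derivAt_const, zero_add]
    refine Finset.sum_congr rfl fun a _ => ?_
    -- At a constant jet all lifts of positive order vanish, and `X a` vanishes at `p`. In the
    -- Leibniz sum only the differential of `(X a)^{(j)}` times `h a p` survives.
    rw [lift_mul, map_sum, Finset.sum_eq_single ⟨((j : ℕ), 0), by simp⟩]
    · rw [derivAtₗ_apply, derivAt_mul hH hp', lift_constJet, lift_constJet]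
      have h0 : (⟨0, by omega⟩ : Fin (k + 1)) = 0 := rfl
      simp only [h0, if_true, hX0, ite_self, zero_smul, zero_add]
      rw [derivAt_lift_coord he hp (hX a)]
    · rintro ⟨⟨m₁, m₂⟩, hm⟩ - hne
      rw [derivAtₗ_apply, derivAt_mul hH hp', lift_constJet, lift_constJet, hX0, ite_self,
        zero_smul, zero_add, if_neg, zero_smul]
      intro h0
      have h1 : m₂ = 0 := congrArg Fin.val h0
      have h2 := Finset.HasAntidiagonal.mem_antidiagonal.mp hm
      apply hne
      subst h1
      simp only [add_zero] at h2
      subst h2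
      rfl
    · simp
  rw [e1, e2]
  simp

end LiftDifferentials

/-! ### Scaling of curves, and points away from the base -/

section Scaling

variable {n : ℕ} {M : Type*} [TopologicalSpace M] [ChartedSpace (EuclideanSpace ℝ (Fin n)) M]
  [IsManifold (𝓡 n) ∞ M] {k : ℕ}

/-- `Q` is the zero set of the lifts of functions that vanish on it. -/
def IsCutOutByLifts (Q : Set (JetBundle n M k)) : Prop :=
  ∀ u, (∀ (f : Func n M) (j : Fin (k + 1)), lift f j ∈ vanishingIdeal Q → lift f j u = 0) → u ∈ Q

/-- The curve `t ↦ γ (c t)`. -/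
noncomputable def scaleCurve (γ : Curve n M) (c : ℝ) : Curve n M :=
  reparam γ (fun t => c * t) (by fun_prop)

@[simp] theorem scaleCurve_apply (γ : Curve n M) (c t : ℝ) : scaleCurve γ c t = γ (c * t) := rfl

theorem scaleCurve_scaleCurve (γ : Curve n M) {c : ℝ} (hc : c ≠ 0) :
    scaleCurve (scaleCurve γ c) c⁻¹ = γ := by
  ext t
  simp [hc]

theorem jet_scaleCurve_zero (γ : Curve n M) : jet k (scaleCurve γ 0) = constJet k (γ 0) := by
  have : scaleCurve γ 0 = mkSmooth (fun _ => γ 0) contMDiff_const := by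
    ext t
    simp
  rw [this]
  rfl

theorem lift_scaleCurve (f : Func n M) (j : Fin (k + 1)) (γ : Curve n M) (c : ℝ) :
    lift f j (jet k (scaleCurve γ c)) = c ^ (j : ℕ) * lift f j (jet k γ) := by
  rw [lift_jet, lift_jet, ← coeff_tser_comp_mul (contDiff_func_comp f γ)]
  rfl

/-- The lift of order `j` is homogeneous of degree `j`. The value `c = 0` is allowed, which yields
the constant jets. -/
theorem IsCutOutByLifts.scaleCurve_mem {Q : Set (JetBundle n M k)} (hQ : IsCutOutByLifts Q)
    {γ : Curve n M} (hγ : jet k γ ∈ Q) (c : ℝ) : jet k (scaleCurve γ c) ∈ Q :=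
  hQ _ fun f j hf => by rw [lift_scaleCurve, hf _ hγ, mul_zero]

theorem IsCutOutByLifts.constJet_mem {Q : Set (JetBundle n M k)} (hQ : IsCutOutByLifts Q)
    {γ : Curve n M} (hγ : jet k γ ∈ Q) : constJet k (γ 0) ∈ Q := by
  rw [← jet_scaleCurve_zero]
  exact hQ.scaleCurve_mem hγ 0

variable [T2Space M] [SecondCountableTopology M]

/-- If all generators vanished at a point off the closed set `Q`, so would the whole ideal; but a
bump function supported off `Q` belongs to it. -/
theorem isCutOutByLifts_of_generatedByLifts {Q : Set (JetBundle n M k)} (hQ : IsClosed Q)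
    (h : GeneratedByLifts Q) : IsCutOutByLifts Q := by
  intro u hu
  by_contra huQ
  obtain ⟨χ, h1, h2⟩ := exists_bump (V := Fin (k + 1) → EuclideanSpace ℝ (Fin n)) hQ.isOpen_compl
    isClosed_singleton (singleton_subset_iff.mpr huQ)
  rw [nhdsSet_singleton] at h1
  have hχ : χ ∈ vanishingIdeal Q := fun v hv => by
    by_contra hne
    exact h2 (subset_tsupport _ hne) hv
  have hzero : ∀ g ∈ vanishingIdeal Q, g u = 0 := by
    intro g hg
    rw [h] at hg
    induction hg using Submodule.span_induction with
    | mem g hg =>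
      obtain ⟨hg, f, j, rfl⟩ := hg
      exact hu f j hg
    | zero => rfl
    | add g g' _ _ hg hg' => rw [smooth_add_apply, hg, hg', add_zero]
    | smul r g _ hg => rw [smul_eq_mul, smooth_mul_apply, hg, mul_zero]
  have := h1.self_of_nhds
  rw [hzero χ hχ] at this
  exact zero_ne_one this

theorem jetCoord_scaleCurve {e : OpenPartialHomeomorph M (EuclideanSpace ℝ (Fin n))}
    (he : e ∈ IsManifold.maximalAtlas (𝓡 n) ∞ M) {γ : Curve n M} (h0 : γ 0 ∈ e.source) (c : ℝ)
    (j : Fin (k + 1)) :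
    jetCoord e (jet k (scaleCurve γ c)) j = c ^ (j : ℕ) • jetCoord e (jet k γ) j := by
  ext a
  obtain ⟨f, hf⟩ := exists_func_eq (n := n) e.open_source h0 (contMDiffOn_coord he a)
  have h1 : (jet k (scaleCurve γ c)).base = γ 0 := by simp
  rw [PiLp.smul_apply, smul_eq_mul, ← lift_eq_jetCoord he (f := f) (by rwa [h1]) (by rwa [h1]),
    ← lift_eq_jetCoord he (u := jet k γ) (f := f) h0 hf, lift_scaleCurve]

theorem tendsto_jet_scaleCurve (γ : Curve n M) :
    Tendsto (fun c => jet k (scaleCurve γ c)) (𝓝 0) (𝓝 (constJet k (γ 0))) := by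
  have he := IsManifold.chart_mem_maximalAtlas (I := 𝓡 n) (n := ∞) (γ 0)
  have h0 := mem_chart_source (EuclideanSpace ℝ (Fin n)) (γ 0)
  set e := chartAt (EuclideanSpace ℝ (Fin n)) (γ 0)
  set H := jetHomeo k e he with hH
  have hsrc : ∀ c, jet k (scaleCurve γ c) ∈ H.source := fun c => by
    rw [hH, mem_jetHomeo_source, base_jet, scaleCurve_apply, mul_zero]
    exact h0
  have h1 : Continuous fun c : ℝ => H (jet k (scaleCurve γ c)) := by
    refine continuous_pi fun j => ?_
    have : (fun c : ℝ => H (jet k (scaleCurve γ c)) j) =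
        fun c => c ^ (j : ℕ) • jetCoord e (jet k γ) j :=
      funext fun c => jetCoord_scaleCurve he h0 c j
    rw [this]
    fun_prop
  have h2 : Tendsto (fun c : ℝ => H.symm (H (jet k (scaleCurve γ c)))) (𝓝 0)
      (𝓝 (H.symm (H (jet k (scaleCurve γ 0))))) :=
    (H.continuousAt_symm (H.map_source (hsrc 0))).tendsto.comp (h1.tendsto 0)
  simp only [H.left_inv (hsrc _)] at h2
  rwa [jet_scaleCurve_zero] at h2

theorem IsWeightedCurve.scaleCurve {e : OpenPartialHomeomorph M (EuclideanSpace ℝ (Fin n))}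
    (he : e ∈ IsManifold.maximalAtlas (𝓡 n) ∞ M) {w : Fin n → ℕ} {γ : Curve n M}
    (h0 : γ 0 ∈ e.source) (hγ : IsWeightedCurve e w γ) (c : ℝ) :
    IsWeightedCurve e w (scaleCurve γ c) :=
  hγ.comp he h0 (ψ := fun t => c * t) (by fun_prop) (mul_zero c) fun _ => rfl

/-- If all weighted curves near the zero section have their jet in `Q`, then so do all weighted
curves. -/
theorem IsCutOutByLifts.mem_of_isWeightedCurve {Q : Set (JetBundle n M k)} (hQ : IsCutOutByLifts Q)
    {e : OpenPartialHomeomorph M (EuclideanSpace ℝ (Fin n))}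
    (he : e ∈ IsManifold.maximalAtlas (𝓡 n) ∞ M) {w : Fin n → ℕ} {O : Set (JetBundle n M k)}
    (hO : IsOpen O) (h : ∀ γ : Curve n M, jet k γ ∈ O → γ 0 ∈ e.source → IsWeightedCurve e w γ →
      jet k γ ∈ Q) {γ : Curve n M} (h0 : γ 0 ∈ e.source) (hγO : constJet k (γ 0) ∈ O)
    (hγ : IsWeightedCurve e w γ) : jet k γ ∈ Q := by
  -- Scale the curve by a small `c ≠ 0` to move its jet into `O`, then return by `c⁻¹`.
  have h1 : ∀ᶠ c in 𝓝[≠] (0 : ℝ), jet k (JetWeighting.scaleCurve γ c) ∈ O :=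
    ((tendsto_jet_scaleCurve γ).eventually (hO.mem_nhds hγO)).filter_mono nhdsWithin_le_nhds
  obtain ⟨c, hc, hc0⟩ := (h1.and self_mem_nhdsWithin).exists
  have h2 := h _ hc (by simpa using h0) (hγ.scaleCurve he h0 c)
  have h3 := hQ.scaleCurve_mem h2 c⁻¹
  rwa [scaleCurve_scaleCurve γ hc0] at h3

/-- Away from the base of `Q` there are adapted charts for all nonzero weights. -/
theorem IsCutOutByLifts.exists_isAdapted_of_notMem {Q : Set (JetBundle n M k)} (hc : IsClosed Q)
    (hQ : IsCutOutByLifts Q) {p : M} (hp : constJet k p ∉ Q) {w : Fin n → ℕ} (hw : Monotone w)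
    (hwk : ∀ a, w a ≤ k + 1) (hw0 : ∃ a, 0 < w a) : ∃ e, IsAdapted Q e w ∧ p ∈ e.source := by
  have he₀ := IsManifold.chart_mem_maximalAtlas (I := 𝓡 n) (n := ∞) p
  have hp₀ := mem_chart_source (EuclideanSpace ℝ (Fin n)) p
  set e₀ := chartAt (EuclideanSpace ℝ (Fin n)) p
  -- The shift gives every coordinate the value `1` at `p`. Near `p` there are then no weighted
  -- curves, as some weight is positive, and no jets of `Q`, as `constJet` avoids the closed set
  -- `Q`.
  choose f hf using fun a => exists_func_eq (n := n) e₀.open_source hp₀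
    (f := fun q => e₀ q a - (e₀ p a - 1)) ((contMDiffOn_coord he₀ a).sub contMDiffOn_const)
  have hli : LinearIndependent ℝ fun a => derivAt e₀ p (f a) := by
    have : (fun a => derivAt e₀ p (f a)) = fun a => EuclideanSpace.proj (𝕜 := ℝ) a :=
      funext fun a => derivAt_coord hp₀ (hf a)
    rw [this, Fintype.linearIndependent_iff]
    intro g hg b
    have := DFunLike.congr_fun hg (EuclideanSpace.single b (1 : ℝ))
    simpa [Pi.single_apply] using this
  obtain ⟨e, he, hpe, hef⟩ := exists_chart_of_linearIndependent he₀ hp₀ hli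
  obtain ⟨a, ha⟩ := hw0
  let U : Set M := {q | f a q ≠ 0} ∩ {q | constJet k q ∉ Q}
  have hU : IsOpen U := (isOpen_ne_fun (f a).contMDiff.continuous continuous_const).inter
    (hc.isOpen_compl.preimage continuous_constJet)
  have hpU : p ∈ U := by
    refine ⟨?_, hp⟩
    have := (hf a).self_of_nhds
    simp only [mem_ofPred_eq, this]
    norm_num
  refine ⟨e.restr U, ⟨restr_mem_maximalAtlas he hU, hw, hwk, fun γ h0 => ?_⟩, ?_⟩
  · rw [e.restr_source' _ hU] at h0
    refine ⟨fun hγ => absurd (hQ.constJet_mem hγ) h0.2.2, fun hγ => absurd ?_ h0.2.1⟩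
    have := hγ.coord_eq_zero ha
    rw [← hef _ h0.1]
    exact this
  · rw [e.restr_source' _ hU]
    exact ⟨hpe, hpU⟩

end Scaling

/-! ### Bases adapted to a filtration -/

section Flags

/-- A descending filtration of a finite-dimensional vector space has an adapted basis. -/
theorem exists_adapted_basis {W : Type*} [AddCommGroup W] [Module ℝ W] [FiniteDimensional ℝ W]
    {n : ℕ} (hn : Module.finrank ℝ W = n) {A : ℕ → Submodule ℝ W} (hA : Antitone A)
    (hA0 : A 0 = ⊤) (m : ℕ) :
    ∃ (b : Fin n → W) (w : Fin n → ℕ), LinearIndependent ℝ b ∧ Monotone w ∧ (∀ a, w a ≤ m) ∧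
      (∀ a, b a ∈ A (w a)) ∧ ∀ i ≤ m, A i ≤ Submodule.span ℝ (b '' {a | i ≤ w a}) := by
  classical
  -- The basis is grown from the smallest space `A m` upwards, by extending an independent set
  -- through `A (m - d)`.
  have key : ∀ d ≤ m, ∃ s : Set W, LinearIndepOn ℝ id s ∧ s ⊆ A (m - d) ∧
      ∀ i ≤ m, m - d ≤ i → (A i : Set W) ⊆ Submodule.span ℝ (s ∩ A i) := by
    intro d
    induction d with
    | zero =>
      intro _
      obtain ⟨s, hs, -, hspan, hli⟩ := exists_linearIndepOn_id_extension (K := ℝ)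
        (linearIndepOn_empty ℝ id) (empty_subset (A m : Set W))
      refine ⟨s, hli, hs, fun i hi hi' => ?_⟩
      obtain rfl : i = m := le_antisymm hi hi'
      rwa [inter_eq_left.mpr hs]
    | succ d ih =>
      intro hd
      obtain ⟨s, hli, hs, hspan⟩ := ih (by omega)
      obtain ⟨t, ht, hst, htspan, htli⟩ := exists_linearIndepOn_id_extension (K := ℝ)
        (t := (A (m - (d + 1)) : Set W)) hli (hs.trans (hA (by omega)))
      refine ⟨t, htli, ht, fun i hi hi' => ?_⟩
      rcases eq_or_lt_of_le hi' with rfl | hlt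
      · rwa [inter_eq_left.mpr ht]
      · exact (hspan i hi (by omega)).trans
          (Submodule.span_mono (inter_subset_inter_left _ hst))
  obtain ⟨s, hli, -, hspan⟩ := key m le_rfl
  simp only [Nat.sub_self, zero_le, forall_const] at hspan
  have htop : ⊤ ≤ Submodule.span ℝ s := by
    have := hspan 0 (Nat.zero_le _)
    rw [hA0] at this
    exact fun x _ => Submodule.span_mono inter_subset_left (this (mem_univ x))
  have B := Module.Basis.mk (v := ((↑) : s → W)) hli (by rwa [Subtype.range_coe])
  have hfin : Finite s := Module.Finite.finite_basis B
  have := Fintype.ofFinite s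
  have hcard : Fintype.card s = n := by rw [← hn, Module.finrank_eq_card_basis B]
  let ε : Fin n ≃ s := (Fintype.equivFinOfCardEq hcard).symm
  -- The weight is the last index up to `m` whose space contains the vector; sorting then makes the
  -- weights monotone.
  let wt : W → ℕ := fun x => Nat.findGreatest (fun i => x ∈ A i) m
  have hwt : ∀ x, x ∈ A (wt x) := fun x =>
    Nat.findGreatest_spec (P := fun i => x ∈ A i) (Nat.zero_le m) (by rw [hA0]; trivial)
  let σ := Tuple.sort fun a => wt (ε a)
  refine ⟨fun a => ε (σ a), fun a => wt (ε (σ a)), ?_, Tuple.monotone_sort fun a => wt (ε a),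
    fun a => Nat.findGreatest_le m, fun a => hwt _, fun i hi => ?_⟩
  · exact hli.comp (fun a => ε (σ a)) (ε.injective.comp σ.injective)
  · refine SetLike.coe_subset_coe.mp ((hspan i hi).trans (Submodule.span_mono ?_))
    rintro x ⟨hxs, hxi⟩
    refine ⟨σ.symm (ε.symm ⟨x, hxs⟩), ?_, by simp⟩
    simp only [mem_ofPred_eq, Equiv.apply_symm_apply]
    exact Nat.le_findGreatest hi hxi

end Flags

/-! ### Tangent spaces of submanifolds -/

section Submanifolds

variable {V : Type*} [NormedAddCommGroup V] [NormedSpace ℝ V] [FiniteDimensional ℝ V]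
  {N : Type*} [TopologicalSpace N] [ChartedSpace V N] [IsManifold 𝓘(ℝ, V) ∞ N]

/-- A subset that is a subspace `K` in a chart `c` and that lies in a subspace `Z` in a chart `H`
equals `Z` near a point where the tangent spaces agree. -/
theorem eventually_mem_of_le_map {c H : OpenPartialHomeomorph N V}
    (hc : c ∈ IsManifold.maximalAtlas 𝓘(ℝ, V) ∞ N) (hH : H ∈ IsManifold.maximalAtlas 𝓘(ℝ, V) ∞ N)
    {u₀ : N} (hu : u₀ ∈ c.source) (hu' : u₀ ∈ H.source) {Q : Set N} (hu₀ : u₀ ∈ Q)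
    {K Z : Submodule ℝ V} (hK : ∀ v ∈ c.source, v ∈ Q ↔ c v ∈ K)
    (hZ : ∀ v ∈ H.source, v ∈ Q → H v ∈ Z)
    (hle : Z ≤ K.map (transitionDeriv c H u₀).toLinearMap) : ∀ᶠ u in 𝓝 u₀, H u ∈ Z → u ∈ Q := by
  -- Parametrize `Q` by `K` and project its image in `H` onto `Z`. The derivative is onto, so every
  -- nearby point of `Z` is the projection of a point of `Q`; as `Q` already lies in `Z`, the
  -- projection changes nothing.
  obtain ⟨π, hπ⟩ := Submodule.ClosedComplemented.of_finiteDimensional (𝕜 := ℝ) Z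
  have := FiniteDimensional.complete ℝ K
  have := FiniteDimensional.complete ℝ Z
  let x₀ : K := ⟨c u₀, (hK u₀ hu).mp hu₀⟩
  let F : K → Z := fun x => π (H (c.symm x))
  have hF : HasStrictFDerivAt F (π.comp ((transitionDeriv c H u₀).comp K.subtypeL)) x₀ := by
    have h1 : HasStrictFDerivAt (H ∘ c.symm) (transitionDeriv c H u₀) (c u₀) :=
      (contDiffAt_transition hH hc hu' hu).hasStrictFDerivAt (by simp)
    exact π.hasStrictFDerivAt.comp x₀ (h1.comp x₀ K.subtypeL.hasStrictFDerivAt)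
  have hsurj : (π.comp ((transitionDeriv c H u₀).comp K.subtypeL)).range = ⊤ := by
    refine LinearMap.range_eq_top.mpr fun z => ?_
    obtain ⟨x, hx, hxz⟩ := hle z.2
    refine ⟨⟨x, hx⟩, ?_⟩
    change π (transitionDeriv c H u₀ x) = z
    have hxz' : transitionDeriv c H u₀ x = z := hxz
    rw [hxz', hπ]
  have hmap := hF.map_nhds_eq_of_surj hsurj
  have hB : ∀ᶠ x : K in 𝓝 x₀, (x : V) ∈ c.target ∧ c.symm x ∈ H.source := by
    have h1 : ContinuousAt (fun x : K => (x : V)) x₀ := continuous_subtype_val.continuousAt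
    have h2 := c.continuousAt_symm (c.map_source hu)
    rw [ContinuousAt, c.left_inv hu] at h2
    exact h1.eventually ((c.open_target.eventually_mem (c.map_source hu)).and
      (h2.eventually (H.open_source.mem_nhds hu')))
  have hFB : ∀ᶠ z in 𝓝 (F x₀), ∃ x : K, ((x : V) ∈ c.target ∧ c.symm x ∈ H.source) ∧ F x = z := by
    rw [← hmap]
    exact image_mem_map hB
  have hFx₀ : F x₀ = π (H u₀) := by
    change π (H (c.symm (c u₀))) = _
    rw [c.left_inv hu]
  rw [hFx₀] at hFB
  filter_upwards [(π.continuous.continuousAt.comp (H.continuousAt hu')).eventually hFB,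
    H.open_source.mem_nhds hu'] with u ⟨x, ⟨hx1, hx2⟩, hxu⟩ hus huZ
  have hvQ : c.symm x ∈ Q := by
    rw [hK _ (c.map_target hx1), c.right_inv hx1]
    exact x.2
  have h1 := hπ ⟨_, hZ _ hx2 hvQ⟩
  have h2 := hπ ⟨_, huZ⟩
  have h3 : H (c.symm x) = H u := by
    have : π (H (c.symm x)) = π (H u) := hxu
    have h4 := h1.symm.trans (this.trans h2)
    exact congrArg Subtype.val h4
  rw [← H.injOn hx2 hus h3]
  exact hvQ

variable [T2Space N] [SigmaCompactSpace N]

/-- The tangent space of a submanifold is cut out by the differentials of the functions that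
vanish on it. -/
theorem le_map_of_derivAt_eq_zero {c H : OpenPartialHomeomorph N V}
    (hc : c ∈ IsManifold.maximalAtlas 𝓘(ℝ, V) ∞ N) (hH : H ∈ IsManifold.maximalAtlas 𝓘(ℝ, V) ∞ N)
    {u₀ : N} (hu : u₀ ∈ c.source) (hu' : u₀ ∈ H.source) {Q : Set N}
    {K Z : Submodule ℝ V} (hK : ∀ v ∈ c.source, v ∈ Q → c v ∈ K)
    (h : ∀ g : C^∞⟮𝓘(ℝ, V), N; 𝓘(ℝ, ℝ), ℝ⟯, (∀ v ∈ Q, g v = 0) → ∀ z ∈ Z, derivAt H u₀ g z = 0) :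
    Z ≤ K.map (transitionDeriv c H u₀).toLinearMap := by
  intro z hz
  by_contra hzK
  obtain ⟨φ, hφz, hφ⟩ := Submodule.exists_le_ker_of_notMem hzK
  let φ' : V →L[ℝ] ℝ := LinearMap.toContinuousLinearMap φ
  -- The functional separating `z` from the tangent space, read in the chart `c`, vanishes on `K`.
  -- Cut off, it is a function vanishing on `Q` whose differential does not kill `z`.
  let ξ : V →L[ℝ] ℝ := φ'.comp (transitionDeriv c H u₀)
  obtain ⟨χ, h1, h2⟩ := exists_bump (V := V) c.open_source isClosed_singleton
    (singleton_subset_iff.mpr hu)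
  rw [nhdsSet_singleton] at h1
  have hξ : ContMDiffOn 𝓘(ℝ, V) 𝓘(ℝ, ℝ) ∞ (fun v => ξ (c v)) c.source :=
    ξ.contDiff.contMDiff.comp_contMDiffOn (contMDiffOn_of_mem_maximalAtlas hc)
  let g := mkSmooth (fun v => χ v * ξ (c v))
    (contMDiff_mul_of_tsupport c.open_source χ.contMDiff h2 hξ)
  have hg : ∀ v ∈ Q, g v = 0 := by
    intro v hv
    by_cases hvc : v ∈ c.source
    · have : ξ (c v) = 0 := hφ ⟨c v, hK v hvc hv, rfl⟩
      simp [g, this]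
    · have : χ v = 0 := by
        by_contra hne
        exact hvc (h2 (subset_tsupport _ hne))
      simp [g, this]
  have hgc : ⇑g =ᶠ[𝓝 u₀] fun v => ξ (c v) - 0 := by
    filter_upwards [h1] with v hv
    simp [g, hv]
  have h3 := h g hg z hz
  rw [derivAt_eq_comp hH hc hu' hu, derivAt_linear hu ξ hgc] at h3
  have h4 := DFunLike.congr_fun (transitionDeriv_comp hH hc hu' hu) z
  have h5 : φ' (transitionDeriv c H u₀ (transitionDeriv H c u₀ z)) = 0 := h3
  have h6 : transitionDeriv c H u₀ (transitionDeriv H c u₀ z) = z := h4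
  rw [h6] at h5
  exact hφz h5

end Submanifolds

/-! ### Construction of adapted charts at constant jets in `Q` -/

section AdaptedAtZeroSection

variable {n : ℕ} {M : Type*} [TopologicalSpace M] [ChartedSpace (EuclideanSpace ℝ (Fin n)) M]
  [IsManifold (𝓡 n) ∞ M] {k : ℕ}

/-- The jets of weighted curves, in the jet coordinates. -/
def weightedJets (n k : ℕ) (w : Fin n → ℕ) :
    Submodule ℝ (Fin (k + 1) → EuclideanSpace ℝ (Fin n)) where
  carrier := {z | ∀ a, ∀ j : Fin (k + 1), (j : ℕ) < w a → z j a = 0}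
  zero_mem' := fun _ _ _ => rfl
  add_mem' := fun {y z} hy hz a j hj => by
    rw [Pi.add_apply, PiLp.add_apply, hy a j hj, hz a j hj, add_zero]
  smul_mem' := fun r z hz a j hj => by
    rw [Pi.smul_apply, PiLp.smul_apply, hz a j hj, smul_zero]

variable [T2Space M] [SecondCountableTopology M]

/-- A function whose lift vanishes on `Q` differs from a function of high order along `Q`, near a
point of the base of `Q`, by a constant. -/
theorem LowerLiftsVanish.exists_mem_curveOrderIdeal {Q : Set (JetBundle n M k)}
    (hlow : LowerLiftsVanish Q) (hQ : IsCutOutByLifts Q) {p : M} (hp : constJet k p ∈ Q)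
    {f : Func n M} {j : Fin (k + 1)} (hf : lift f j ∈ vanishingIdeal Q) :
    ∃ g ∈ curveOrderIdeal Q (j + 1), ⇑g =ᶠ[𝓝 p] fun q => f q - f p := by
  obtain ⟨h1, h2⟩ := hlow f j hf
  obtain ⟨O, hO, hpO, hOf⟩ := (IsLocallyConstant.iff_exists_open _).mp h2 ⟨_, hp⟩
  obtain ⟨O', hO', rfl⟩ := isOpen_induced_iff.mp hO
  obtain ⟨g, hg, hg'⟩ := exists_localized (n := n) (hO'.preimage (continuous_constJet (k := k)))
    (p := p) hpO (g := fun q => f q - f p) (f.contMDiff.sub contMDiff_const).contMDiffOn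
  refine ⟨g, fun γ hγ => hg' γ _ fun h0 => ?_, hg⟩
  have hc := hQ.constJet_mem hγ
  have hfp : f (γ 0) = f p := by
    have := hOf ⟨_, hc⟩ h0
    simpa only [lift_zero_apply, base_constJet] using this
  have hadd : (fun q => f q - f p) ∘ γ = f ∘ γ + fun _ => -f p := by
    ext t
    simp [sub_eq_add_neg]
  rw [hadd, tser_add (contDiff_func_comp f γ).contDiffAt contDiffAt_const, tser_const,
    PowerSeries.X_pow_dvd_iff]
  intro m hm
  rw [map_add, PowerSeries.coeff_C]
  by_cases hm0 : m = 0
  · subst hm0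
    rw [coeff_zero_tser, if_pos rfl, Function.comp_apply, hfp, add_neg_cancel]
  · rw [if_neg hm0, add_zero]
    have := h1 ⟨m, hm.trans_le (by omega)⟩ (Nat.one_le_iff_ne_zero.mpr hm0)
      (Fin.le_def.mpr (Nat.lt_succ_iff.mp hm))
    exact lift_mem_vanishingIdeal.mp this γ hγ

/-- Coordinates that are adapted to the filtration by orders along `Q` at `p`. -/
theorem exists_adapted_coordinates (Q : Set (JetBundle n M k)) (p : M) :
    ∃ e ∈ IsManifold.maximalAtlas (𝓡 n) ∞ M, p ∈ e.source ∧ ∃ (w : Fin n → ℕ) (f : Fin n → Func n M),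
      Monotone w ∧ (∀ a, w a ≤ k + 1) ∧ (∀ q ∈ e.source, ∀ a, e q a = f a q) ∧
      (∀ a, f a ∈ curveOrderIdeal Q (w a)) ∧ ∀ i ≤ k + 1, ∀ g ∈ curveOrderIdeal Q i,
        ∀ v : EuclideanSpace ℝ (Fin n), (∀ a, i ≤ w a → v a = 0) → derivAt e p g v = 0 := by
  have he₀ := IsManifold.chart_mem_maximalAtlas (I := 𝓡 n) (n := ∞) p
  have hp₀ := mem_chart_source (EuclideanSpace ℝ (Fin n)) p
  set e₀ := chartAt (EuclideanSpace ℝ (Fin n)) p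
  -- The flag in the cotangent space at `p` formed by the differentials of the functions of order `≥
  -- i` along `Q`.
  let A : ℕ → Submodule ℝ (EuclideanSpace ℝ (Fin n) →L[ℝ] ℝ) := fun i =>
    ((curveOrderIdeal Q i).restrictScalars ℝ).map (derivAtₗ he₀ hp₀)
  have hA : Antitone A := fun i j hij => Submodule.map_mono (curveOrderIdeal_antitone Q hij)
  have hA0 : A 0 = ⊤ := by
    refine eq_top_iff.mpr fun φ _ => ?_
    obtain ⟨f, hf⟩ := exists_func_eq (n := n) e₀.open_source hp₀ (f := fun q => φ (e₀ q) - 0)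
      ((φ.contDiff.contMDiff.comp_contMDiffOn (contMDiffOn_of_mem_maximalAtlas he₀)).sub
        contMDiffOn_const)
    exact ⟨f, fun γ _ => by simp, derivAt_linear hp₀ φ hf⟩
  have hrank : Module.finrank ℝ (EuclideanSpace ℝ (Fin n) →L[ℝ] ℝ) = n := by
    rw [← LinearMap.toContinuousLinearMap.finrank_eq, Subspace.dual_finrank_eq,
      finrank_euclideanSpace_fin]
  obtain ⟨b, w, hb, hw, hwk, hbA, hspan⟩ := exists_adapted_basis hrank hA hA0 (k + 1)
  choose f hf hfb using hbA
  have hfb' : ∀ a, derivAt e₀ p (f a) = b a := hfb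
  obtain ⟨e, he, hp, hef⟩ := exists_chart_of_linearIndependent he₀ hp₀ (f := f)
    (by simpa only [hfb'] using hb)
  refine ⟨e, he, hp, w, f, hw, hwk, hef, hf, fun i hi g hg v hv => ?_⟩
  have h1 : derivAt e₀ p g ∈ Submodule.span ℝ (b '' {a | i ≤ w a}) := hspan i hi ⟨g, hg, rfl⟩
  rw [derivAt_eq_comp he he₀ hp hp₀]
  generalize derivAt e₀ p g = φ at h1 ⊢
  induction h1 using Submodule.span_induction with
  | mem φ hφ =>
    obtain ⟨a, ha, rfl⟩ := hφ
    rw [← hfb', ← derivAt_eq_comp he he₀ hp hp₀, derivAt_coord hp (a := a) (r := 0)]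
    · exact hv a ha
    · filter_upwards [e.open_source.mem_nhds hp] with q hq
      rw [hef q hq, sub_zero]
  | zero => simp
  | add φ ψ _ _ hφ hψ =>
    rw [ContinuousLinearMap.add_comp, add_apply, hφ, hψ, add_zero]
  | smul r φ _ hφ =>
    rw [ContinuousLinearMap.smul_comp, smul_apply, hφ, smul_zero]

/-- In adapted coordinates `Q` lies in the space of weighted jets by construction. Differentials of
functions vanishing on `Q` kill this space at the constant jet, so it is contained in the tangent
space of `Q` and the two sets coincide nearby. -/
theorem exists_isAdapted_of_mem {Q : Set (JetBundle n M k)} (hQs : IsSubmanifold Q)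
    (hgen : GeneratedByLifts Q) (hlow : LowerLiftsVanish Q) (hQ : IsCutOutByLifts Q) {p : M}
    (hp : constJet k p ∈ Q) : ∃ e w, IsAdapted Q e w ∧ p ∈ e.source := by
  obtain ⟨e, he, hpe, w, f, hw, hwk, hef, hf, hd⟩ := exists_adapted_coordinates Q p
  have hQw : ∀ γ : Curve n M, γ 0 ∈ e.source → jet k γ ∈ Q → IsWeightedCurve e w γ := by
    intro γ h0 hγ a
    have h1 := hf a γ hγ
    rwa [← tser_congr (φ := fun t => e (γ t) a)] at h1
    filter_upwards [eventually_curve_mem e.open_source γ h0] with t ht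
    exact hef _ ht a
  have hH := jetHomeo_mem_maximalAtlas (k := k) he
  set H := jetHomeo k e he with hHdef
  have hpH : (constJet k p : JetBundle n M k) ∈ H.source := hpe
  have hlift : ∀ (g : Func n M) (j : Fin (k + 1)), lift g j ∈ vanishingIdeal Q →
      ∀ z ∈ weightedJets n k w, derivAt H (constJet k p) (lift g j) z = 0 := by
    intro g j hg z hz
    rw [derivAt_lift_constJet he hpe]
    obtain ⟨g', hg', hgg'⟩ := hlow.exists_mem_curveOrderIdeal hQ hp hg
    have h1 := hd (j + 1) (Nat.succ_le_of_lt j.2) g' hg' (z j) fun a ha => hz a j ha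
    have h2 : ⇑g =ᶠ[𝓝 p] ⇑(g' + (constFunc (g p) : Func n M)) := by
      filter_upwards [hgg'] with q hq
      rw [smooth_add_apply, constFunc_apply, hq, sub_add_cancel]
    have h3 : derivAt e p (constFunc (g p) : Func n M) = 0 := derivAt_const _
    rw [derivAt_congr hpe h2, derivAt_add he hpe, h3, add_zero, h1]
  have hker : ∀ g : JetFunc n M k, (∀ v ∈ Q, g v = 0) → ∀ z ∈ weightedJets n k w,
      derivAt H (constJet k p) g z = 0 := by
    intro g hg z hz
    have hg' : g ∈ vanishingIdeal Q := hg
    rw [hgen] at hg'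
    -- The value at the point is carried along because the product rule for `r * g` involves it.
    suffices g (constJet k p) = 0 ∧ derivAt H (constJet k p) g z = 0 from this.2
    clear hg
    induction hg' using Submodule.span_induction with
    | mem g hg =>
      obtain ⟨hg, f, j, rfl⟩ := hg
      exact ⟨hg _ hp, hlift f j hg z hz⟩
    | zero => exact ⟨rfl, by rw [← derivAtₗ_apply hH hpH, map_zero]; rfl⟩
    | add g g' _ _ hg hg' =>
      rw [smooth_add_apply, derivAt_add hH hpH, add_apply, hg.1, hg.2, hg'.1, hg'.2]
      simp
    | smul r g _ hg =>
      rw [smul_eq_mul, smooth_mul_apply, derivAt_mul hH hpH, add_apply, smul_apply, smul_apply,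
        hg.1, hg.2]
      simp
  obtain ⟨c, hc, hpc, K, hK⟩ := hQs _ hp
  have hle := le_map_of_derivAt_eq_zero hc hH hpc hpH (fun v hv hvQ => (hK v hv).mp hvQ) hker
  have hZ : ∀ v ∈ H.source, v ∈ Q → H v ∈ weightedJets n k w := by
    intro v hv hvQ
    obtain ⟨γ, rfl⟩ := exists_jet v
    exact (isWeightedCurve_iff he hwk hv).mp (hQw γ hv hvQ)
  -- Coincidence is known only near the constant jet. The chart is restricted to points whose
  -- constant jets lie in `O`, and scaling reaches the rest of the fibres.
  obtain ⟨O, hO, hOo, hpO⟩ := eventually_nhds_iff.mp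
    (eventually_mem_of_le_map hc hH hpc hpH hp hK hZ hle)
  have hU : IsOpen (constJet k ⁻¹' O : Set M) := hOo.preimage continuous_constJet
  refine ⟨e.restr (constJet k ⁻¹' O), w, ⟨restr_mem_maximalAtlas he hU, hw, hwk,
    fun γ h0 => ?_⟩, ?_⟩
  · rw [e.restr_source' _ hU] at h0
    exact ⟨hQw γ h0.1, hQ.mem_of_isWeightedCurve he hOo
      (fun δ hδ h0 hδw => hO _ hδ ((isWeightedCurve_iff he hwk h0).mp hδw)) h0.1 h0.2⟩
  · rw [e.restr_source' _ hU]
    exact ⟨hpe, hpO⟩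

end AdaptedAtZeroSection

/-! ### Invariance of the weights and the main theorem -/

section MainResults

variable {n : ℕ} {M : Type*} [TopologicalSpace M] [ChartedSpace (EuclideanSpace ℝ (Fin n)) M]
  [IsManifold (𝓡 n) ∞ M] [T2Space M] [SecondCountableTopology M] {k : ℕ}

/-- In jet coordinates the line through the constant jet in the direction of `v`, placed in slot
`j`, stays in `Q`. The lift of order `j` vanishes along it, and its derivative there is the
derivative of `f` along `v`. -/
theorem IsAdapted.derivAt_eq_zero {Q : Set (JetBundle n M k)}
    {e : OpenPartialHomeomorph M (EuclideanSpace ℝ (Fin n))} {w : Fin n → ℕ}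
    (h : IsAdapted Q e w) {p : M} (hpe : p ∈ e.source) (hp : constJet k p ∈ Q) {j : Fin (k + 1)}
    {f : Func n M} (hf : f ∈ curveOrderIdeal Q (j + 1)) {v : EuclideanSpace ℝ (Fin n)}
    (hv : ∀ a, (j : ℕ) < w a → v a = 0) : derivAt e p f v = 0 := by
  have he := h.mem_maximalAtlas
  have hH := jetHomeo_mem_maximalAtlas (k := k) he
  set H := jetHomeo k e he with hHdef
  have hpH : (constJet k p : JetBundle n M k) ∈ H.source := hpe
  let z : Fin (k + 1) → EuclideanSpace ℝ (Fin n) := Pi.single j v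
  have hz : z ∈ weightedJets n k w := by
    intro a i hi
    by_cases hij : i = j
    · subst hij
      simpa [z] using hv a hi
    · simp [z, hij]
  have hp0 : H (constJet k p) ∈ weightedJets n k w := (h.mem_iff (u := constJet k p) hpe).mp hp
  have h1 : derivAt e p f v = derivAt H (constJet k p) (lift f j) z := by
    rw [derivAt_lift_constJet he hpe]
    simp [z]
  rw [h1]
  have h2 : HasDerivAt (fun s : ℝ => H (constJet k p) + s • z) z 0 := by
    simpa using ((hasDerivAt_id (0 : ℝ)).smul_const z).const_add (H (constJet k p))
  have h3 := hasFDerivAt_derivAt hH hpH (lift f j)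
  have h4 : H (constJet k p) = H (constJet k p) + (0 : ℝ) • z := by simp
  rw [h4] at h3
  have h5 := h3.comp_hasDerivAt (0 : ℝ) h2
  refine h5.unique ((hasDerivAt_const (0 : ℝ) (0 : ℝ)).congr_of_eventuallyEq ?_)
  have h6 : ∀ᶠ s : ℝ in 𝓝 0, H (constJet k p) + s • z ∈ H.target := by
    refine h2.continuousAt.eventually (H.open_target.mem_nhds ?_)
    beta_reduce
    rw [← h4]
    exact H.map_source hpH
  filter_upwards [h6] with s hs
  have h7 : H.symm (H (constJet k p) + s • z) ∈ Q := by
    refine (h.mem_iff (H.map_target hs)).mpr ?_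
    have h8 : jetCoord e (H.symm (H (constJet k p) + s • z)) =
        H (constJet k p) + s • z := H.right_inv hs
    rw [h8]
    exact Submodule.add_mem _ hp0 (Submodule.smul_mem _ s hz)
  have h9 : lift f j ∈ vanishingIdeal Q := lift_mem_vanishingIdeal.mpr fun γ hγ =>
    PowerSeries.X_pow_dvd_iff.mp (hf γ hγ) j (Nat.lt_succ_self _)
  exact h9 _ h7

/-- The coordinates of `e'` of weight `> j` belong to `curveOrderIdeal Q (j + 1)`. Their
differentials are independent and lie in the span of the differentials of the coordinates of `e` of
weight `> j`. -/
theorem IsAdapted.card_le {Q : Set (JetBundle n M k)}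
    {e e' : OpenPartialHomeomorph M (EuclideanSpace ℝ (Fin n))} {w w' : Fin n → ℕ}
    (h : IsAdapted Q e w) (h' : IsAdapted Q e' w') {p : M} (hp : constJet k p ∈ Q)
    (hpe : p ∈ e.source) (hpe' : p ∈ e'.source) (j : Fin (k + 1)) :
    Fintype.card {a // (j : ℕ) < w' a} ≤ Fintype.card {a // (j : ℕ) < w a} := by
  classical
  have he := h.mem_maximalAtlas
  have he' := h'.mem_maximalAtlas
  choose f hf hfe using h'.exists_localized_coord hpe'
  have hproj : ∀ a, (derivAt e p (f a)).comp (transitionDeriv e' e p) =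
      EuclideanSpace.proj (𝕜 := ℝ) a := by
    intro a
    rw [← derivAt_eq_comp he' he hpe' hpe]
    refine derivAt_coord hpe' (r := 0) ?_
    simpa only [sub_zero] using hfe a
  have hli : LinearIndependent ℝ fun a => derivAt e p (f a) := by
    rw [Fintype.linearIndependent_iff]
    intro g hg b
    have h1 := DFunLike.congr_fun hg (transitionDeriv e' e p (EuclideanSpace.single b (1 : ℝ)))
    have h2 : ∀ a, derivAt e p (f a) (transitionDeriv e' e p (EuclideanSpace.single b (1 : ℝ))) =
        if a = b then 1 else 0 := fun a => by
      have := DFunLike.congr_fun (hproj a) (EuclideanSpace.single b (1 : ℝ))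
      rw [ContinuousLinearMap.comp_apply] at this
      rw [this]
      simp
    simpa [h2] using h1
  have hspan : range (fun a : {a // (j : ℕ) < w' a} => derivAt e p (f a)) ≤
      Submodule.span ℝ (range fun b : {b // (j : ℕ) < w b} => EuclideanSpace.proj (𝕜 := ℝ) b.1) := by
    rintro _ ⟨a, rfl⟩
    have h0 : ∀ b, ¬ (j : ℕ) < w b → derivAt e p (f a) (EuclideanSpace.single b 1) = 0 := by
      intro b hb
      refine h.derivAt_eq_zero hpe hp (curveOrderIdeal_antitone Q a.2 (hf a)) fun b' hb' => ?_
      have : b' ≠ b := fun h => hb (h ▸ hb')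
      simp [this]
    have h1 : derivAt e p (f a) = ∑ b, derivAt e p (f a) (EuclideanSpace.single b 1) •
        EuclideanSpace.proj (𝕜 := ℝ) b := by
      ext v
      have hv : v = ∑ b, v b • EuclideanSpace.single b (1 : ℝ) := by
        ext b
        simp [Pi.single_apply]
      conv_lhs => rw [hv]
      rw [map_sum, sum_apply]
      refine Finset.sum_congr rfl fun b _ => ?_
      rw [map_smul, smul_eq_mul, mul_comm]
      rfl
    beta_reduce
    rw [h1]
    refine Submodule.sum_mem _ fun b _ => ?_
    by_cases hb : (j : ℕ) < w b
    · exact Submodule.smul_mem _ _ (Submodule.subset_span ⟨⟨b, hb⟩, rfl⟩)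
    · rw [h0 b hb, zero_smul]
      exact Submodule.zero_mem _
  rw [← finrank_span_eq_card (hli.comp (Subtype.val : {a // (j : ℕ) < w' a} → Fin n)
    Subtype.val_injective)]
  exact (Submodule.finrank_mono (Submodule.span_le.mpr hspan)).trans (finrank_range_le_card _)

/-- If `w a < w' a`, count at the level `j = w a`: by monotonicity all indices `≥ a` count for `w'`,
but only indices `> a` can count for `w`. -/
theorem le_of_card_le {w w' : Fin n → ℕ} (hw : Monotone w) (hw' : Monotone w') {m : ℕ}
    (hm : ∀ a, w' a ≤ m) (h : ∀ j < m, Fintype.card {a // j < w' a} ≤ Fintype.card {a // j < w a}) :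
    w' ≤ w := by
  intro a
  by_contra hlt
  push Not at hlt
  have h1 := h (w a) (hlt.trans_le (hm a))
  rw [Fintype.card_subtype, Fintype.card_subtype] at h1
  have h2 : Finset.Ici a ⊆ Finset.univ.filter fun b => w a < w' b := fun b hb => by
    simpa using hlt.trans_le (hw' (Finset.mem_Ici.mp hb))
  have h3 : (Finset.univ.filter fun b => w a < w b) ⊆ Finset.Ioi a := fun b hb => by
    rw [Finset.mem_Ioi]
    by_contra hba
    exact absurd (Finset.mem_filter.mp hb).2 (not_lt.mpr (hw (not_lt.mp hba)))
  have h4 := (Finset.card_le_card h2).trans (h1.trans (Finset.card_le_card h3))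
  rw [Fin.card_Ici, Fin.card_Ioi] at h4
  omega

theorem IsAdapted.weights_eq {Q : Set (JetBundle n M k)}
    {e e' : OpenPartialHomeomorph M (EuclideanSpace ℝ (Fin n))} {w w' : Fin n → ℕ}
    (h : IsAdapted Q e w) (h' : IsAdapted Q e' w') {p : M} (hp : constJet k p ∈ Q)
    (hpe : p ∈ e.source) (hpe' : p ∈ e'.source) : w = w' :=
  le_antisymm
    (le_of_card_le h'.monotone h.monotone h.le_order fun j hj =>
      h'.card_le h hp hpe' hpe ⟨j, hj⟩)
    (le_of_card_le h.monotone h'.monotone h'.le_order fun j hj =>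
      h.card_le h' hp hpe hpe' ⟨j, hj⟩)

theorem forall_exists_isAdapted (hn : 0 < n) {Q : Set (JetBundle n M k)} (hQ : IsClosed Q)
    (hQs : IsSubmanifold Q) (hgen : GeneratedByLifts Q) (hlow : LowerLiftsVanish Q) (p : M) :
    ∃ e w, IsAdapted Q e w ∧ p ∈ e.source := by
  have hcut := isCutOutByLifts_of_generatedByLifts hQ hgen
  by_cases hp : constJet k p ∈ Q
  · exact exists_isAdapted_of_mem hQs hgen hlow hcut hp
  -- Any monotone weights bounded by `k + 1` and not all zero would do; `0 < n` ensures that the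
  -- constant weight `k + 1` is not vacuous.
  · obtain ⟨e, he⟩ := hcut.exists_isAdapted_of_notMem hQ hp (w := fun _ => k + 1) monotone_const
      (fun _ => le_rfl) ⟨⟨0, hn⟩, Nat.succ_pos k⟩
    exact ⟨e, _, he⟩

/-- If `M` and `Q` are connected, then the weights can be chosen to be the same everywhere. -/
theorem exists_weights_forall_isAdapted (hn : 0 < n) [ConnectedSpace M] {Q : Set (JetBundle n M k)}
    (hQ : IsClosed Q) (hQc : IsPreconnected Q) (hcut : IsCutOutByLifts Q)
    (hcov : ∀ p : M, ∃ e w, IsAdapted Q e w ∧ p ∈ e.source) :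
    ∃ w : Fin n → ℕ, ∀ p : M, ∃ e, IsAdapted Q e w ∧ p ∈ e.source := by
  rcases Q.eq_empty_or_nonempty with hempty | ⟨u₁, hu₁⟩
  · refine ⟨fun _ => k + 1, fun p => hcut.exists_isAdapted_of_notMem hQ ?_ monotone_const
      (fun _ => le_rfl) ⟨⟨0, hn⟩, Nat.succ_pos k⟩⟩
    simp [hempty]
  have hbase : ∀ u ∈ Q, constJet k u.base ∈ Q := by
    intro u hu
    obtain ⟨γ, rfl⟩ := exists_jet u
    exact hcut.constJet_mem hu
  choose e w hew hpe using hcov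
  have hconst : IsLocallyConstant fun u : Q => w (u : JetBundle n M k).base := by
    rw [IsLocallyConstant.iff_eventually_eq]
    intro u
    have : ∀ᶠ v : Q in 𝓝 u, (v : JetBundle n M k).base ∈ (e (u : JetBundle n M k).base).source :=
      (continuous_base.comp continuous_subtype_val).continuousAt.eventually
        ((e _).open_source.mem_nhds (hpe _))
    filter_upwards [this] with v hv
    exact (hew _).weights_eq (hew _) (hbase v v.2) (hpe _) hv
  have := Subtype.preconnectedSpace hQc
  have hw : ∀ p, constJet k p ∈ Q → w p = w u₁.base := fun p hp =>
    hconst.apply_eq_of_preconnectedSpace ⟨constJet k p, hp⟩ ⟨u₁, hu₁⟩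
  have hN : ∀ p, constJet k p ∈ Q → ∃ e, IsAdapted Q e (w u₁.base) ∧ p ∈ e.source := fun p hp =>
    ⟨e p, hw p hp ▸ hew p, hpe p⟩
  refine ⟨w u₁.base, fun p => ?_⟩
  by_cases hp : constJet k p ∈ Q
  · exact hN p hp
  -- Off the base of `Q` the same weights work unless all are zero. In that case `Q` contains all
  -- jets over each adapted chart meeting its base, so its base is open and closed, hence all of
  -- `M`.
  by_cases hw0 : ∃ a, 0 < w u₁.base a
  · exact hcut.exists_isAdapted_of_notMem hQ hp (hew _).monotone (hew _).le_order hw0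
  push Not at hw0
  have hopen : IsOpen {q : M | constJet k q ∈ Q} := by
    rw [isOpen_iff_mem_nhds]
    intro q hq
    obtain ⟨e', he', hqe'⟩ := hN q hq
    filter_upwards [e'.open_source.mem_nhds hqe'] with q' hq'
    refine (he'.mem_iff (u := constJet k q') hq').mpr fun a j hj => ?_
    exact absurd hj (by rw [Nat.le_zero.mp (hw0 a)]; exact Nat.not_lt_zero _)
  have huniv := IsClopen.eq_univ ⟨hQ.preimage continuous_constJet, hopen⟩ ⟨u₁.base, hbase _ hu₁⟩
  exact absurd (huniv.ge (mem_univ p)) hp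

theorem weighting_iff (hn : 0 < n) (Q : Set (JetBundle n M k)) (hQ : IsClosed Q)
    (hQs : IsSubmanifold Q) :
    ((∃ F : ℕ → Ideal (Func n M), IsWeighting (k + 1) F ∧ Q = cutOut k F) ↔
      GeneratedByLifts Q ∧ LowerLiftsVanish Q) ∧
    (∀ F : ℕ → Ideal (Func n M), IsWeighting (k + 1) F → Q = cutOut k F →
      ∀ (j : Fin (k + 1)) (f : Func n M), f ∈ F (j + 1) ↔
        lift f (0 : Fin (k + 1)) ∈ vanishingIdeal Q ∧ lift f j ∈ vanishingIdeal Q) ∧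
    (ConnectedSpace M → IsPreconnected Q →
      ((∃ (w : Fin n → ℕ) (F : ℕ → Ideal (Func n M)),
          IsWeightingWithWeights (k + 1) w F ∧ Q = cutOut k F) ↔
        GeneratedByLifts Q ∧ LowerLiftsVanish Q)) := by
  refine ⟨?_, ?_, fun hM hQc => ?_⟩
  · rw [exists_isWeighting_iff]
    exact ⟨fun h => ⟨generatedByLifts_of_isAdapted h, lowerLiftsVanish_of_isAdapted h⟩,
      fun h => forall_exists_isAdapted hn hQ hQs h.1 h.2⟩
  · intro F hF hQF j f
    have hcov := exists_isWeighting_iff.mp ⟨F, hF, hQF⟩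
    obtain ⟨A, w, H⟩ := hF
    rw [H.eq_curveOrderIdeal, ← hQF]
    exact mem_curveOrderIdeal_iff_lift (lowerLiftsVanish_of_isAdapted hcov) j f
  · simp only [exists_isWeightingWithWeights_iff]
    constructor
    · rintro ⟨w, h⟩
      have hcov : ∀ p : M, ∃ e w, IsAdapted Q e w ∧ p ∈ e.source := fun p => by
        obtain ⟨e, he⟩ := h p
        exact ⟨e, w, he⟩
      exact ⟨generatedByLifts_of_isAdapted hcov, lowerLiftsVanish_of_isAdapted hcov⟩
    · intro h
      exact exists_weights_forall_isAdapted hn hQ hQc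
        (isCutOutByLifts_of_generatedByLifts hQ h.1) (forall_exists_isAdapted hn hQ hQs h.1 h.2)

end MainResults

end JetWeighting

theorem mainTheorem1 {n r : ℕ} (hn : 0 < n) (hr : 0 < r)
    (M : Type*) [TopologicalSpace M] [T2Space M] [SecondCountableTopology M]
    [ChartedSpace (EuclideanSpace ℝ (Fin n)) M] [IsManifold (𝓡 n) ∞ M]
    (Q : Set (JetBundle n M (r - 1))) (hQ : IsClosed Q) (hQs : IsSubmanifold Q) :
    ((∃ F : ℕ → Ideal (Func n M), IsWeighting r F ∧ Q = cutOut (r - 1) F) ↔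
      GeneratedByLifts Q ∧ LowerLiftsVanish Q) ∧
    (∀ F : ℕ → Ideal (Func n M), IsWeighting r F → Q = cutOut (r - 1) F →
      ∀ (j : Fin (r - 1 + 1)) (f : Func n M), f ∈ F (j + 1) ↔
        lift f (0 : Fin (r - 1 + 1)) ∈ vanishingIdeal Q ∧ lift f j ∈ vanishingIdeal Q) ∧
    (ConnectedSpace M → IsPreconnected Q →
      ((∃ (w : Fin n → ℕ) (F : ℕ → Ideal (Func n M)),
          IsWeightingWithWeights r w F ∧ Q = cutOut (r - 1) F) ↔
        GeneratedByLifts Q ∧ LowerLiftsVanish Q)) := by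
  obtain ⟨k, rfl⟩ := Nat.exists_eq_succ_of_ne_zero hr.ne'
  exact weighting_iff hn Q hQ hQs
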